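/- Let $N\ge 1$ be an integer and let $F_1(s),\dots,F_N(s)$ be functions such that, for each $j$: (I) $F_j(s)=\sum_{n\ge1}a_j(n)n^{-s}$, absolutely convergent for $\sigma=\operatorname{Re}s>1$; (II) $\log F_j(s)=\sum_p\sum_{k\ge1}b_j(p^k)p^{-ks}$, absolutely convergent for $\sigma>1$, and there are constants $\theta_j<\tfrac12$ and $K_j$ with $|b_j(p^k)|\le K_jp^{k\theta_j}$ for every prime $p$ and every $k\ge1$. Assume that $F_1,\dots,F_N$ are orthogonal, i.e. there are real numbers $m_{i,j}$ with $m_{i,i}>0$, and $m_{i,j}=0$ for $i\ne j$, such that for all $i,j$ $$\sum_{p\le x}\frac{a_i(p)\overline{a_j(p)}}{p}=(m_{i,j}+o(1))\log\log x\qquad(x\to\infty).$$ For a prime $p$ let $\log F_{j,p}(s)=\sum_{k\ge1}b_j(p^k)p^{-ks}$ and $F_{j,p}=\exp(\log F_{j,p})$ (for $\sigma\ge1$ these series converge absolutely). Let $p_m$ be the $m$-th prime and, for $\boldsymbol\theta=(\theta_1,\dots,\theta_n)\in\mathbb R^n$, put $$F_{j,n}(s,\boldsymbol\theta)=\prod_{m=1}^nF_{j,p_m}\Big(s+\frac{2\pi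 i\theta_m}{\log p_m}\Big),\qquad \log F_{j,n}(s,\boldsymbol\theta)=\sum_{m=1}^n\log F_{j,p_m}\Big(s+\frac{2\pi i\theta_m}{\log p_m}\Big),$$ $\boldsymbol{\log F}_n=(\log F_{1,n},\dots,\log F_{N,n})$, and let $F_{j,n}'$ denote the derivative with respect to $s$. For $\sigma\ge1$, $j\ne l$ in $\{1,\dots,N\}$, $\tau\in\{1,-1,i,-i\}$ and Borel sets $E\subseteq\mathbb C^N$ let, with $W=\{\boldsymbol\theta\in[0,1)^n:\boldsymbol{\log F}_n(\sigma,\boldsymbol\theta)\in E\}$, $$\lambda_{\sigma,n;j}(E)=\int_W\Big|\frac{F_{j,n}'}{F_{j,n}}(\sigma,\boldsymbol\theta)\Big|^2d\boldsymbol\theta,\qquad \lambda_{\sigma,n;j,l;\tau}(E)=\int_W\Big|\frac{F_{j,n}'}{F_{j,n}}(\sigma,\boldsymbol\theta)+\tau\frac{F_{l,n}'}{F_{l,n}}(\sigma,\boldsymbol\theta)\Big|^2d\boldsymbol\theta .$$ Then there are integers $n_k\ge1$ ($k=0,1,2,\dots$), depending only on $k$ and $F_1,\dots,F_N$, such that the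 following holds for all $j,l\in\{1,\dots,N\}$ with $j\ne l$ and all $\tau\in\{\pm1,\pm i\}$. 1. For every $n\ge n_0$ and every $\sigma\ge1$ the measures $\lambda_{\sigma,n;j}$ and $\lambda_{\sigma,n;j,l;\tau}$ are absolutely continuous with respect to Lebesgue measure on $\mathbb C^N$, with continuous densities $G_{\sigma,n;j}$ and $G_{\sigma,n;j,l;\tau}$; more generally, for every $k\ge0$, every $n\ge n_k$ and every $\sigma\ge1$ they are absolutely continuous with densities $G_{\sigma,n;j},\,G_{\sigma,n;j,l;\tau}\in\mathcal C^k(\mathbb C^N)$ (differentiability being in the real sense). 2. For every $\sigma\ge1$, as $n\to\infty$, the finite measures $\lambda_{\sigma,n;j}$ and $\lambda_{\sigma,n;j,l;\tau}$ converge weakly to finite measures $\lambda_{\sigma;j}$ and $\lambda_{\sigma;j,l;\tau}$, which are absolutely continuous with densities $G_{\sigma;j},\,G_{\sigma;j,l;\tau}\in\mathcal C^\infty(\mathbb C^N)$. 3. For every $M>1$ and every order $k\ge0$, the partial derivatives of order $k$ of $G_{\sigma,n;j}$ and of $G_{\sigma,n;j,l;\tau}$ (defined for $n\ge n_k$; for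 $k=0$ the functions themselves) converge, as $n\to\infty$, to those of $G_{\sigma;j}$ and of $G_{\sigma;j,l;\tau}$, uniformly for $\boldsymbol x\in\mathbb C^N$ and $1\le\sigma\le M$. -/

import Mathlib

open MeasureTheory Filter Topology

/-- Property (I): `F(s) = ∑_{n ≥ 1} a(n) n^{-s}`, absolutely convergent for `Re s > 1`. -/
def HasDirichletSeries (F : ℂ → ℂ) (a : ℕ → ℂ) : Prop :=
  ∀ s : ℂ, 1 < s.re → LSeriesHasSum a s (F s)

/-- The logarithm of the local factor at `p`: `log F_p(s) = ∑_{k ≥ 1} b(p^k) p^{-ks}`. -/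
noncomputable def localLog (b : ℕ → ℂ) (p : ℕ) (s : ℂ) : ℂ :=
  ∑' k : ℕ, b (p ^ (k + 1)) / (p : ℂ) ^ (((k : ℂ) + 1) * s)

/-- Property (II): `log F(s) = ∑_p ∑_{k ≥ 1} b(p^k) p^{-ks}`, absolutely convergent for
`Re s > 1`, with `|b(p^k)| ≤ K p^{kθ}` for all primes `p` and all `k ≥ 1`, for some `K` and some
`θ < 1/2`. Only the values of `b` at prime powers matter. -/
def HasLogEulerProduct (F : ℂ → ℂ) (b : ℕ → ℂ) : Prop :=
  (∀ s : ℂ, 1 < s.re →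
    Summable (fun q : Nat.Primes × ℕ =>
      b ((q.1 : ℕ) ^ (q.2 + 1)) / ((q.1 : ℕ) : ℂ) ^ (((q.2 : ℂ) + 1) * s)) ∧
    Complex.exp (∑' p : Nat.Primes, localLog b (p : ℕ) s) = F s) ∧
  ∃ θ : ℝ, θ < 1 / 2 ∧ ∃ K : ℝ, ∀ p : ℕ, p.Prime → ∀ k : ℕ, 1 ≤ k →
    ‖b (p ^ k)‖ ≤ K * (p : ℝ) ^ ((k : ℝ) * θ)

/-- Orthogonality, in terms of the Dirichlet coefficients `a i` of the functions `F_i`: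
`∑_{p ≤ x} a_i(p) conj(a_j(p)) / p = (m_{ij} + o(1)) log log x` as `x → ∞`, where `m_{ii} > 0`
and `m_{ij} = 0` for `i ≠ j`. -/
def AreOrthogonal {N : ℕ} (a : Fin N → ℕ → ℂ) : Prop :=
  ∃ m : Fin N → Fin N → ℝ,
    (∀ i, 0 < m i i) ∧ (∀ i j, i ≠ j → m i j = 0) ∧
    ∀ i j, (fun x : ℝ =>
        (∑ p ∈ (Finset.Icc 1 ⌊x⌋₊).filter Nat.Prime,
          a i p * (starRingEnd ℂ) (a j p) / (p : ℂ))
          - ((m i j * Real.log (Real.log x) : ℝ) : ℂ))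
      =o[atTop] (fun x : ℝ => Real.log (Real.log x))

/-- The primes in increasing order; `nthPrime 0 = 2`, so this is `p_{m+1}`. -/
noncomputable def nthPrime (m : ℕ) : ℕ := Nat.nth Nat.Prime m

/-- The shifted argument `s + 2πi t / log p`. -/
noncomputable def twist (p : ℕ) (s : ℂ) (t : ℝ) : ℂ :=
  s + Complex.I * ((2 * Real.pi * t / Real.log p : ℝ) : ℂ)

/-- `log F_n(s, θ) = ∑_{m=1}^n log F_{p_m}(s + 2πi θ_m / log p_m)`. -/
noncomputable def logPartial (b : ℕ → ℂ) (n : ℕ) (s : ℂ) (θ : Fin n → ℝ) : ℂ :=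
  ∑ m : Fin n, localLog b (nthPrime m) (twist (nthPrime m) s (θ m))

/-- `F_n(s, θ) = ∏_{m=1}^n F_{p_m}(s + 2πi θ_m / log p_m)`, with `F_p = exp (log F_p)`. -/
noncomputable def partialProd (b : ℕ → ℂ) (n : ℕ) (s : ℂ) (θ : Fin n → ℝ) : ℂ :=
  ∏ m : Fin n, Complex.exp (localLog b (nthPrime m) (twist (nthPrime m) s (θ m)))

/-- `(F_n' / F_n)(σ, θ)`, the derivative being taken in the complex variable `s` at `s = σ`. -/
noncomputable def partialLogDeriv (b : ℕ → ℂ) (n : ℕ) (σ : ℝ) (θ : Fin n → ℝ) : ℂ :=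
  logDeriv (fun s : ℂ => partialProd b n s θ) (σ : ℂ)

/-- The measure `E ↦ ∫_{θ ∈ [0,1)^n, (log F_{1,n}(σ,θ), …, log F_{N,n}(σ,θ)) ∈ E} |w(θ)|² dθ`
on `ℂ^N`. -/
noncomputable def weightedDistribution {N : ℕ} (b : Fin N → ℕ → ℂ) (σ : ℝ) (n : ℕ)
    (w : (Fin n → ℝ) → ℂ) : Measure (Fin N → ℂ) :=
  Measure.map (fun (θ : Fin n → ℝ) (h : Fin N) => logPartial (b h) n (σ : ℂ) θ)
    ((volume.restrict (Set.univ.pi fun _ : Fin n => Set.Ico (0 : ℝ) 1)).withDensity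
      fun θ => ENNReal.ofReal (‖w θ‖ ^ 2))

/-- `λ_{σ,n;j}`. -/
noncomputable def lambdaSingle {N : ℕ} (b : Fin N → ℕ → ℂ) (j : Fin N) (σ : ℝ) (n : ℕ) :
    Measure (Fin N → ℂ) :=
  weightedDistribution b σ n fun θ => partialLogDeriv (b j) n σ θ

/-- `λ_{σ,n;j,l;τ}`. -/
noncomputable def lambdaPair {N : ℕ} (b : Fin N → ℕ → ℂ) (j l : Fin N) (τ : ℂ) (σ : ℝ) (n : ℕ) :
    Measure (Fin N → ℂ) :=
  weightedDistribution b σ n fun θ =>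
    partialLogDeriv (b j) n σ θ + τ * partialLogDeriv (b l) n σ θ

/-- `μ` is absolutely continuous with respect to Lebesgue measure on `ℂ^N`, and `G` is a
(nonnegative, integrable) density of it. -/
def IsAbsContWithDensity {N : ℕ} (μ : Measure (Fin N → ℂ)) (G : (Fin N → ℂ) → ℝ) : Prop :=
  μ ≪ volume ∧ (∀ x, 0 ≤ G x) ∧ Integrable G volume ∧
    μ = volume.withDensity fun x => ENNReal.ofReal (G x)

/-- Weak convergence of a sequence of finite measures on `ℂ^N` to a finite measure. -/
def ConvergesWeakly {N : ℕ} (μs : ℕ → Measure (Fin N → ℂ)) (μ : Measure (Fin N → ℂ)) : Prop :=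
  (∀ n, IsFiniteMeasure (μs n)) ∧ IsFiniteMeasure μ ∧
    ∀ f : BoundedContinuousFunction (Fin N → ℂ) ℝ,
      Tendsto (fun n => ∫ x, f x ∂(μs n)) atTop (𝓝 (∫ x, f x ∂μ))

/-! Fix coefficients `c_j` and weight the box by `|∑ c_j F_{j,n}'/F_{j,n}|²`; `c = e_j` and `c = e_j
+ τ e_l` give the two families of measures. At each prime the logarithm and its derivative are
trigonometric series in `θ_m` without constant term, so on the box everything is a sum of
independent variables of mean zero. The characteristic function of the weighted law at `2πy` is `R_n
= E[S conj(S) exp(i ∑ g_m)]`, where `S = ∑ f_m` is the weight and `g_m` is the phase at `p_m` in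
direction `y`. Together with the moments carrying fewer factors of `S`, it satisfies a linear
recursion in `n` whose coefficients are one-prime integrals: `K = E[e^{ig}]`, `A = E[f e^{ig}]`, `B
= E[conj(f) e^{ig}]`, `D = E[|f|² e^{ig}]`.

Decay: in every term of the expansion of `R_n` at most two factors `K_m` are missing. If the first
frequency of the phase dominates at `p_m`, then `K_m = O(‖y‖^{-1/3})`
(`norm_integral_exp_trigSeries_le`); the optimal exponent is not needed, because as many such primes
as desired are available. Domination holds as soon as `|∑ conj(y_j) b_j(p)| ≥ C p^{2θ-1} ‖y‖`. If
this failed at all primes of a long block, `∑ |∑ conj(y_j) b_j(p)|² / p` would stay `O(‖y‖²)`,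
because `∑ p^{4θ-3}` converges, whereas orthogonality makes it grow like `‖y‖² log log x`. So every
direction has `t` good primes among the first `n₀ t` (`AreOrthogonal.exists_good_primes`), with `n₀`
independent of `y` and `σ`. Orthogonality concerns `a_j(p)`, but `a_j(p) = b_j(p)`
(`coeff_prime_eq_of_hasLogEulerProduct`).

Convergence: with `Y = 1 + ‖y‖`, mean zero gives `K - 1 = O(Y² ε)`, `A, B = O(Y ε)`, `D = O(ε)`,
where `∑ ε_m < ∞` because `θ < 1/2`. Hence `R_n` is Cauchy at the cost of a fixed power of `Y`,
which a few more good primes absorb (`exists_rapid_limit_of_momentRecursion`).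

Inversion: rapid decay of the characteristic functions, uniform in `n` and locally in `σ`, gives
smooth densities converging uniformly with all derivatives; convergence of the masses and Scheffé's
lemma then give weak convergence (`exists_smooth_limit_densities`). -/

/-! ### Fourier inversion for finite measures with integrable characteristic function -/

section FourierDensity

set_option linter.unusedSectionVars false

open scoped FourierTransform RealInnerProductSpace

variable {V : Type*} [NormedAddCommGroup V] [InnerProductSpace ℝ V] [MeasurableSpace V]
  [BorelSpace V] [FiniteDimensional ℝ V]

/-- The characteristic function of `μ`, normalised so that it is the inverse Fourier transform. -/
noncomputable def scaledCharFun (μ : Measure V) (y : V) : ℂ := charFun μ ((2 * Real.pi) • y)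

theorem continuous_scaledCharFun (μ : Measure V) [IsFiniteMeasure μ] :
    Continuous (scaledCharFun μ) := by
  have : Continuous (charFun μ) := by
    refine continuous_of_dominated (bound := fun _ => 1) ?_ ?_ (integrable_const _) ?_
    · intro x; exact (by fun_prop : Measurable _).aestronglyMeasurable
    · intro x; exact ae_of_all _ fun y => (by
        rw [Complex.norm_exp_ofReal_mul_I])
    · exact ae_of_all _ fun y => by fun_prop
  exact this.comp (by fun_prop)

/-- The Gaussian approximate identity of width `c⁻¹`. -/
noncomputable def gaussianKernel (c : ℝ) (z : V) : ℝ :=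
  (Real.pi / c⁻¹) ^ ((Module.finrank ℝ V : ℝ) / 2) * Real.exp (-Real.pi ^ 2 * ‖z‖ ^ 2 / c⁻¹)

theorem gaussianKernel_nonneg {c : ℝ} (hc : 0 < c) (z : V) : 0 ≤ gaussianKernel c z := by
  unfold gaussianKernel; positivity

theorem gaussianKernel_coe {c : ℝ} (hc : 0 < c) (z : V) :
    ((gaussianKernel c z : ℝ) : ℂ) = (Real.pi / ((c⁻¹ : ℝ) : ℂ)) ^ (Module.finrank ℝ V / 2 : ℂ) *
      Complex.exp (-Real.pi ^ 2 * ‖z‖ ^ 2 / ((c⁻¹ : ℝ) : ℂ)) := by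
  unfold gaussianKernel
  push_cast
  rw [Complex.ofReal_cpow (by positivity)]
  push_cast
  rfl

theorem integrable_gaussianKernel {c : ℝ} (hc : 0 < c) :
    Integrable (gaussianKernel c : V → ℝ) := by
  have h := GaussianFourier.integrable_cexp_neg_mul_sq_norm_add (V := V)
    (b := ((Real.pi ^ 2 * c : ℝ) : ℂ)) (by rw [Complex.ofReal_re]; positivity) 0 0
  have h2 := (h.re).const_mul ((Real.pi / c⁻¹) ^ ((Module.finrank ℝ V : ℝ) / 2))
  refine h2.congr (ae_of_all _ fun z => ?_)
  simp only [gaussianKernel]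
  congr 1
  rw [show (-((Real.pi ^ 2 * c : ℝ) : ℂ) * (‖z‖ : ℂ) ^ 2 + 0 * ((⟪(0 : V), z⟫ : ℝ) : ℂ))
    = ((-Real.pi ^ 2 * ‖z‖ ^ 2 / c⁻¹ : ℝ) : ℂ) by push_cast; simp; ring]
  rw [← Complex.ofReal_exp]; rfl

theorem integral_gaussianKernel {c : ℝ} (hc : 0 < c) :
    ∫ z : V, gaussianKernel c z = 1 := by
  unfold gaussianKernel
  rw [integral_const_mul]
  have : ∀ z : V, Real.exp (-Real.pi ^ 2 * ‖z‖ ^ 2 / c⁻¹)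
      = Real.exp (-(Real.pi ^ 2 * c) * ‖z‖ ^ 2) := fun z => by
    congr 1; rw [div_inv_eq_mul]; ring
  simp_rw [this]
  rw [GaussianFourier.integral_rexp_neg_mul_sq_norm (by positivity), ← Real.mul_rpow
    (by positivity) (by positivity)]
  rw [show Real.pi / c⁻¹ * (Real.pi / (Real.pi ^ 2 * c)) = 1 by field_simp]
  exact Real.one_rpow _

/-- Fubini brings the Gaussian-damped inversion integral inside `μ`, where it becomes the transform
of a Gaussian. The regularised inversion is thus an average of `μ` against a positive kernel, which
is the source of both realness and nonnegativity of the density. -/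
theorem integral_exp_smul_fourierChar_scaledCharFun (μ : Measure V) [IsFiniteMeasure μ] {c : ℝ}
    (hc : 0 < c) (x : V) :
    ∫ w : V, Complex.exp (-(c : ℂ)⁻¹ * ‖w‖ ^ 2) •
        ((Real.fourierChar (-⟪w, x⟫)) • scaledCharFun μ w) =
      ((∫ z, gaussianKernel c (z - x) ∂μ : ℝ) : ℂ) := by
  have key : ∀ w z : V, Complex.exp (-(c : ℂ)⁻¹ * ‖w‖ ^ 2) •
      ((Real.fourierChar (-⟪w, x⟫)) • Complex.exp ((⟪z, (2 * Real.pi) • w⟫ : ℝ) * Complex.I))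
      = (Real.fourierChar (-⟪w, x⟫)) • Complex.exp (-((c⁻¹ : ℝ) : ℂ) * ‖w‖ ^ 2
          + 2 * Real.pi * Complex.I * ⟪z, w⟫) := by
    intro w z
    rw [Complex.exp_add, inner_smul_right]
    simp only [Circle.smul_def, smul_eq_mul]
    push_cast
    rw [mul_left_comm]
    congr 3
    ring_nf
  have hg : Integrable (fun w : V => Complex.exp (-((c⁻¹ : ℝ) : ℂ) * ‖w‖ ^ 2)) := by
    simpa using GaussianFourier.integrable_cexp_neg_mul_sq_norm_add (V := V)
      (b := ((c⁻¹ : ℝ) : ℂ)) (by rw [Complex.ofReal_re]; positivity) 0 0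
  have hmeas : Continuous (fun p : V × V => (Real.fourierChar (-⟪p.1, x⟫)) •
      Complex.exp (-((c⁻¹ : ℝ) : ℂ) * ‖p.1‖ ^ 2 + 2 * Real.pi * Complex.I * ⟪p.2, p.1⟫)) := by
    simp only [Circle.smul_def, smul_eq_mul, Real.fourierChar_apply]
    fun_prop
  have hint : Integrable (Function.uncurry fun w z : V => (Real.fourierChar (-⟪w, x⟫)) •
      Complex.exp (-((c⁻¹ : ℝ) : ℂ) * ‖w‖ ^ 2 + 2 * Real.pi * Complex.I * ⟪z, w⟫))
      ((volume : Measure V).prod μ) := by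
    refine (hg.mul_prod (integrable_const (1 : ℂ)) (ν := μ)).norm.mono'
      hmeas.aestronglyMeasurable (ae_of_all _ fun p => le_of_eq ?_)
    rw [Function.uncurry_def, Circle.norm_smul, mul_one, Complex.norm_exp, Complex.norm_exp]
    congr 1
    simp
  calc _ = ∫ w : V, ∫ z, (Real.fourierChar (-⟪w, x⟫)) •
          Complex.exp (-((c⁻¹ : ℝ) : ℂ) * ‖w‖ ^ 2 + 2 * Real.pi * Complex.I * ⟪z, w⟫) ∂μ := by
        congr 1; ext w
        unfold scaledCharFun charFun
        simp_rw [Circle.smul_def]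
        rw [← integral_smul, ← integral_smul]
        refine integral_congr_ae (ae_of_all _ fun z => ?_)
        simpa only [Circle.smul_def] using key w z
    _ = ∫ z, (∫ w : V, (Real.fourierChar (-⟪w, x⟫)) •
          Complex.exp (-((c⁻¹ : ℝ) : ℂ) * ‖w‖ ^ 2 + 2 * Real.pi * Complex.I * ⟪z, w⟫)) ∂μ :=
        integral_integral_swap hint
    _ = ∫ z, ((gaussianKernel c (z - x) : ℝ) : ℂ) ∂μ := by
        congr 1; ext z
        have := fourier_gaussian_innerProductSpace' (V := V) (b := ((c⁻¹ : ℝ) : ℂ))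
          (by rw [Complex.ofReal_re]; positivity) z x
        rw [gaussianKernel_coe hc, ← this]
        rfl
    _ = _ := integral_ofReal

theorem tendsto_integral_gaussianKernel (μ : Measure V) [IsFiniteMeasure μ]
    (h : Integrable (scaledCharFun μ)) (x : V) :
    Tendsto (fun c : ℝ => ((∫ z, gaussianKernel c (z - x) ∂μ : ℝ) : ℂ)) atTop
      (𝓝 (𝓕 (scaledCharFun μ) x)) := by
  have hi : Integrable (fun w : V => (Real.fourierChar (-⟪w, x⟫)) • scaledCharFun μ w) := by
    exact (VectorFourier.fourierIntegral_convergent_iff Real.continuous_fourierChar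
      (L := innerₗ V) continuous_inner x).2 h
  have := Real.tendsto_integral_cexp_sq_smul hi
  refine this.congr' ?_
  filter_upwards [eventually_gt_atTop 0] with c hc
  rw [← integral_exp_smul_fourierChar_scaledCharFun μ hc]
  simp

theorem fourier_scaledCharFun_eq_re (μ : Measure V) [IsFiniteMeasure μ]
    (h : Integrable (scaledCharFun μ)) (x : V) :
    𝓕 (scaledCharFun μ) x = ((𝓕 (scaledCharFun μ) x).re : ℂ) := by
  have h1 := tendsto_integral_gaussianKernel μ h x
  have h2 := (Complex.continuous_ofReal.comp Complex.continuous_re).continuousAt.tendsto.comp h1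
  refine tendsto_nhds_unique h1 (h2.congr fun c => ?_)
  simp

theorem tendsto_integral_gaussianKernel_re (μ : Measure V) [IsFiniteMeasure μ]
    (h : Integrable (scaledCharFun μ)) (x : V) :
    Tendsto (fun c : ℝ => ∫ z, gaussianKernel c (z - x) ∂μ) atTop
      (𝓝 (𝓕 (scaledCharFun μ) x).re) := by
  have h1 := tendsto_integral_gaussianKernel μ h x
  exact Complex.continuous_re.continuousAt.tendsto.comp h1

theorem fourier_scaledCharFun_re_nonneg (μ : Measure V) [IsFiniteMeasure μ]
    (h : Integrable (scaledCharFun μ)) (x : V) : 0 ≤ (𝓕 (scaledCharFun μ) x).re := by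
  refine ge_of_tendsto (tendsto_integral_gaussianKernel_re μ h x) ?_
  filter_upwards [eventually_gt_atTop 0] with c hc
  exact integral_nonneg fun z => gaussianKernel_nonneg hc _

theorem continuous_gaussianKernel (c : ℝ) : Continuous (gaussianKernel c : V → ℝ) := by
  unfold gaussianKernel; fun_prop

theorem lintegral_gaussianKernel_sub {c : ℝ} (hc : 0 < c) (z : V) :
    ∫⁻ x : V, ENNReal.ofReal (gaussianKernel c (z - x)) = 1 := by
  rw [lintegral_sub_left_eq_self (μ := (volume : Measure V))
    (fun u => ENNReal.ofReal (gaussianKernel c u)) z]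
  rw [← ofReal_integral_eq_lintegral_ofReal (integrable_gaussianKernel hc)
    (ae_of_all _ (gaussianKernel_nonneg hc)), integral_gaussianKernel hc, ENNReal.ofReal_one]

theorem gaussianKernel_le {c : ℝ} (hc : 0 < c) (z : V) :
    gaussianKernel c z ≤ (Real.pi / c⁻¹) ^ ((Module.finrank ℝ V : ℝ) / 2) := by
  unfold gaussianKernel
  refine mul_le_of_le_one_right (by positivity) (Real.exp_le_one_iff.2 ?_)
  rw [div_inv_eq_mul]
  have : 0 ≤ Real.pi ^ 2 * ‖z‖ ^ 2 * c := by positivity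
  linarith

theorem continuous_fourier_of_integrable {f : V → ℂ} (h : Integrable f) : Continuous (𝓕 f) :=
  VectorFourier.fourierIntegral_continuous Real.continuous_fourierChar
    (L := innerₗ V) continuous_inner h

/-- Fatou along the Gaussian averages: each of them has total mass exactly `μ univ`, because the
kernel has integral one. The density is therefore integrable although nothing is known about its
decay. -/
theorem lintegral_fourier_scaledCharFun_le (μ : Measure V) [IsFiniteMeasure μ]
    (h : Integrable (scaledCharFun μ)) :
    ∫⁻ x, ENNReal.ofReal (𝓕 (scaledCharFun μ) x).re ≤ μ Set.univ := by
  have h1 : ∀ x, Tendsto (fun n : ℕ =>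
      ∫⁻ z, ENNReal.ofReal (gaussianKernel ((n : ℝ) + 1) (z - x)) ∂μ) atTop
      (𝓝 (ENNReal.ofReal (𝓕 (scaledCharFun μ) x).re)) := by
    intro x
    have h2 := (tendsto_integral_gaussianKernel_re μ h x).comp
      (tendsto_atTop_add_const_right _ 1 (tendsto_natCast_atTop_atTop (R := ℝ)))
    refine ((ENNReal.continuous_ofReal.tendsto _).comp h2).congr fun n => ?_
    have hn : (0 : ℝ) < n + 1 := by positivity
    simp only [Function.comp]
    rw [ofReal_integral_eq_lintegral_ofReal]
    · refine Integrable.of_bound (C := (Real.pi / ((n : ℝ) + 1)⁻¹) ^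
        ((Module.finrank ℝ V : ℝ) / 2))
        ((continuous_gaussianKernel _).comp (by fun_prop)).aestronglyMeasurable
        (ae_of_all _ fun z => ?_)
      rw [Real.norm_of_nonneg (gaussianKernel_nonneg hn _)]
      exact gaussianKernel_le hn _
    · exact ae_of_all _ fun z => gaussianKernel_nonneg hn _
  have hm : ∀ n : ℕ, Measurable (Function.uncurry fun x z : V =>
      ENNReal.ofReal (gaussianKernel ((n : ℝ) + 1) (z - x))) := fun n =>
    (ENNReal.continuous_ofReal.comp
      ((continuous_gaussianKernel _).comp (continuous_snd.sub continuous_fst))).measurable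
  calc _ = ∫⁻ x, liminf (fun n : ℕ =>
        ∫⁻ z, ENNReal.ofReal (gaussianKernel ((n : ℝ) + 1) (z - x)) ∂μ) atTop := by
        simp_rw [fun x => (h1 x).liminf_eq]
    _ ≤ liminf (fun n : ℕ => ∫⁻ x,
        ∫⁻ z, ENNReal.ofReal (gaussianKernel ((n : ℝ) + 1) (z - x)) ∂μ) atTop := by
        refine lintegral_liminf_le fun n => (hm n).lintegral_prod_right
    _ = liminf (fun n : ℕ => μ Set.univ) atTop := by
        congr 1; ext n
        rw [lintegral_lintegral_swap (hm n).aemeasurable]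
        simp_rw [lintegral_gaussianKernel_sub (by positivity : (0 : ℝ) < n + 1)]
        simp
    _ = _ := by simp

theorem integrable_fourier_scaledCharFun (μ : Measure V) [IsFiniteMeasure μ]
    (h : Integrable (scaledCharFun μ)) : Integrable (fun x => (𝓕 (scaledCharFun μ) x).re) := by
  refine ⟨(Complex.continuous_re.comp (continuous_fourier_of_integrable h)).aestronglyMeasurable,
    ?_⟩
  rw [hasFiniteIntegral_iff_ofReal (ae_of_all _ (fourier_scaledCharFun_re_nonneg μ h))]
  exact (lintegral_fourier_scaledCharFun_le μ h).trans_lt (measure_lt_top _ _)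

/-- If `φ` and its Fourier transform `g ≥ 0` are integrable, the measure with density `g` has
characteristic function `φ`. -/
theorem scaledCharFun_withDensity {φ : V → ℂ} {g : V → ℝ} (hφ : Continuous φ)
    (hφi : Integrable φ) (hg : ∀ x, 𝓕 φ x = (g x : ℂ)) (hg0 : ∀ x, 0 ≤ g x) (hgi : Integrable g) :
    scaledCharFun ((volume : Measure V).withDensity fun x => ENNReal.ofReal (g x)) = φ := by
  have hgm : AEMeasurable g := hgi.aemeasurable
  have hF : 𝓕 φ = fun x => (g x : ℂ) := funext hg
  have hinv := hφ.fourierInv_fourier_eq hφi (by rw [hF]; exact hgi.ofReal)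
  ext y
  conv_rhs => rw [← hinv, hF, Real.fourierInv_eq]
  unfold scaledCharFun charFun
  rw [integral_withDensity_eq_integral_toReal_smul₀ hgm.ennreal_ofReal
    (ae_of_all _ fun _ => ENNReal.ofReal_lt_top)]
  congr 1; ext x
  rw [ENNReal.toReal_ofReal (hg0 x), Circle.smul_def, Real.fourierChar_apply, inner_smul_right]
  simp only [Complex.real_smul, smul_eq_mul]
  ring

theorem charFun_eq_of_scaledCharFun_eq {μ ν : Measure V} (h : scaledCharFun μ = scaledCharFun ν) :
    charFun μ = charFun ν := by
  ext y
  have := congrFun h ((2 * Real.pi)⁻¹ • y)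
  unfold scaledCharFun at this
  rwa [smul_smul, mul_inv_cancel₀ (by positivity), one_smul] at this

/-- A finite measure with integrable characteristic function has a density, given by Fourier
inversion. -/
theorem eq_withDensity_fourier_scaledCharFun (μ : Measure V) [IsFiniteMeasure μ]
    (h : Integrable (scaledCharFun μ)) :
    μ = (volume : Measure V).withDensity
      fun x => ENNReal.ofReal (𝓕 (scaledCharFun μ) x).re := by
  have hi := integrable_fourier_scaledCharFun μ h
  have : IsFiniteMeasure ((volume : Measure V).withDensity
      fun x => ENNReal.ofReal (𝓕 (scaledCharFun μ) x).re) :=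
    isFiniteMeasure_withDensity_ofReal hi.2
  refine Measure.ext_of_charFun (charFun_eq_of_scaledCharFun_eq ?_)
  exact (scaledCharFun_withDensity (continuous_scaledCharFun μ) h
    (fourier_scaledCharFun_eq_re μ h) (fourier_scaledCharFun_re_nonneg μ h) hi).symm

/-- Differentiating under the integral sign brings down `k` factors of the frequency variable. -/
theorem norm_iteratedFDeriv_fourier_le {f : V → ℂ} {k : ℕ}
    (hf : ∀ n : ℕ, n ≤ k → Integrable (fun v => ‖v‖ ^ n * ‖f v‖))
    (hfm : AEStronglyMeasurable f) (x : V) :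
    ‖iteratedFDeriv ℝ k (𝓕 f) x‖ ≤
      (2 * Real.pi * ‖(innerSL ℝ : V →L[ℝ] _)‖) ^ k * ∫ v, ‖v‖ ^ k * ‖f v‖ := by
  have h := Real.iteratedFDeriv_fourier (N := k) (fun n hn => hf n (by exact_mod_cast hn)) hfm
    (n := k) le_rfl
  rw [h]
  refine (VectorFourier.norm_fourierIntegral_le_integral_norm _ _ _ _ _).trans ?_
  rw [← integral_const_mul]
  refine integral_mono_of_nonneg (ae_of_all _ fun _ => norm_nonneg _)
    ((hf k le_rfl).const_mul _) (ae_of_all _ fun v => ?_)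
  refine (VectorFourier.norm_fourierPowSMulRight_le _ f v k).trans (le_of_eq ?_)
  ring

end FourierDensity

/-! ### Smoothness of the density from decay of the characteristic function -/

section DecayingFourier

set_option linter.unusedSectionVars false

open scoped FourierTransform RealInnerProductSpace

variable {V : Type*} [NormedAddCommGroup V] [InnerProductSpace ℝ V] [MeasurableSpace V]
  [BorelSpace V] [FiniteDimensional ℝ V]

theorem integrable_inv_one_add_norm_pow :
    Integrable (fun y : V => ((1 + ‖y‖) ^ (Module.finrank ℝ V + 1))⁻¹) := by
  have h := integrable_one_add_norm (E := V) (μ := volume) (r := Module.finrank ℝ V + 1)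
    (by linarith)
  refine h.congr (ae_of_all _ fun y => ?_)
  simp only
  rw [Real.rpow_neg (by positivity)]
  norm_cast

/-- In the exponent `finrank + 1 + k`, the `k` pays for up to `k` derivatives and `finrank + 1`
leaves an integrable function. -/
theorem norm_pow_mul_le_of_decay {f : V → ℂ} {C : ℝ} {k n : ℕ} (hn : n ≤ k)
    (hf : ∀ y, ‖f y‖ ≤ C * ((1 + ‖y‖) ^ (Module.finrank ℝ V + 1 + k))⁻¹) (y : V) :
    ‖y‖ ^ n * ‖f y‖ ≤ C * ((1 + ‖y‖) ^ (Module.finrank ℝ V + 1))⁻¹ := by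
  have h1 : ‖y‖ ^ n ≤ (1 + ‖y‖) ^ k :=
    (pow_le_pow_left₀ (norm_nonneg _) (by linarith) n).trans
      (pow_le_pow_right₀ (by linarith [norm_nonneg y]) hn)
  calc ‖y‖ ^ n * ‖f y‖ ≤ (1 + ‖y‖) ^ k * (C * ((1 + ‖y‖) ^ (Module.finrank ℝ V + 1 + k))⁻¹) :=
        mul_le_mul h1 (hf y) (norm_nonneg _) (by positivity)
    _ = _ := by
        have : (0 : ℝ) < 1 + ‖y‖ := by positivity
        rw [pow_add _ _ k]
        field_simp

theorem integrable_norm_pow_mul_of_decay {f : V → ℂ} (hfm : AEStronglyMeasurable f) {C : ℝ}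
    {k n : ℕ} (hn : n ≤ k)
    (hf : ∀ y, ‖f y‖ ≤ C * ((1 + ‖y‖) ^ (Module.finrank ℝ V + 1 + k))⁻¹) :
    Integrable (fun v => ‖v‖ ^ n * ‖f v‖) := by
  refine (integrable_inv_one_add_norm_pow.const_mul C).mono'
    ((by fun_prop : Continuous fun v : V => ‖v‖ ^ n).aestronglyMeasurable.mul hfm.norm)
    (ae_of_all _ fun y => ?_)
  rw [Real.norm_of_nonneg (by positivity)]
  exact norm_pow_mul_le_of_decay hn hf y

theorem integrable_of_decay {f : V → ℂ} (hfm : AEStronglyMeasurable f) {C : ℝ} {k : ℕ}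
    (hf : ∀ y, ‖f y‖ ≤ C * ((1 + ‖y‖) ^ (Module.finrank ℝ V + 1 + k))⁻¹) : Integrable f := by
  have := integrable_norm_pow_mul_of_decay hfm (Nat.zero_le k) hf
  simp only [pow_zero, one_mul] at this
  exact (integrable_norm_iff hfm).1 this

theorem contDiff_fourier_of_decay {f : V → ℂ} (hfm : AEStronglyMeasurable f) {C : ℝ} {k : ℕ}
    (hf : ∀ y, ‖f y‖ ≤ C * ((1 + ‖y‖) ^ (Module.finrank ℝ V + 1 + k))⁻¹) :
    ContDiff ℝ k (𝓕 f) :=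
  Real.contDiff_fourier (N := k) fun n hn =>
    integrable_norm_pow_mul_of_decay hfm (by exact_mod_cast hn) hf

theorem norm_iteratedFDeriv_fourier_le_of_decay {f : V → ℂ} (hfm : AEStronglyMeasurable f)
    {C : ℝ} {k : ℕ} (hf : ∀ y, ‖f y‖ ≤ C * ((1 + ‖y‖) ^ (Module.finrank ℝ V + 1 + k))⁻¹) (x : V) :
    ‖iteratedFDeriv ℝ k (𝓕 f) x‖ ≤ (2 * Real.pi * ‖(innerSL ℝ : V →L[ℝ] _)‖) ^ k *
      (C * ∫ y : V, ((1 + ‖y‖) ^ (Module.finrank ℝ V + 1))⁻¹) := by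
  refine (norm_iteratedFDeriv_fourier_le
    (fun n hn => integrable_norm_pow_mul_of_decay hfm hn hf) hfm x).trans ?_
  gcongr
  rw [← integral_const_mul]
  exact integral_mono (integrable_norm_pow_mul_of_decay hfm le_rfl hf)
    (integrable_inv_one_add_norm_pow.const_mul C) (norm_pow_mul_le_of_decay le_rfl hf)

theorem fourier_sub_of_integrable {f g : V → ℂ} (hf : Integrable f) (hg : Integrable g) :
    𝓕 (f - g) = 𝓕 f - 𝓕 g := by
  have hi : ∀ {f : V → ℂ} (_ : Integrable f) (x : V),
      Integrable (fun w : V => (Real.fourierChar (-⟪w, x⟫)) • f w) := fun h x =>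
    (VectorFourier.fourierIntegral_convergent_iff Real.continuous_fourierChar
      (L := innerₗ V) continuous_inner x).2 h
  ext x
  simp only [Real.fourier_eq, Pi.sub_apply, smul_sub]
  exact integral_sub (hi hf x) (hi hg x)

/-- The density obtained from `f` by Fourier inversion, read through `T` and rescaled. -/
noncomputable def inversionDensity {X : Type*} (T : X → V) (c : ℝ) (f : V → ℂ) (x : X) : ℝ :=
  c * (𝓕 f (T x)).re

variable {X : Type*} [NormedAddCommGroup X] [NormedSpace ℝ X]

theorem contDiff_inversionDensity (T : X ≃L[ℝ] V) (c : ℝ) {f : V → ℂ}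
    (hfm : AEStronglyMeasurable f) {C : ℝ} {k : ℕ}
    (hf : ∀ y, ‖f y‖ ≤ C * ((1 + ‖y‖) ^ (Module.finrank ℝ V + 1 + k))⁻¹) :
    ContDiff ℝ k (inversionDensity T c f) :=
  contDiff_const.mul (Complex.reCLM.contDiff.comp
    ((contDiff_fourier_of_decay hfm hf).comp T.contDiff))

theorem norm_iteratedFDeriv_inversionDensity_le (T : X ≃L[ℝ] V) (c : ℝ) {f : V → ℂ}
    (hfm : AEStronglyMeasurable f) {C : ℝ} {k : ℕ}
    (hf : ∀ y, ‖f y‖ ≤ C * ((1 + ‖y‖) ^ (Module.finrank ℝ V + 1 + k))⁻¹) (x : X) :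
    ‖iteratedFDeriv ℝ k (inversionDensity T c f) x‖ ≤ ‖c • Complex.reCLM‖ *
      (((2 * Real.pi * ‖(innerSL ℝ : V →L[ℝ] _)‖) ^ k *
      (C * ∫ y : V, ((1 + ‖y‖) ^ (Module.finrank ℝ V + 1))⁻¹)) *
        ‖(T : X →L[ℝ] V)‖ ^ k) := by
  have hc := contDiff_fourier_of_decay hfm hf
  have he : inversionDensity T c f = (c • Complex.reCLM : ℂ →L[ℝ] ℝ) ∘ (𝓕 f ∘ T) := by
    ext x; simp [inversionDensity]
  rw [he, ContinuousLinearMap.iteratedFDeriv_comp_left _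
    (hc.comp T.contDiff).contDiffAt le_rfl]
  refine (ContinuousLinearMap.norm_compContinuousMultilinearMap_le _ _).trans ?_
  gcongr
  have := ContinuousLinearMap.iteratedFDeriv_comp_right (T : X →L[ℝ] V) hc x (i := k) le_rfl
  erw [this]
  refine (ContinuousMultilinearMap.norm_compContinuousLinearMap_le _ _).trans ?_
  rw [Finset.prod_const, Finset.card_univ, Fintype.card_fin]
  gcongr
  exact norm_iteratedFDeriv_fourier_le_of_decay hfm hf _

theorem inversionDensity_sub {X : Type*} (T : X → V) (c : ℝ) {f g : V → ℂ} (hf : Integrable f)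
    (hg : Integrable g) :
    inversionDensity T c (f - g) = inversionDensity T c f - inversionDensity T c g := by
  ext x
  simp only [inversionDensity, fourier_sub_of_integrable hf hg, Pi.sub_apply, Complex.sub_re]
  ring

end DecayingFourier

/-! ### Scheffé's lemma and weak convergence -/

section Scheffe

variable {X : Type*} [MeasurableSpace X] {μ : Measure X}

/-- Scheffé's lemma for nonnegative functions. -/
theorem tendsto_integral_abs_sub_of_tendsto_integral {g : ℕ → X → ℝ} {h : X → ℝ}
    (hg0 : ∀ n x, 0 ≤ g n x) (hg : ∀ n, Integrable (g n) μ) (hh0 : ∀ x, 0 ≤ h x)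
    (hh : Integrable h μ) (hlim : ∀ x, Tendsto (fun n => g n x) atTop (𝓝 (h x)))
    (hint : Tendsto (fun n => ∫ x, g n x ∂μ) atTop (𝓝 (∫ x, h x ∂μ))) :
    Tendsto (fun n => ∫ x, |g n x - h x| ∂μ) atTop (𝓝 0) := by
  have h1 : Tendsto (fun n => ∫ x, max (h x - g n x) 0 ∂μ) atTop (𝓝 (∫ x, (0 : ℝ) ∂μ)) := by
    refine tendsto_integral_of_dominated_convergence h
      (fun n => ((hh.sub (hg n)).sup (integrable_zero _ _ _)).aestronglyMeasurable) hh ?_ ?_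
    · intro n
      refine ae_of_all _ fun x => ?_
      rw [Real.norm_of_nonneg (le_max_right _ _)]
      exact max_le (by linarith [hg0 n x]) (hh0 x)
    · refine ae_of_all _ fun x => ?_
      have := ((tendsto_const_nhds (x := h x)).sub (hlim x)).max (tendsto_const_nhds (x := (0 : ℝ)))
      simpa using this
  -- With `u = g n - h`, `|u| = u + 2 max (-u) 0`: the first part is governed by the masses, the
  -- second is dominated by `h`.
  have h2 : ∀ n, ∫ x, |g n x - h x| ∂μ
      = (∫ x, g n x ∂μ - ∫ x, h x ∂μ) + 2 * ∫ x, max (h x - g n x) 0 ∂μ := by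
    intro n
    have hm : Integrable (fun x => max (h x - g n x) 0) μ :=
      (hh.sub (hg n)).sup (integrable_zero _ _ _)
    rw [← integral_sub (hg n) hh, ← integral_const_mul,
      ← integral_add (f := fun x => g n x - h x) ((hg n).sub hh) (hm.const_mul 2)]
    congr 1; ext x
    rcases le_total (h x - g n x) 0 with hx | hx
    · rw [max_eq_right hx, abs_of_nonneg (by linarith)]; ring
    · rw [max_eq_left hx, abs_of_nonpos (by linarith)]; ring
  simp_rw [h2]
  have := (hint.sub_const (∫ x, h x ∂μ)).add (h1.const_mul 2)
  simpa using this

theorem tendsto_integral_withDensity_of_tendsto [TopologicalSpace X] [BorelSpace X]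
    {g : ℕ → X → ℝ} {h : X → ℝ}
    (hg0 : ∀ n x, 0 ≤ g n x) (hg : ∀ n, Integrable (g n) μ) (hh0 : ∀ x, 0 ≤ h x)
    (hh : Integrable h μ) (hlim : ∀ x, Tendsto (fun n => g n x) atTop (𝓝 (h x)))
    (hint : Tendsto (fun n => ∫ x, g n x ∂μ) atTop (𝓝 (∫ x, h x ∂μ)))
    (f : BoundedContinuousFunction X ℝ) :
    Tendsto (fun n => ∫ x, f x ∂(μ.withDensity fun x => ENNReal.ofReal (g n x))) atTop
      (𝓝 (∫ x, f x ∂(μ.withDensity fun x => ENNReal.ofReal (h x)))) := by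
  have hrw : ∀ {u : X → ℝ}, (∀ x, 0 ≤ u x) → Integrable u μ →
      ∫ x, f x ∂(μ.withDensity fun x => ENNReal.ofReal (u x)) = ∫ x, u x * f x ∂μ := by
    intro u hu0 hu
    rw [integral_withDensity_eq_integral_toReal_smul₀ hu.aemeasurable.ennreal_ofReal
      (ae_of_all _ fun _ => ENNReal.ofReal_lt_top)]
    simp_rw [ENNReal.toReal_ofReal (hu0 _), smul_eq_mul]
  rw [hrw hh0 hh]
  simp_rw [fun n => hrw (hg0 n) (hg n)]
  have hfi : ∀ {u : X → ℝ}, Integrable u μ → Integrable (fun x => u x * f x) μ := fun hu =>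
    hu.mul_bdd (c := ‖f‖) f.continuous.aestronglyMeasurable (ae_of_all _ f.norm_coe_le_norm)
  rw [tendsto_iff_norm_sub_tendsto_zero]
  have h0 := (tendsto_integral_abs_sub_of_tendsto_integral hg0 hg hh0 hh hlim hint).mul_const ‖f‖
  rw [zero_mul] at h0
  refine squeeze_zero (fun _ => norm_nonneg _) (fun n => ?_) h0
  rw [← integral_sub (hfi (hg n)) (hfi hh), ← integral_mul_const]
  refine norm_integral_le_of_norm_le (((hg n).sub hh).abs.mul_const _) (ae_of_all _ fun x => ?_)
  rw [← sub_mul, norm_mul, Real.norm_eq_abs]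
  gcongr
  exact f.norm_coe_le_norm x

end Scheffe

/-! ### Transfer of densities between `ℂ^N` and a Euclidean space -/

section Transfer

set_option linter.unusedSectionVars false

variable {X V : Type*} [NormedAddCommGroup X] [NormedSpace ℝ X] [MeasureSpace X] [BorelSpace X]
  [FiniteDimensional ℝ X] [(volume : Measure X).IsAddHaarMeasure]
  [NormedAddCommGroup V] [InnerProductSpace ℝ V] [MeasurableSpace V]
  [BorelSpace V] [FiniteDimensional ℝ V]

/-- The factor by which `T.symm` distorts volume. -/
theorem exists_map_symm_volume_eq_smul (T : X ≃L[ℝ] V) :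
    ∃ c : ℝ, 0 < c ∧
      (volume : Measure V).map T.symm = ENNReal.ofReal c • (volume : Measure X) := by
  have : ((volume : Measure V).map T.symm).IsAddHaarMeasure :=
    T.symm.isAddHaarMeasure_map volume
  refine ⟨((volume : Measure V).map T.symm).addHaarScalarFactor (volume : Measure X), ?_, ?_⟩
  · exact_mod_cast Measure.addHaarScalarFactor_pos_of_isAddHaarMeasure _ _
  · rw [ENNReal.ofReal_coe_nnreal]
    exact Measure.isAddLeftInvariant_eq_smul _ _

/-- Fourier inversion needs an inner product, while `Fin N → ℂ` carries the sup norm. Haar measure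
being unique up to scaling, densities travel along `T` at the cost of the constant `c`. -/
theorem map_eq_withDensity_iff (T : X ≃L[ℝ] V) {c : ℝ} (hc : 0 < c)
    (hT : (volume : Measure V).map T.symm = ENNReal.ofReal c • (volume : Measure X))
    {g : V → ℝ} (hg : Measurable g) (ν : Measure X) :
    ν.map T = (volume : Measure V).withDensity (fun y => ENNReal.ofReal (g y)) ↔
      ν = (volume : Measure X).withDensity fun x => ENNReal.ofReal (c * g (T x)) := by
  have hTm : Measurable T := T.continuous.measurable
  have hSm : Measurable T.symm := T.symm.continuous.measurable
  have key : ((volume : Measure V).withDensity (fun y => ENNReal.ofReal (g y))).map T.symm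
      = (volume : Measure X).withDensity fun x => ENNReal.ofReal (c * g (T x)) := by
    ext s hs
    rw [Measure.map_apply hSm hs, withDensity_apply _ (hSm hs), withDensity_apply _ hs]
    have h1 : ∫⁻ x in s, ENNReal.ofReal (g (T x)) ∂((volume : Measure V).map T.symm)
        = ∫⁻ y in T.symm ⁻¹' s, ENNReal.ofReal (g y) := by
      rw [setLIntegral_map hs (by fun_prop) hSm]
      simp
    rw [← h1, hT, Measure.restrict_smul, lintegral_smul_measure, smul_eq_mul,
      ← lintegral_const_mul _ (by fun_prop)]
    simp_rw [ENNReal.ofReal_mul hc.le]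
  constructor
  · intro h
    rw [← key, ← h, Measure.map_map hSm hTm]
    simp
  · intro h
    rw [h, ← key, Measure.map_map hTm hSm]
    simp

theorem integrable_comp_of_map_symm_volume (T : X ≃L[ℝ] V) {c : ℝ} (hc : 0 < c)
    (hT : (volume : Measure V).map T.symm = ENNReal.ofReal c • (volume : Measure X))
    {g : V → ℝ} (hg : Integrable g) : Integrable (fun x => c * g (T x)) := by
  refine Integrable.const_mul ?_ c
  have h1 : Integrable (fun x => g (T x)) ((volume : Measure V).map T.symm) := by
    refine (T.symm.toHomeomorph.measurableEmbedding.integrable_map_iff).2 ?_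
    refine hg.congr (ae_of_all _ fun y => ?_)
    simp
  rw [hT] at h1
  exact (integrable_smul_measure (by simpa using hc) ENNReal.ofReal_ne_top).1 h1

end Transfer

/-! ### Rapidly decaying limits of characteristic functions -/

section SmoothLimit

set_option linter.unusedSectionVars false

open scoped FourierTransform RealInnerProductSpace

variable {V : Type*} [NormedAddCommGroup V] [InnerProductSpace ℝ V] [MeasurableSpace V]
  [BorelSpace V] [FiniteDimensional ℝ V]

/-- `φ` is the limit of the characteristic functions of the measures `μ σ n`, with rapid decay
from the index `nJ J` on, locally uniformly in `σ`. -/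
def HasRapidCharFunLimit (μ : ℝ → ℕ → Measure V) (φ : ℝ → V → ℂ) (nJ : ℕ → ℕ) : Prop :=
  ∀ (J : ℕ) (M : ℝ), ∃ (C : ℝ) (δ : ℕ → ℝ), Tendsto δ atTop (𝓝 0) ∧
    ∀ n, nJ J ≤ n → ∀ σ ∈ Set.Icc 1 M, ∀ y,
      ‖scaledCharFun (μ σ n) y‖ ≤ C * ((1 + ‖y‖) ^ J)⁻¹ ∧
      ‖scaledCharFun (μ σ n) y - φ σ y‖ ≤ δ n * ((1 + ‖y‖) ^ J)⁻¹

variable {μ : ℝ → ℕ → Measure V} {φ : ℝ → V → ℂ} {nJ : ℕ → ℕ}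

theorem HasRapidCharFunLimit.continuous_limit (h : HasRapidCharFunLimit μ φ nJ)
    [∀ σ n, IsFiniteMeasure (μ σ n)] {σ : ℝ} (hσ : 1 ≤ σ) : Continuous (φ σ) := by
  obtain ⟨C, δ, hδ, hC⟩ := h 0 σ
  have : TendstoUniformly (fun n => scaledCharFun (μ σ n)) (φ σ) atTop := by
    rw [Metric.tendstoUniformly_iff]
    intro ε hε
    filter_upwards [eventually_ge_atTop (nJ 0), hδ.eventually_lt_const hε] with n hn hn' y
    rw [dist_comm, dist_eq_norm]
    have := (hC n hn σ ⟨hσ, le_rfl⟩ y).2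
    simp only [pow_zero, inv_one, mul_one] at this
    exact this.trans_lt hn'
  exact this.continuous (Frequently.of_forall fun n => continuous_scaledCharFun (μ σ n))

theorem HasRapidCharFunLimit.norm_limit_le (h : HasRapidCharFunLimit μ φ nJ) (J : ℕ) (M : ℝ) :
    ∃ C : ℝ, ∀ σ ∈ Set.Icc 1 M, ∀ y, ‖φ σ y‖ ≤ C * ((1 + ‖y‖) ^ J)⁻¹ := by
  obtain ⟨C, δ, hδ, hC⟩ := h J M
  -- The single index `n = nJ J` already bounds the limit.
  refine ⟨C + δ (nJ J), fun σ hσ y => ?_⟩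
  obtain ⟨h1, h2⟩ := hC (nJ J) le_rfl σ hσ y
  rw [add_mul]
  have := norm_sub_norm_le (φ σ y) (scaledCharFun (μ σ (nJ J)) y)
  rw [norm_sub_rev] at this
  linarith

theorem HasRapidCharFunLimit.tendsto (h : HasRapidCharFunLimit μ φ nJ) {σ : ℝ} (hσ : 1 ≤ σ)
    (y : V) : Tendsto (fun n => scaledCharFun (μ σ n) y) atTop (𝓝 (φ σ y)) := by
  obtain ⟨C, δ, hδ, hC⟩ := h 0 σ
  rw [tendsto_iff_norm_sub_tendsto_zero]
  refine squeeze_zero' (Eventually.of_forall fun _ => norm_nonneg _) ?_ hδ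
  filter_upwards [eventually_ge_atTop (nJ 0)] with n hn
  simpa using (hC n hn σ ⟨hσ, le_rfl⟩ y).2

/-- Inversion is linear, and the difference of the characteristic functions decays with constant `δ
n`; the derivative bound for decaying functions is then uniform in `x` and `σ`. -/
theorem HasRapidCharFunLimit.tendstoUniformlyOn (h : HasRapidCharFunLimit μ φ nJ)
    [∀ σ n, IsFiniteMeasure (μ σ n)] {X : Type*} [NormedAddCommGroup X] [NormedSpace ℝ X]
    (T : X ≃L[ℝ] V) (c : ℝ) (M : ℝ) (k : ℕ) :
    TendstoUniformlyOn
      (fun (n : ℕ) (q : ℝ × X) =>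
        iteratedFDeriv ℝ k (inversionDensity T c (scaledCharFun (μ q.1 n))) q.2)
      (fun q : ℝ × X => iteratedFDeriv ℝ k (inversionDensity T c (φ q.1)) q.2)
      atTop (Set.Icc 1 M ×ˢ Set.univ) := by
  obtain ⟨C, δ, hδ, hC⟩ := h (Module.finrank ℝ V + 1 + k) M
  obtain ⟨C', hC'⟩ := h.norm_limit_le (Module.finrank ℝ V + 1 + k) M
  rw [Metric.tendstoUniformlyOn_iff]
  intro ε hε
  have hlim : Tendsto (fun n => ‖c • Complex.reCLM‖ *
      (((2 * Real.pi * ‖(innerSL ℝ : V →L[ℝ] _)‖) ^ k *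
      (δ n * ∫ y : V, ((1 + ‖y‖) ^ (Module.finrank ℝ V + 1))⁻¹)) *
        ‖(T : X →L[ℝ] V)‖ ^ k)) atTop (𝓝 0) := by
    have := ((((hδ.mul_const (∫ y : V, ((1 + ‖y‖) ^ (Module.finrank ℝ V + 1))⁻¹)).const_mul
      ((2 * Real.pi * ‖(innerSL ℝ : V →L[ℝ] _)‖) ^ k)).mul_const
        (‖(T : X →L[ℝ] V)‖ ^ k)).const_mul ‖c • Complex.reCLM‖)
    simpa using this
  filter_upwards [eventually_ge_atTop (nJ (Module.finrank ℝ V + 1 + k)),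
    hlim.eventually_lt_const hε] with n hn hn'
  rintro ⟨σ, x⟩ ⟨hσ, -⟩
  have hcn := continuous_scaledCharFun (μ σ n)
  have hcl := h.continuous_limit hσ.1
  have hdn := fun y => (hC n hn σ hσ y).1
  have hdl := hC' σ hσ
  rw [dist_comm, dist_eq_norm]
  dsimp only
  rw [← iteratedFDeriv_sub_apply
    (contDiff_inversionDensity T c hcn.aestronglyMeasurable hdn).contDiffAt
    (contDiff_inversionDensity T c hcl.aestronglyMeasurable hdl).contDiffAt,
    ← inversionDensity_sub _ _ (integrable_of_decay hcn.aestronglyMeasurable hdn)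
      (integrable_of_decay hcl.aestronglyMeasurable hdl)]
  exact (norm_iteratedFDeriv_inversionDensity_le T c (hcn.sub hcl).aestronglyMeasurable
    (fun y => (hC n hn σ hσ y).2) x).trans_lt hn'

theorem HasRapidCharFunLimit.tendsto_fourier (h : HasRapidCharFunLimit μ φ nJ)
    [∀ σ n, IsFiniteMeasure (μ σ n)] {σ : ℝ} (hσ : 1 ≤ σ) (x : V) :
    Tendsto (fun n => 𝓕 (scaledCharFun (μ σ n)) x) atTop (𝓝 (𝓕 (φ σ) x)) := by
  obtain ⟨C, δ, hδ, hC⟩ := h (Module.finrank ℝ V + 1 + 0) σ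
  obtain ⟨C', hC'⟩ := h.norm_limit_le (Module.finrank ℝ V + 1 + 0) σ
  have hm : σ ∈ Set.Icc 1 σ := ⟨hσ, le_rfl⟩
  rw [tendsto_iff_norm_sub_tendsto_zero]
  have hlim := hδ.mul_const (∫ y : V, ((1 + ‖y‖) ^ (Module.finrank ℝ V + 1))⁻¹)
  rw [zero_mul] at hlim
  refine squeeze_zero' (Eventually.of_forall fun _ => norm_nonneg _) ?_ hlim
  filter_upwards [eventually_ge_atTop (nJ (Module.finrank ℝ V + 1 + 0))] with n hn
  have hcn := continuous_scaledCharFun (μ σ n)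
  have hcl := h.continuous_limit hσ
  have := norm_iteratedFDeriv_fourier_le_of_decay (k := 0) (hcn.sub hcl).aestronglyMeasurable
    (fun y => (hC n hn σ hm y).2) x
  rw [norm_iteratedFDeriv_zero, pow_zero, one_mul] at this
  refine le_trans (le_of_eq ?_) this
  rw [fourier_sub_of_integrable
      (integrable_of_decay hcn.aestronglyMeasurable fun y => (hC n hn σ hm y).1)
      (integrable_of_decay hcl.aestronglyMeasurable (hC' σ hm)), Pi.sub_apply]

theorem HasRapidCharFunLimit.integrable (h : HasRapidCharFunLimit μ φ nJ)
    [∀ σ n, IsFiniteMeasure (μ σ n)] (k : ℕ) {n : ℕ}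
    (hn : nJ (Module.finrank ℝ V + 1 + k) ≤ n) {σ : ℝ} (hσ : 1 ≤ σ) :
    Integrable (scaledCharFun (μ σ n)) := by
  obtain ⟨C, δ, hδ, hC⟩ := h (Module.finrank ℝ V + 1 + k) σ
  exact integrable_of_decay (continuous_scaledCharFun (μ σ n)).aestronglyMeasurable
    fun y => (hC n hn σ ⟨hσ, le_rfl⟩ y).1

theorem HasRapidCharFunLimit.integrable_limit (h : HasRapidCharFunLimit μ φ nJ)
    [∀ σ n, IsFiniteMeasure (μ σ n)] {σ : ℝ} (hσ : 1 ≤ σ) : Integrable (φ σ) := by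
  obtain ⟨C', hC'⟩ := h.norm_limit_le (Module.finrank ℝ V + 1 + 0) σ
  exact integrable_of_decay (h.continuous_limit hσ).aestronglyMeasurable (hC' σ ⟨hσ, le_rfl⟩)

theorem HasRapidCharFunLimit.fourier_limit_eq (h : HasRapidCharFunLimit μ φ nJ)
    [∀ σ n, IsFiniteMeasure (μ σ n)] {σ : ℝ} (hσ : 1 ≤ σ) (x : V) :
    𝓕 (φ σ) x = ((𝓕 (φ σ) x).re : ℂ) ∧ 0 ≤ (𝓕 (φ σ) x).re := by
  have h1 := h.tendsto_fourier hσ x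
  have h2 := (Complex.continuous_re.tendsto _).comp h1
  have hev := eventually_ge_atTop (nJ (Module.finrank ℝ V + 1 + 0))
  constructor
  · refine tendsto_nhds_unique h1 (((Complex.continuous_ofReal.tendsto _).comp h2).congr' ?_)
    filter_upwards [hev] with n hn
    exact (fourier_scaledCharFun_eq_re _ (h.integrable 0 hn hσ) x).symm
  · refine ge_of_tendsto h2 ?_
    filter_upwards [hev] with n hn
    exact fourier_scaledCharFun_re_nonneg _ (h.integrable 0 hn hσ) x

theorem HasRapidCharFunLimit.integrable_fourier_limit (h : HasRapidCharFunLimit μ φ nJ)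
    [∀ σ n, IsFiniteMeasure (μ σ n)] {σ : ℝ} (hσ : 1 ≤ σ) :
    Integrable (fun x => (𝓕 (φ σ) x).re) := by
  refine ⟨(Complex.continuous_re.comp
    (continuous_fourier_of_integrable (h.integrable_limit hσ))).aestronglyMeasurable, ?_⟩
  rw [hasFiniteIntegral_iff_ofReal (ae_of_all _ fun x => (h.fourier_limit_eq hσ x).2)]
  have hlim : ∀ x, Tendsto (fun n => ENNReal.ofReal (𝓕 (scaledCharFun (μ σ n)) x).re) atTop
      (𝓝 (ENNReal.ofReal (𝓕 (φ σ) x).re)) := fun x =>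
    ((ENNReal.continuous_ofReal.comp Complex.continuous_re).tendsto _).comp
      (h.tendsto_fourier hσ x)
  have hshift := fun x => (tendsto_add_atTop_iff_nat (nJ (Module.finrank ℝ V + 1 + 0))).2 (hlim x)
  have hint : ∀ n, Integrable (scaledCharFun (μ σ (n + nJ (Module.finrank ℝ V + 1 + 0)))) :=
    fun n => h.integrable 0 (Nat.le_add_left _ _) hσ
  obtain ⟨C, δ, hδ, hC⟩ := h (Module.finrank ℝ V + 1 + 0) σ
  calc ∫⁻ x, ENNReal.ofReal (𝓕 (φ σ) x).re
      = ∫⁻ x, liminf (fun n => ENNReal.ofReal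
          (𝓕 (scaledCharFun (μ σ (n + nJ (Module.finrank ℝ V + 1 + 0)))) x).re) atTop := by
        simp_rw [fun x => (hshift x).liminf_eq]
    _ ≤ liminf (fun n => ∫⁻ x, ENNReal.ofReal
          (𝓕 (scaledCharFun (μ σ (n + nJ (Module.finrank ℝ V + 1 + 0)))) x).re) atTop :=
        lintegral_liminf_le fun n => (ENNReal.continuous_ofReal.comp (Complex.continuous_re.comp
          (continuous_fourier_of_integrable (hint n)))).measurable
    _ ≤ ENNReal.ofReal C := by
        refine liminf_le_of_le (by isBoundedDefault) fun b hb => ?_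
        obtain ⟨n, hn⟩ := hb.exists
        refine hn.trans ((lintegral_fourier_scaledCharFun_le _ (hint n)).trans ?_)
        -- At frequency `0` the decay estimate bounds the total mass, uniformly in `n`.
        have := (hC _ (Nat.le_add_left _ n) σ ⟨hσ, le_rfl⟩ 0).1
        rw [scaledCharFun, smul_zero, charFun_zero, Complex.norm_real,
          Real.norm_of_nonneg measureReal_nonneg] at this
        simp only [norm_zero, add_zero, one_pow, inv_one, mul_one] at this
        rw [measureReal_def] at this
        exact (ENNReal.le_ofReal_iff_toReal_le (measure_ne_top _ _)
          (ENNReal.toReal_nonneg.trans this)).2 this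
    _ < ⊤ := ENNReal.ofReal_lt_top

end SmoothLimit

open scoped FourierTransform in
/-- Rapidly decaying limits of characteristic functions give smooth densities which converge
uniformly with all derivatives, and weak convergence of the measures. -/
theorem exists_smooth_limit_densities {N : ℕ} {V : Type*} [NormedAddCommGroup V]
    [InnerProductSpace ℝ V] [MeasurableSpace V] [BorelSpace V] [FiniteDimensional ℝ V]
    (T : (Fin N → ℂ) ≃L[ℝ] V) (ν : ℝ → ℕ → Measure (Fin N → ℂ))
    (hfin : ∀ σ n, IsFiniteMeasure (ν σ n)) (φ : ℝ → V → ℂ) (nJ : ℕ → ℕ)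
    (h : HasRapidCharFunLimit (fun σ n => (ν σ n).map T) φ nJ) :
    ∃ (G : ℝ → ℕ → (Fin N → ℂ) → ℝ) (lam : ℝ → Measure (Fin N → ℂ))
      (Glim : ℝ → (Fin N → ℂ) → ℝ),
      (∀ k n : ℕ, nJ (Module.finrank ℝ V + 1 + k) ≤ n → ∀ σ : ℝ, 1 ≤ σ →
        IsAbsContWithDensity (ν σ n) (G σ n) ∧ ContDiff ℝ (k : ℕ∞) (G σ n)) ∧
      (∀ σ : ℝ, 1 ≤ σ →
        ConvergesWeakly (fun n => ν σ n) (lam σ) ∧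
          IsAbsContWithDensity (lam σ) (Glim σ) ∧ ContDiff ℝ (⊤ : ℕ∞) (Glim σ)) ∧
      (∀ M : ℝ, 1 < M → ∀ k : ℕ,
        TendstoUniformlyOn
          (fun (n : ℕ) (q : ℝ × (Fin N → ℂ)) => iteratedFDeriv ℝ k (G q.1 n) q.2)
          (fun q : ℝ × (Fin N → ℂ) => iteratedFDeriv ℝ k (Glim q.1) q.2)
          atTop (Set.Icc 1 M ×ˢ Set.univ)) := by
  obtain ⟨c, hc, hT⟩ := exists_map_symm_volume_eq_smul T
  have hTm : Measurable T := T.continuous.measurable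
  have hfinV : ∀ σ n, IsFiniteMeasure ((ν σ n).map T) := fun σ n => inferInstance
  have habs : ∀ k n : ℕ, nJ (Module.finrank ℝ V + 1 + k) ≤ n → ∀ σ : ℝ, 1 ≤ σ →
      IsAbsContWithDensity (ν σ n) (inversionDensity T c (scaledCharFun ((ν σ n).map T))) := by
    intro k n hn σ hσ
    have hi := h.integrable k hn hσ
    have hd := (map_eq_withDensity_iff T hc hT (Complex.continuous_re.comp
      (continuous_fourier_of_integrable hi)).measurable (ν σ n)).1
      (eq_withDensity_fourier_scaledCharFun _ hi)
    refine ⟨?_, fun x => mul_nonneg hc.le (fourier_scaledCharFun_re_nonneg _ hi _),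
      integrable_comp_of_map_symm_volume T hc hT (integrable_fourier_scaledCharFun _ hi), hd⟩
    rw [hd]
    exact withDensity_absolutelyContinuous _ _
  have habsl : ∀ σ : ℝ, 1 ≤ σ → (∀ x, 0 ≤ inversionDensity T c (φ σ) x) ∧
      Integrable (inversionDensity T c (φ σ)) := fun σ hσ =>
    ⟨fun x => mul_nonneg hc.le (h.fourier_limit_eq hσ _).2,
      integrable_comp_of_map_symm_volume T hc hT (h.integrable_fourier_limit hσ)⟩
  refine ⟨fun σ n => inversionDensity T c (scaledCharFun ((ν σ n).map T)),
    fun σ => (volume : Measure (Fin N → ℂ)).withDensity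
      fun x => ENNReal.ofReal (inversionDensity T c (φ σ) x),
    fun σ => inversionDensity T c (φ σ), ?_, ?_, ?_⟩
  · intro k n hn σ hσ
    refine ⟨habs k n hn σ hσ, ?_⟩
    obtain ⟨C, δ, hδ, hC⟩ := h (Module.finrank ℝ V + 1 + k) σ
    exact_mod_cast contDiff_inversionDensity T c
      (continuous_scaledCharFun ((ν σ n).map T)).aestronglyMeasurable
      fun y => (hC n hn σ ⟨hσ, le_rfl⟩ y).1
  · intro σ hσ
    obtain ⟨hl0, hli⟩ := habsl σ hσ
    have hfl : IsFiniteMeasure ((volume : Measure (Fin N → ℂ)).withDensity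
      fun x => ENNReal.ofReal (inversionDensity T c (φ σ) x)) :=
      isFiniteMeasure_withDensity_ofReal hli.2
    refine ⟨⟨hfin σ, hfl, fun f => ?_⟩, ⟨withDensity_absolutelyContinuous _ _, hl0, hli, rfl⟩, ?_⟩
    · have hmass : ∀ {ρ : Measure (Fin N → ℂ)} {g : (Fin N → ℂ) → ℝ} [IsFiniteMeasure ρ],
          (∀ x, 0 ≤ g x) → Integrable g →
          ρ = volume.withDensity (fun x => ENNReal.ofReal (g x)) →
          ((∫ x, g x : ℝ) : ℂ) = scaledCharFun (ρ.map T) 0 := by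
        intro ρ g _ hg0 hgi hρ
        rw [scaledCharFun, smul_zero, charFun_zero, measureReal_def,
          Measure.map_apply hTm MeasurableSet.univ, Set.preimage_univ, hρ,
          withDensity_apply _ MeasurableSet.univ, Measure.restrict_univ,
          integral_eq_lintegral_of_nonneg_ae (ae_of_all _ hg0) hgi.aestronglyMeasurable]
      have hlimmass : scaledCharFun (((volume : Measure (Fin N → ℂ)).withDensity
          fun x => ENNReal.ofReal (inversionDensity T c (φ σ) x)).map T) = φ σ := by
        rw [(map_eq_withDensity_iff T hc hT (g := fun y => (𝓕 (φ σ) y).re)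
          (Complex.continuous_re.comp
          (continuous_fourier_of_integrable (h.integrable_limit hσ))).measurable
          ((volume : Measure (Fin N → ℂ)).withDensity
            fun x => ENNReal.ofReal (inversionDensity T c (φ σ) x))).2 rfl]
        exact scaledCharFun_withDensity (h.continuous_limit hσ) (h.integrable_limit hσ)
          (fun x => (h.fourier_limit_eq hσ x).1) (fun x => (h.fourier_limit_eq hσ x).2)
          (h.integrable_fourier_limit hσ)
      -- The inversion formula is available only from the threshold on, hence the shift.
      rw [← tendsto_add_atTop_iff_nat (nJ (Module.finrank ℝ V + 1 + 0))]
      have hn : ∀ n, nJ (Module.finrank ℝ V + 1 + 0) ≤ n + nJ (Module.finrank ℝ V + 1 + 0) :=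
        fun n => Nat.le_add_left _ _
      have := tendsto_integral_withDensity_of_tendsto (μ := (volume : Measure (Fin N → ℂ)))
        (fun n => (habs 0 _ (hn n) σ hσ).2.1) (fun n => (habs 0 _ (hn n) σ hσ).2.2.1) hl0 hli
        (fun x => ?_) ?_ f
      · refine this.congr fun n => ?_
        rw [← (habs 0 _ (hn n) σ hσ).2.2.2]
      · have h1 := (tendsto_add_atTop_iff_nat (nJ (Module.finrank ℝ V + 1 + 0))).2
          (h.tendsto_fourier hσ (T x))
        exact ((Complex.continuous_re.tendsto _).comp h1).const_mul c
      -- The masses converge, being the values of the characteristic functions at `0`.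
      · have h1 := (tendsto_add_atTop_iff_nat (nJ (Module.finrank ℝ V + 1 + 0))).2
          (h.tendsto hσ 0)
        rw [← hlimmass, ← hmass hl0 hli rfl] at h1
        refine ((Complex.continuous_re.tendsto _).comp h1).congr fun n => ?_
        have h2 := habs 0 _ (hn n) σ hσ
        simp only [Function.comp]
        rw [← hmass h2.2.1 h2.2.2.1 h2.2.2.2, Complex.ofReal_re]
    · rw [contDiff_infty]
      intro k
      obtain ⟨C', hC'⟩ := h.norm_limit_le (Module.finrank ℝ V + 1 + k) σ
      exact contDiff_inversionDensity T c (h.continuous_limit hσ).aestronglyMeasurable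
        (hC' σ ⟨hσ, le_rfl⟩)
  · intro M _ k
    exact h.tendstoUniformlyOn T c M k

/-! ### Moment recursions: decay and convergence -/

/-- The recursion satisfied by the moments of order `0`, `1`, `1`, `2` of a sum of independent
random variables, weighted by a character of another such sum. -/
structure MomentRecursion (K A B D P Q Q' R : ℕ → ℂ) : Prop where
  P_zero : P 0 = 1
  Q_zero : Q 0 = 0
  Q'_zero : Q' 0 = 0
  R_zero : R 0 = 0
  P_succ : ∀ n, P (n + 1) = P n * K n
  Q_succ : ∀ n, Q (n + 1) = Q n * K n + P n * A n
  Q'_succ : ∀ n, Q' (n + 1) = Q' n * K n + P n * B n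
  R_succ : ∀ n, R (n + 1) = R n * K n + Q n * B n + Q' n * A n + P n * D n

/-- Size of the ingredients of a moment recursion, at frequency scale `Y`. -/
structure MomentBounds (K A B D : ℕ → ℂ) (ε : ℕ → ℝ) (Y : ℝ) : Prop where
  K_le : ∀ n, ‖K n‖ ≤ 1
  K_sub : ∀ n, ‖K n - 1‖ ≤ Y ^ 2 * ε n
  A_le : ∀ n, ‖A n‖ ≤ Y * ε n
  B_le : ∀ n, ‖B n‖ ≤ Y * ε n
  D_le : ∀ n, ‖D n‖ ≤ ε n

namespace MomentRecursion

variable {K A B D P Q Q' R : ℕ → ℂ}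

/-- Each factor `K m` that is `O(d)` gains a factor `d`. -/
theorem decay (h : MomentRecursion K A B D P Q Q' R) {c d : ℝ} (hc : 1 ≤ c) (hd0 : 0 ≤ d)
    (hd1 : d ≤ 1) (hA : ∀ n, ‖A n‖ ≤ c) (hB : ∀ n, ‖B n‖ ≤ c) (hD : ∀ n, ‖D n‖ ≤ c)
    (hK : ∀ n, ‖K n‖ ≤ 1) (G : Finset ℕ) (hG : ∀ m ∈ G, ‖K m‖ ≤ c * d) (n : ℕ) :
    ‖P n‖ ≤ (4 * c) ^ n * d ^ (G.filter (· < n)).card ∧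
    ‖Q n‖ * d ≤ (4 * c) ^ n * d ^ (G.filter (· < n)).card ∧
    ‖Q' n‖ * d ≤ (4 * c) ^ n * d ^ (G.filter (· < n)).card ∧
    ‖R n‖ * d ^ 2 ≤ (4 * c) ^ n * d ^ (G.filter (· < n)).card := by
  have hc0 : 0 ≤ c := by linarith
  -- Terms of `Q` and `Q'` have one factor `K` replaced, terms of `R` at most two. The weights `d`
  -- and `d ^ 2` pay for the good factors lost in this way; the `4` counts the summands of `R_succ`.
  induction n with
  | zero => simp [h.P_zero, h.Q_zero, h.Q'_zero, h.R_zero]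
  | succ n ih =>
    obtain ⟨hP, hQ, hQ', hR⟩ := ih
    -- `κ` bounds `K n`, and the count goes up exactly when `κ = c * d`
    obtain ⟨κ, hκ, hκ1, hκd, hcard⟩ : ∃ e : ℝ, ‖K n‖ ≤ c * e ∧ d ≤ e ∧ 0 ≤ e ∧
        d ^ (G.filter (· < n + 1)).card = d ^ (G.filter (· < n)).card * e := by
      by_cases hn : n ∈ G
      · refine ⟨d, hG n hn, le_rfl, hd0, ?_⟩
        have : G.filter (· < n + 1) = insert n (G.filter (· < n)) := by
          ext m; simp only [Finset.mem_filter, Finset.mem_insert]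
          constructor
          · rintro ⟨h1, h2⟩
            rcases Nat.lt_succ_iff_lt_or_eq.1 h2 with h3 | h3
            · exact Or.inr ⟨h1, h3⟩
            · exact Or.inl h3
          · rintro (rfl | ⟨h1, h2⟩)
            · exact ⟨hn, Nat.lt_succ_self _⟩
            · exact ⟨h1, h2.trans (Nat.lt_succ_self _)⟩
        rw [this, Finset.card_insert_of_notMem (by simp), pow_succ]
      · refine ⟨1, by linarith [hK n], hd1, zero_le_one, ?_⟩
        have : G.filter (· < n + 1) = G.filter (· < n) := by
          ext m; simp only [Finset.mem_filter]
          constructor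
          · rintro ⟨h1, h2⟩
            rcases Nat.lt_succ_iff_lt_or_eq.1 h2 with h3 | h3
            · exact ⟨h1, h3⟩
            · exact absurd (h3 ▸ h1) hn
          · rintro ⟨h1, h2⟩
            exact ⟨h1, h2.trans (Nat.lt_succ_self _)⟩
        rw [this, mul_one]
    rw [hcard, h.P_succ, h.Q_succ, h.Q'_succ, h.R_succ]
    set X := (4 * c) ^ n * d ^ (G.filter (· < n)).card with hX
    have hX0 : 0 ≤ X := by positivity
    have e1 : (4 * c) ^ (n + 1) * (d ^ (G.filter (· < n)).card * κ) = 4 * (X * (c * κ)) := by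
      rw [hX, pow_succ]; ring
    rw [e1]
    have hnn : 0 ≤ X * (c * κ) := by positivity
    have tK : ∀ {z : ℂ} {w : ℝ}, ‖z‖ * w ≤ X → 0 ≤ w → ‖z * K n‖ * w ≤ X * (c * κ) := by
      intro z w hz hw
      rw [norm_mul, mul_right_comm]
      exact mul_le_mul hz hκ (norm_nonneg _) hX0
    -- Since `d ≤ κ`, the additional weight `d` stands in for the missing factor `K n`.
    have tA : ∀ {z a : ℂ} {w : ℝ}, ‖z‖ * w ≤ X → ‖a‖ ≤ c → 0 ≤ w →
        ‖z * a‖ * (w * d) ≤ X * (c * κ) := by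
      intro z a w hz ha hw
      rw [norm_mul]
      calc ‖z‖ * ‖a‖ * (w * d) = (‖z‖ * w) * (‖a‖ * d) := by ring
        _ ≤ X * (c * κ) := by gcongr
    refine ⟨?_, ?_, ?_, ?_⟩
    · have := tK (z := P n) (w := 1) (by simpa using hP) zero_le_one
      rw [mul_one] at this
      linarith
    · have h1 := tK hQ hd0
      have h2 := tA (z := P n) (w := 1) (by simpa using hP) (hA n) zero_le_one
      rw [one_mul] at h2
      have := mul_le_mul_of_nonneg_right (norm_add_le (Q n * K n) (P n * A n)) hd0
      linarith
    · have h1 := tK hQ' hd0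
      have h2 := tA (z := P n) (w := 1) (by simpa using hP) (hB n) zero_le_one
      rw [one_mul] at h2
      have := mul_le_mul_of_nonneg_right (norm_add_le (Q' n * K n) (P n * B n)) hd0
      linarith
    · have h1 := tK hR (by positivity)
      have h2 := tA hQ (hB n) hd0
      have h3 := tA hQ' (hA n) hd0
      -- The `D` term replaces only one factor `K`, so one `d` of the weight is superfluous.
      have hPd : ‖P n‖ * d ≤ X := (mul_le_of_le_one_right (norm_nonneg _) hd1).trans hP
      have h4 := tA hPd (hD n) hd0
      rw [← pow_two] at h2 h3 h4
      have := mul_le_mul_of_nonneg_right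
        ((norm_add_le (R n * K n + Q n * B n + Q' n * A n) (P n * D n)).trans
          (add_le_add_left ((norm_add_le (R n * K n + Q n * B n) (Q' n * A n)).trans
            (add_le_add_left (norm_add_le (R n * K n) (Q n * B n)) _)) _)) (sq_nonneg d)
      linarith

variable {ε : ℕ → ℝ} {Y S : ℝ}

/-- From any starting index on, the moments lose at most powers of `Y`. -/
theorem growth (h : MomentRecursion K A B D P Q Q' R) (hb : MomentBounds K A B D ε Y)
    (hS : ∀ s : Finset ℕ, ∑ m ∈ s, ε m ≤ S) (hY : 1 ≤ Y) {n₀ : ℕ} {b : ℝ}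
    (hP : ‖P n₀‖ ≤ b) (hQ : ‖Q n₀‖ ≤ b) (hQ' : ‖Q' n₀‖ ≤ b) (hR : ‖R n₀‖ ≤ b) {n : ℕ}
    (hn : n₀ ≤ n) :
    ‖P n‖ ≤ b ∧ ‖Q n‖ ≤ b * (1 + Y * S) ∧ ‖Q' n‖ ≤ b * (1 + Y * S) ∧
      ‖R n‖ ≤ b * (1 + (2 * Y * (1 + Y * S) + 1) * S) := by
  have hb0 : 0 ≤ b := (norm_nonneg _).trans hP
  have hS0 : 0 ≤ S := by simpa using hS ∅
  -- The partial sums of `ε` absorb each increment in the induction; they are replaced by `S` only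
  -- here.
  suffices H : ‖P n‖ ≤ b ∧ ‖Q n‖ ≤ b * (1 + Y * ∑ m ∈ Finset.Ico n₀ n, ε m) ∧
      ‖Q' n‖ ≤ b * (1 + Y * ∑ m ∈ Finset.Ico n₀ n, ε m) ∧
      ‖R n‖ ≤ b * (1 + (2 * Y * (1 + Y * S) + 1) * ∑ m ∈ Finset.Ico n₀ n, ε m) by
    have := hS (Finset.Ico n₀ n)
    refine ⟨H.1, H.2.1.trans ?_, H.2.2.1.trans ?_, H.2.2.2.trans ?_⟩ <;> gcongr
  induction n, hn using Nat.le_induction with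
  | base => simp only [Finset.Ico_self, Finset.sum_empty, mul_zero, add_zero, mul_one]
            exact ⟨hP, hQ, hQ', hR⟩
  | succ n hn ih =>
    obtain ⟨hP, hQ, hQ', hR⟩ := ih
    rw [h.P_succ, h.Q_succ, h.Q'_succ, h.R_succ, Finset.sum_Ico_succ_top hn]
    set s := ∑ m ∈ Finset.Ico n₀ n, ε m
    have hsS : s ≤ S := hS _
    have tK : ∀ {z : ℂ} {w : ℝ}, ‖z‖ ≤ w → ‖z * K n‖ ≤ w := by
      intro z w hz
      rw [norm_mul]
      exact (mul_le_of_le_one_right (norm_nonneg _) (hb.K_le n)).trans hz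
    have t : ∀ {z a : ℂ} {w v : ℝ}, ‖z‖ ≤ w → ‖a‖ ≤ v → ‖z * a‖ ≤ w * v := by
      intro z a w v hz ha
      rw [norm_mul]
      exact mul_le_mul hz ha (norm_nonneg _) ((norm_nonneg _).trans hz)
    have hq : b * (1 + Y * s) ≤ b * (1 + Y * S) := by gcongr
    refine ⟨tK hP, ?_, ?_, ?_⟩
    · have := (norm_add_le (Q n * K n) (P n * A n)).trans (add_le_add (tK hQ) (t hP (hb.A_le n)))
      linarith
    · have := (norm_add_le (Q' n * K n) (P n * B n)).trans
        (add_le_add (tK hQ') (t hP (hb.B_le n)))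
      linarith
    · have h1 := tK hR
      have h2 := t (hQ.trans hq) (hb.B_le n)
      have h3 := t (hQ'.trans hq) (hb.A_le n)
      have h4 := t hP (hb.D_le n)
      have := (norm_add_le (R n * K n + Q n * B n + Q' n * A n) (P n * D n)).trans
          (add_le_add_left ((norm_add_le (R n * K n + Q n * B n) (Q' n * A n)).trans
            (add_le_add_left (norm_add_le (R n * K n) (Q n * B n)) _)) _)
      refine this.trans (le_trans (add_le_add (add_le_add (add_le_add h1 h2) h3) h4) (le_of_eq ?_))
      ring

theorem norm_R_le (h : MomentRecursion K A B D P Q Q' R) (hb : MomentBounds K A B D ε Y)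
    (hε : ∀ n, 0 ≤ ε n) (hS : ∀ s : Finset ℕ, ∑ m ∈ s, ε m ≤ S) (hY : 1 ≤ Y) {n₀ : ℕ} {b : ℝ}
    (hP : ‖P n₀‖ ≤ b) (hQ : ‖Q n₀‖ ≤ b) (hQ' : ‖Q' n₀‖ ≤ b) (hR : ‖R n₀‖ ≤ b) {n : ℕ}
    (hn : n₀ ≤ n) :
    ‖R n‖ ≤ 3 * (1 + S) ^ 2 * (b * Y ^ 2) ∧
      ‖R (n + 1) - R n‖ ≤ 8 * (1 + S) ^ 2 * (b * Y ^ 4) * ε n := by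
  have hb0 : 0 ≤ b := (norm_nonneg _).trans hP
  have hS0 : 0 ≤ S := by simpa using hS ∅
  obtain ⟨hP, hQ, hQ', hR⟩ := h.growth hb hS hY hP hQ hQ' hR hn
  have hY2 : 1 ≤ Y ^ 2 := one_le_pow₀ hY
  have hYY : Y ≤ Y ^ 2 := by nlinarith
  have hQY : b * (1 + Y * S) ≤ b * ((1 + S) * Y) := by
    gcongr; nlinarith
  have hRY : b * (1 + (2 * Y * (1 + Y * S) + 1) * S) ≤ 3 * (1 + S) ^ 2 * (b * Y ^ 2) := by
    have : 1 + (2 * Y * (1 + Y * S) + 1) * S ≤ 3 * (1 + S) ^ 2 * Y ^ 2 := by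
      nlinarith [mul_nonneg hS0 (sub_nonneg.2 hYY), mul_nonneg hS0 (sub_nonneg.2 hY2),
        mul_nonneg (sq_nonneg S) (sq_nonneg Y)]
    calc _ ≤ b * (3 * (1 + S) ^ 2 * Y ^ 2) := by gcongr
      _ = _ := by ring
  refine ⟨hR.trans hRY, ?_⟩
  have t : ∀ {z a : ℂ} {w v : ℝ}, ‖z‖ ≤ w → ‖a‖ ≤ v → ‖z * a‖ ≤ w * v := by
    intro z a w v hz ha
    rw [norm_mul]
    exact mul_le_mul hz ha (norm_nonneg _) ((norm_nonneg _).trans hz)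
  -- The final `Y ^ 4` is the `Y ^ 2` in the bound for `R` times the `Y ^ 2` in that for `K - 1`;
  -- the other terms are of lower order in `Y`.
  rw [h.R_succ, show R n * K n + Q n * B n + Q' n * A n + P n * D n - R n
    = R n * (K n - 1) + Q n * B n + Q' n * A n + P n * D n by ring]
  have h1 := t (hR.trans hRY) (hb.K_sub n)
  have h2 := t (hQ.trans hQY) (hb.B_le n)
  have h3 := t (hQ'.trans hQY) (hb.A_le n)
  have h4 := t hP (hb.D_le n)
  refine ((norm_add_le (R n * (K n - 1) + Q n * B n + Q' n * A n) (P n * D n)).trans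
    (add_le_add_left ((norm_add_le (R n * (K n - 1) + Q n * B n) (Q' n * A n)).trans
      (add_le_add_left (norm_add_le (R n * (K n - 1)) (Q n * B n)) _)) _)).trans
    (le_trans (add_le_add (add_le_add (add_le_add h1 h2) h3) h4) ?_)
  have hbe : 0 ≤ b * ε n := mul_nonneg hb0 (hε n)
  have hY4 : Y ^ 2 ≤ Y ^ 4 := pow_le_pow_right₀ hY (by norm_num)
  have hY40 : 1 ≤ Y ^ 4 := one_le_pow₀ hY
  have e : (3 * (1 + S) ^ 2) * Y ^ 4 + 2 * ((1 + S) * Y ^ 2) + 1 ≤ 8 * (1 + S) ^ 2 * Y ^ 4 := by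
    have h5 : (1 + S) * Y ^ 2 ≤ (1 + S) ^ 2 * Y ^ 4 := by
      apply mul_le_mul _ hY4 (by positivity) (by positivity)
      nlinarith
    have h6 : 1 ≤ (1 + S) ^ 2 * Y ^ 4 := one_le_mul_of_one_le_of_one_le
      (one_le_pow₀ (by linarith)) hY40
    nlinarith
  calc _ = (b * ε n) * ((3 * (1 + S) ^ 2) * Y ^ 4 + 2 * ((1 + S) * Y ^ 2) + 1) := by ring
    _ ≤ (b * ε n) * (8 * (1 + S) ^ 2 * Y ^ 4) := by gcongr
    _ = _ := by ring

end MomentRecursion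

/-- Moment recursions with enough decaying factors `K` have rapidly decaying limits. -/
theorem exists_rapid_limit_of_momentRecursion {V : Type*} [NormedAddCommGroup V]
    {K A B D P Q Q' R : ℝ → V → ℕ → ℂ} {ε : ℕ → ℝ} {C₀ : ℝ} (hε : ∀ n, 0 ≤ ε n)
    (hεs : Summable ε)
    (hrec : ∀ σ, 1 ≤ σ → ∀ y, MomentRecursion (K σ y) (A σ y) (B σ y) (D σ y)
      (P σ y) (Q σ y) (Q' σ y) (R σ y))
    (hb : ∀ σ, 1 ≤ σ → ∀ y, MomentBounds (K σ y) (A σ y) (B σ y) (D σ y) ε (1 + ‖y‖))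
    (hA : ∀ σ, 1 ≤ σ → ∀ y n, ‖A σ y n‖ ≤ C₀) (hB : ∀ σ, 1 ≤ σ → ∀ y n, ‖B σ y n‖ ≤ C₀)
    {n₀ : ℕ → ℕ} (hgood : ∀ (t : ℕ) (M : ℝ), ∃ c : ℝ, ∀ σ ∈ Set.Icc 1 M, ∀ y, ∃ G : Finset ℕ,
      t ≤ G.card ∧ ∀ m ∈ G, m < n₀ t ∧ ‖K σ y m‖ ≤ c * (1 + ‖y‖) ^ (-(1 / 3) : ℝ)) :
    ∃ φ : ℝ → V → ℂ, ∀ (J : ℕ) (M : ℝ), ∃ (C : ℝ) (δ : ℕ → ℝ), Tendsto δ atTop (𝓝 0) ∧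
      ∀ n, n₀ (3 * (J + 4) + 2) ≤ n → ∀ σ ∈ Set.Icc 1 M, ∀ y,
        ‖R σ y n‖ ≤ C * ((1 + ‖y‖) ^ J)⁻¹ ∧ ‖R σ y n - φ σ y‖ ≤ δ n * ((1 + ‖y‖) ^ J)⁻¹ := by
  set S := ∑' n, ε n with hSdef
  have hS : ∀ s : Finset ℕ, ∑ m ∈ s, ε m ≤ S := fun s => hεs.sum_le_tsum s fun m _ => hε m
  have hS0 : 0 ≤ S := by simpa using hS ∅
  have hεS : ∀ n, ε n ≤ S := fun n => by simpa using hS {n}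
  have key : ∀ (J : ℕ) (M : ℝ), ∃ C : ℝ, ∀ n, n₀ (3 * (J + 4) + 2) ≤ n →
      ∀ σ ∈ Set.Icc 1 M, ∀ y, ‖R σ y n‖ ≤ 3 * (1 + S) ^ 2 * (C * ((1 + ‖y‖) ^ J)⁻¹) ∧
        ‖R σ y (n + 1) - R σ y n‖ ≤ 8 * (1 + S) ^ 2 * (C * ((1 + ‖y‖) ^ J)⁻¹) * ε n := by
    intro J M
    obtain ⟨c₁, hc₁⟩ := hgood (3 * (J + 4) + 2) M
    set N := n₀ (3 * (J + 4) + 2)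
    set c := max (max c₁ 1) (max C₀ S)
    have hcc : c₁ ≤ c := (le_max_left _ _).trans (le_max_left _ _)
    have hc1 : 1 ≤ c := (le_max_right _ _).trans (le_max_left _ _)
    have hc0 : 0 < c := by linarith
    have hcC : C₀ ≤ c := (le_max_left _ _).trans (le_max_right _ _)
    have hcS : S ≤ c := (le_max_right _ _).trans (le_max_right _ _)
    refine ⟨(4 * c) ^ N, fun n hn σ hσ y => ?_⟩
    obtain ⟨G, hGt, hG⟩ := hc₁ σ hσ y
    have hY : 1 ≤ 1 + ‖y‖ := by linarith [norm_nonneg y]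
    set Y := 1 + ‖y‖
    set d := Y ^ (-(1 / 3) : ℝ) with hd
    have hd0 : 0 < d := Real.rpow_pos_of_pos (by linarith) _
    have hd1 : d ≤ 1 := Real.rpow_le_one_of_one_le_of_nonpos hY (by norm_num)
    have hd3 : d ^ (3 * (J + 4)) = (Y ^ (J + 4))⁻¹ := by
      rw [pow_mul, ← Real.rpow_natCast d 3, hd, ← Real.rpow_mul (by linarith)]
      norm_num
      rw [Real.rpow_neg_one, inv_pow]
    have hbb := hb σ hσ.1 y
    obtain ⟨h1, h2, h3, h4⟩ := (hrec σ hσ.1 y).decay hc1 hd0.le hd1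
      (fun m => (hA σ hσ.1 y m).trans hcC) (fun m => (hB σ hσ.1 y m).trans hcC)
      (fun m => (hbb.D_le m).trans ((hεS m).trans hcS)) hbb.K_le G
      (fun m hm => (hG m hm).2.trans (by gcongr)) N
    rw [Finset.filter_true_of_mem fun m hm => (hG m hm).1] at h1 h2 h3 h4
    -- Of the `3 * (J + 4) + 2` good indices, two cancel the weight `d ^ 2` on `R`. The others give
    -- `Y ^ (-(J + 4))`, of which `Y ^ 4` will be spent on the increments beyond `N`.
    have hle : (4 * c) ^ N * d ^ G.card ≤ (4 * c) ^ N * (Y ^ (J + 4))⁻¹ * d ^ 2 := by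
      rw [mul_assoc, ← hd3, ← pow_add]
      exact mul_le_mul_of_nonneg_left (pow_le_pow_of_le_one hd0.le hd1 hGt) (by positivity)
    have hd2 : d ^ 2 ≤ d := by nlinarith
    set b := (4 * c) ^ N * (Y ^ (J + 4))⁻¹ with hbdef
    have hb0 : 0 ≤ b := by positivity
    have g1 : ‖P σ y N‖ ≤ b := h1.trans (hle.trans (mul_le_of_le_one_right hb0 (hd2.trans hd1)))
    have g2 : ∀ {z : ℂ}, ‖z‖ * d ≤ (4 * c) ^ N * d ^ G.card → ‖z‖ ≤ b := fun hz =>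
      le_of_mul_le_mul_right (hz.trans (hle.trans (by gcongr))) hd0
    have g4 : ‖R σ y N‖ ≤ b := le_of_mul_le_mul_right (h4.trans hle) (by positivity)
    obtain ⟨r1, r2⟩ := (hrec σ hσ.1 y).norm_R_le hbb hε hS hY g1 (g2 h2) (g2 h3) g4 hn
    have hY0 : 0 < Y := by linarith
    have e4 : b * Y ^ 4 = (4 * c) ^ N * (Y ^ J)⁻¹ := by
      rw [hbdef, pow_add]; field_simp
    have e2 : b * Y ^ 2 ≤ (4 * c) ^ N * (Y ^ J)⁻¹ := by
      rw [← e4]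
      exact mul_le_mul_of_nonneg_left (pow_le_pow_right₀ hY (by norm_num)) hb0
    refine ⟨r1.trans (by gcongr), ?_⟩
    rwa [e4] at r2
  -- The limit is named before `J` and `M` are given, so that one `φ` serves them all.
  refine ⟨fun σ y => limUnder atTop (R σ y), fun J M => ?_⟩
  obtain ⟨C, hC⟩ := key J M
  refine ⟨3 * (1 + S) ^ 2 * C, fun n => 8 * (1 + S) ^ 2 * C * ∑' m, ε (m + n), ?_, ?_⟩
  · have := (tendsto_sum_nat_add ε).const_mul (8 * (1 + S) ^ 2 * C)
    simpa using this
  · intro n hn σ hσ y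
    obtain ⟨h1, -⟩ := hC n hn σ hσ y
    refine ⟨by rw [mul_assoc]; exact h1, ?_⟩
    set w := ((1 + ‖y‖) ^ J)⁻¹
    have hd : ∀ m, dist (R σ y (m + n)) (R σ y (m.succ + n))
        ≤ 8 * (1 + S) ^ 2 * (C * w) * ε (m + n) := by
      intro m
      rw [dist_comm, dist_eq_norm, Nat.succ_add]
      exact (hC (m + n) (hn.trans (Nat.le_add_left _ _)) σ hσ y).2
    have hsum : Summable fun m => 8 * (1 + S) ^ 2 * (C * w) * ε (m + n) :=
      ((summable_nat_add_iff n).2 hεs).mul_left _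
    have hcau : CauchySeq (fun m => R σ y (m + n)) := cauchySeq_of_dist_le_of_summable _ hd hsum
    obtain ⟨a, ha⟩ := cauchySeq_tendsto_of_complete hcau
    have ha' : Tendsto (R σ y) atTop (𝓝 a) := (tendsto_add_atTop_iff_nat n).1 ha
    simp only [ha'.limUnder_eq]
    have := dist_le_tsum_of_dist_le_of_tendsto₀ _ hd hsum ha
    rw [zero_add, dist_eq_norm, tsum_mul_left] at this
    refine this.trans (le_of_eq ?_)
    ring

/-! ### Moments of sums of independent variables on the box -/

/-- Lebesgue measure on the box `[0,1)^n`. -/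
noncomputable def boxMeasure (n : ℕ) : Measure (Fin n → ℝ) :=
  Measure.pi fun _ => (volume : Measure ℝ).restrict (Set.Ico 0 1)

instance : IsProbabilityMeasure ((volume : Measure ℝ).restrict (Set.Ico 0 1)) :=
  ⟨by simp⟩

instance (n : ℕ) : IsProbabilityMeasure (boxMeasure n) := by
  unfold boxMeasure; infer_instance

theorem volume_restrict_box (n : ℕ) :
    (volume : Measure (Fin n → ℝ)).restrict (Set.univ.pi fun _ : Fin n => Set.Ico (0 : ℝ) 1)
      = boxMeasure n := by
  unfold boxMeasure
  rw [volume_pi, Measure.restrict_pi_pi]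

theorem integrable_box_of_continuous {n : ℕ} {u : (Fin n → ℝ) → ℂ} (hu : Continuous u) :
    Integrable u (boxMeasure n) := by
  rw [← volume_restrict_box]
  refine (hu.integrableOn_Icc (a := (0 : Fin n → ℝ)) (b := 1)).mono_set fun x hx => ?_
  rw [Set.mem_univ_pi] at hx
  exact ⟨fun i => (hx i).1, fun i => (hx i).2.le⟩

/-- Independence of the last coordinate, in the form that drives the recursion. -/
theorem integral_box_succ {n : ℕ} (u : (Fin n → ℝ) → ℂ) (v : ℝ → ℂ) :
    ∫ θ, u (fun j => θ j.castSucc) * v (θ (Fin.last n)) ∂(boxMeasure (n + 1))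
      = (∫ θ, u θ ∂(boxMeasure n)) * ∫ t in Set.Ico (0 : ℝ) 1, v t := by
  have h := measurePreserving_piFinSuccAbove
    (fun _ : Fin (n + 1) => (volume : Measure ℝ).restrict (Set.Ico 0 1)) (Fin.last n)
  have h2 := h.integral_comp' (fun z : ℝ × (Fin n → ℝ) => v z.1 * u z.2)
  rw [integral_prod_mul] at h2
  rw [mul_comm]
  refine Eq.trans ?_ h2
  refine integral_congr_ae (ae_of_all _ fun θ => ?_)
  simp [MeasurableEquiv.piFinSuccAbove, Fin.insertNthEquiv, Fin.removeNth_last, Fin.init_def,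
    mul_comm]

section BoxMoments

variable (f : ℕ → ℝ → ℂ) (g : ℕ → ℝ → ℝ)

/-- `exp (i ∑ g_m(θ_m))`. -/
noncomputable def boxPhase (n : ℕ) (θ : Fin n → ℝ) : ℂ :=
  Complex.exp (((∑ m : Fin n, g m (θ m) : ℝ) : ℂ) * Complex.I)

/-- `∑ f_m(θ_m)`. -/
noncomputable def boxSum (n : ℕ) (θ : Fin n → ℝ) : ℂ := ∑ m : Fin n, f m (θ m)

theorem boxPhase_succ (n : ℕ) (θ : Fin (n + 1) → ℝ) :
    boxPhase g (n + 1) θ = boxPhase g n (fun j => θ j.castSucc) *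
      Complex.exp ((g n (θ (Fin.last n)) : ℂ) * Complex.I) := by
  unfold boxPhase
  rw [Fin.sum_univ_castSucc, ← Complex.exp_add, ← add_mul]
  simp

theorem boxSum_succ (n : ℕ) (θ : Fin (n + 1) → ℝ) :
    boxSum f (n + 1) θ = boxSum f n (fun j => θ j.castSucc) + f n (θ (Fin.last n)) := by
  unfold boxSum
  rw [Fin.sum_univ_castSucc]
  simp

theorem continuous_boxPhase {g : ℕ → ℝ → ℝ} (hg : ∀ m, Continuous (g m)) (n : ℕ) :
    Continuous (boxPhase g n) := by
  unfold boxPhase; fun_prop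

theorem continuous_boxSum {f : ℕ → ℝ → ℂ} (hf : ∀ m, Continuous (f m)) (n : ℕ) :
    Continuous (boxSum f n) := by
  unfold boxSum; fun_prop

-- The phase is multiplicative and the sum additive in the last coordinate. Expanding `(S + f)
-- conj(S + f)` gives four products, each of which factors by independence.
open ComplexConjugate in
theorem momentRecursion_box {f : ℕ → ℝ → ℂ} {g : ℕ → ℝ → ℝ} (hf : ∀ m, Continuous (f m))
    (hg : ∀ m, Continuous (g m)) :
    MomentRecursion
      (fun m => ∫ t in Set.Ico (0 : ℝ) 1, Complex.exp ((g m t : ℂ) * Complex.I))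
      (fun m => ∫ t in Set.Ico (0 : ℝ) 1, f m t * Complex.exp ((g m t : ℂ) * Complex.I))
      (fun m => ∫ t in Set.Ico (0 : ℝ) 1, conj (f m t) * Complex.exp ((g m t : ℂ) * Complex.I))
      (fun m => ∫ t in Set.Ico (0 : ℝ) 1,
        f m t * conj (f m t) * Complex.exp ((g m t : ℂ) * Complex.I))
      (fun n => ∫ θ, boxPhase g n θ ∂(boxMeasure n))
      (fun n => ∫ θ, boxSum f n θ * boxPhase g n θ ∂(boxMeasure n))
      (fun n => ∫ θ, conj (boxSum f n θ) * boxPhase g n θ ∂(boxMeasure n))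
      (fun n => ∫ θ, boxSum f n θ * conj (boxSum f n θ) * boxPhase g n θ ∂(boxMeasure n)) where
  P_zero := by simp [boxPhase]
  Q_zero := by simp [boxSum]
  Q'_zero := by simp [boxSum]
  R_zero := by simp [boxSum]
  P_succ n := by
    rw [← integral_box_succ]
    simp_rw [boxPhase_succ]
  Q_succ n := by
    have hs := continuous_boxSum hf n
    have hp := continuous_boxPhase hg n
    have hfn := hf n
    have hgn := hg n
    rw [← integral_box_succ, ← integral_box_succ, ← integral_add]
    · refine integral_congr_ae (ae_of_all _ fun θ => ?_)
      simp only [boxPhase_succ, boxSum_succ]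
      ring
    · exact integrable_box_of_continuous (by fun_prop)
    · exact integrable_box_of_continuous (by fun_prop)
  Q'_succ n := by
    have hs := continuous_boxSum hf n
    have hp := continuous_boxPhase hg n
    have hfn := hf n
    have hgn := hg n
    rw [← integral_box_succ, ← integral_box_succ, ← integral_add]
    · refine integral_congr_ae (ae_of_all _ fun θ => ?_)
      simp only [boxPhase_succ, boxSum_succ, map_add]
      ring
    · exact integrable_box_of_continuous (by fun_prop)
    · exact integrable_box_of_continuous (by fun_prop)
  R_succ n := by
    have hs := continuous_boxSum hf n
    have hp := continuous_boxPhase hg n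
    have hfn := hf n
    have hgn := hg n
    rw [← integral_box_succ, ← integral_box_succ, ← integral_box_succ, ← integral_box_succ,
      ← integral_add, ← integral_add, ← integral_add]
    · refine integral_congr_ae (ae_of_all _ fun θ => ?_)
      simp only [boxPhase_succ, boxSum_succ, map_add]
      ring
    all_goals exact integrable_box_of_continuous (by fun_prop)

end BoxMoments

/-! ### Van der Corput estimates -/

section OscillatoryIntegrals

/-- First derivative test. -/
theorem norm_integral_exp_le_of_le_abs_deriv {g g' g'' : ℝ → ℝ} (hg : ∀ t, HasDerivAt g (g' t) t)
    (hg' : ∀ t, HasDerivAt g' (g'' t) t) (hc : Continuous g'') {a b l R : ℝ} (hab : a ≤ b)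
    (hl : 0 < l) (h1 : ∀ t ∈ Set.Icc a b, l ≤ |g' t|) (h2 : ∀ t ∈ Set.Icc a b, |g'' t| ≤ R) :
    ‖∫ t in a..b, Complex.exp ((g t : ℂ) * Complex.I)‖ ≤ 2 / l + R * (b - a) / l ^ 2 := by
  have hgc : Continuous g := continuous_iff_continuousAt.2 fun t => (hg t).continuousAt
  have hgc' : Continuous g' := continuous_iff_continuousAt.2 fun t => (hg' t).continuousAt
  have hne : ∀ t ∈ Set.uIcc a b, g' t ≠ 0 := fun t ht h0 => by
    rw [Set.uIcc_of_le hab] at ht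
    have := h1 t ht
    rw [h0, abs_zero] at this
    linarith
  have hu : ∀ t ∈ Set.uIcc a b, HasDerivAt (fun t => (((g' t)⁻¹ : ℝ) : ℂ))
      ((-(g'' t) / (g' t) ^ 2 : ℝ) : ℂ) t := fun t ht => ((hg' t).inv (hne t ht)).ofReal_comp
  have hv : ∀ t ∈ Set.uIcc a b, HasDerivAt (fun t => -Complex.I * Complex.exp ((g t : ℂ) *
      Complex.I)) ((g' t : ℂ) * Complex.exp ((g t : ℂ) * Complex.I)) t := fun t _ => by
    have := (((hg t).ofReal_comp.mul_const Complex.I).cexp).const_mul (-Complex.I)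
    refine this.congr_deriv ?_
    linear_combination (-(g' t : ℂ) * Complex.exp ((g t : ℂ) * Complex.I)) * Complex.I_mul_I
  have hgi : ContinuousOn (fun t => -(g'' t) / (g' t) ^ 2) (Set.uIcc a b) :=
    hc.neg.continuousOn.div (hgc'.pow 2).continuousOn fun t ht => pow_ne_zero 2 (hne t ht)
  -- Integration by parts in `(1 / g') * (g' e^{ig})`: the boundary terms give `2 / l`, the integral
  -- of `g'' / g' ^ 2` gives the rest.
  have hparts := intervalIntegral.integral_mul_deriv_eq_deriv_mul hu hv
    (Complex.continuous_ofReal.comp_continuousOn hgi).intervalIntegrable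
    ((by fun_prop : Continuous fun t => (g' t : ℂ) *
      Complex.exp ((g t : ℂ) * Complex.I)).intervalIntegrable a b)
  have e1 : ∫ t in a..b, Complex.exp ((g t : ℂ) * Complex.I) = ∫ t in a..b,
      (((g' t)⁻¹ : ℝ) : ℂ) * ((g' t : ℂ) * Complex.exp ((g t : ℂ) * Complex.I)) := by
    refine intervalIntegral.integral_congr fun t ht => ?_
    have : (g' t : ℂ) ≠ 0 := by exact_mod_cast hne t ht
    push_cast
    field_simp
  have hE : ∀ t, ‖-Complex.I * Complex.exp ((g t : ℂ) * Complex.I)‖ = 1 := fun t => by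
    rw [norm_mul, Complex.norm_exp_ofReal_mul_I]; simp
  have hinv : ∀ t ∈ Set.Icc a b, ‖(((g' t)⁻¹ : ℝ) : ℂ)‖ ≤ 1 / l := fun t ht => by
    rw [Complex.norm_real, Real.norm_eq_abs, abs_inv, ← one_div]
    exact one_div_le_one_div_of_le hl (h1 t ht)
  rw [e1, hparts]
  refine (norm_sub_le _ _).trans (add_le_add ?_ ?_)
  · refine (norm_sub_le _ _).trans ?_
    rw [norm_mul _ (-Complex.I * _), norm_mul _ (-Complex.I * _), hE, hE, mul_one, mul_one]
    have := add_le_add (hinv b ⟨hab, le_rfl⟩) (hinv a ⟨le_rfl, hab⟩)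
    refine this.trans (le_of_eq (by ring))
  · have : ∀ t ∈ Set.uIoc a b, ‖((-(g'' t) / (g' t) ^ 2 : ℝ) : ℂ) *
        (-Complex.I * Complex.exp ((g t : ℂ) * Complex.I))‖ ≤ R / l ^ 2 := fun t ht => by
      rw [Set.uIoc_of_le hab] at ht
      have ht' : t ∈ Set.Icc a b := ⟨ht.1.le, ht.2⟩
      rw [norm_mul, hE, mul_one, Complex.norm_real, Real.norm_eq_abs, abs_div, abs_neg,
        abs_of_nonneg (sq_nonneg (g' t)), ← sq_abs (g' t)]
      have h3 := h2 t ht'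
      have h4 := h1 t ht'
      have : 0 ≤ R := (abs_nonneg _).trans h3
      gcongr
    refine (intervalIntegral.norm_integral_le_of_norm_le_const this).trans (le_of_eq ?_)
    rw [abs_of_nonneg (sub_nonneg.2 hab)]
    ring

/-- Second derivative test, in a weak form. -/
theorem norm_integral_exp_le_of_le_deriv2 {g g' g'' : ℝ → ℝ} (hg : ∀ t, HasDerivAt g (g' t) t)
    (hg' : ∀ t, HasDerivAt g' (g'' t) t) (hc : Continuous g'') {a b l R δ : ℝ} (hab : a ≤ b)
    (hl : 0 < l) (hδ : 0 < δ) (h1 : ∀ t ∈ Set.Icc a b, l ≤ g'' t)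
    (h2 : ∀ t ∈ Set.Icc a b, |g'' t| ≤ R) :
    ‖∫ t in a..b, Complex.exp ((g t : ℂ) * Complex.I)‖ ≤
      2 * δ + 2 * (2 / (l * δ) + R * (b - a) / (l * δ) ^ 2) := by
  have hgc : Continuous g := continuous_iff_continuousAt.2 fun t => (hg t).continuousAt
  have hgc' : Continuous g' := continuous_iff_continuousAt.2 fun t => (hg' t).continuousAt
  have hR : 0 ≤ R := (abs_nonneg _).trans (h2 a ⟨le_rfl, hab⟩)
  have hmono : ∀ s ∈ Set.Icc a b, ∀ t ∈ Set.Icc a b, s ≤ t → l * (t - s) ≤ g' t - g' s :=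
    (convex_Icc a b).mul_sub_le_image_sub_of_le_deriv hgc'.continuousOn
      (fun t _ => (hg' t).differentiableAt.differentiableWithinAt)
      fun t ht => by rw [(hg' t).deriv]; exact h1 t (interior_subset ht)
  -- The point `c` is the zero of the increasing function `g'`, or the endpoint on whose side the
  -- zero would lie. At distance `δ` from `c` the first derivative test applies; the window around
  -- `c`, of width at most `2 * δ`, is estimated trivially.
  obtain ⟨c, hcm, hc1, hc2⟩ : ∃ c ∈ Set.Icc a b, (∀ t ∈ Set.Icc a b, c + δ ≤ t → l * δ ≤ g' t) ∧
      ∀ t ∈ Set.Icc a b, t ≤ c - δ → l * δ ≤ -g' t := by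
    by_cases ha : 0 ≤ g' a
    · refine ⟨a, ⟨le_rfl, hab⟩, fun t ht h => ?_, fun t ht h => ?_⟩
      · have := hmono a ⟨le_rfl, hab⟩ t ht ht.1
        nlinarith
      · linarith [ht.1]
    by_cases hb : g' b ≤ 0
    · refine ⟨b, ⟨hab, le_rfl⟩, fun t ht h => ?_, fun t ht h => ?_⟩
      · linarith [ht.2]
      · have := hmono t ht b ⟨hab, le_rfl⟩ ht.2
        nlinarith
    obtain ⟨c, hcm, hc0⟩ := intermediate_value_Icc hab hgc'.continuousOn
      (⟨(not_le.1 ha).le, (not_le.1 hb).le⟩ : (0 : ℝ) ∈ Set.Icc (g' a) (g' b))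
    refine ⟨c, hcm, fun t ht h => ?_, fun t ht h => ?_⟩
    · have := hmono c hcm t ht (by linarith)
      nlinarith
    · have := hmono t ht c hcm (by linarith)
      nlinarith
  set p := max a (c - δ) with hp
  set q := min b (c + δ) with hq
  have hap : a ≤ p := le_max_left _ _
  have hpc : p ≤ c := max_le hcm.1 (by linarith)
  have hcq : c ≤ q := le_min hcm.2 (by linarith)
  have hqb : q ≤ b := min_le_left _ _
  have hi : ∀ x y : ℝ, IntervalIntegrable (fun t => Complex.exp ((g t : ℂ) * Complex.I))
      volume x y := fun x y => (by fun_prop : Continuous _).intervalIntegrable x y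
  rw [← intervalIntegral.integral_add_adjacent_intervals (hi a p) (hi p b),
    ← intervalIntegral.integral_add_adjacent_intervals (hi p q) (hi q b)]
  have hlδ : 0 < l * δ := mul_pos hl hδ
  have hB : 0 ≤ 2 / (l * δ) + R * (b - a) / (l * δ) ^ 2 := by
    have := sub_nonneg.2 hab
    positivity
  have k1 : ‖∫ t in a..p, Complex.exp ((g t : ℂ) * Complex.I)‖ ≤
      2 / (l * δ) + R * (b - a) / (l * δ) ^ 2 := by
    rcases le_total (c - δ) a with h | h
    · rw [hp, max_eq_left h, intervalIntegral.integral_same, norm_zero]; exact hB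
    · have hpe : p = c - δ := max_eq_right h
      have hsub : ∀ t ∈ Set.Icc a p, t ∈ Set.Icc a b := fun t ht => ⟨ht.1, by linarith [ht.2]⟩
      refine (norm_integral_exp_le_of_le_abs_deriv hg hg' hc hap hlδ (fun t ht => ?_)
        fun t ht => h2 t (hsub t ht)).trans ?_
      · exact (hc2 t (hsub t ht) (hpe ▸ ht.2)).trans (neg_le_abs _)
      · gcongr; linarith
  have k2 : ‖∫ t in p..q, Complex.exp ((g t : ℂ) * Complex.I)‖ ≤ 2 * δ := by
    refine (intervalIntegral.norm_integral_le_of_norm_le_const (C := 1)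
      fun t _ => (Complex.norm_exp_ofReal_mul_I _).le).trans ?_
    rw [one_mul, abs_of_nonneg (by linarith)]
    have h3 : c - δ ≤ p := le_max_right _ _
    have h4 : q ≤ c + δ := min_le_right _ _
    linarith
  have k3 : ‖∫ t in q..b, Complex.exp ((g t : ℂ) * Complex.I)‖ ≤
      2 / (l * δ) + R * (b - a) / (l * δ) ^ 2 := by
    rcases le_total b (c + δ) with h | h
    · rw [hq, min_eq_left h, intervalIntegral.integral_same, norm_zero]; exact hB
    · have hqe : q = c + δ := min_eq_right h
      have hsub : ∀ t ∈ Set.Icc q b, t ∈ Set.Icc a b := fun t ht => ⟨by linarith [ht.1], ht.2⟩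
      refine (norm_integral_exp_le_of_le_abs_deriv hg hg' hc hqb hlδ (fun t ht => ?_)
        fun t ht => h2 t (hsub t ht)).trans ?_
      · exact (hc1 t (hsub t ht) (hqe ▸ ht.1)).trans (le_abs_self _)
      · gcongr; linarith
  refine (norm_add_le _ _).trans ((add_le_add le_rfl (norm_add_le _ _)).trans ?_)
  linarith

/-- Complex conjugation replaces `g` by `-g` without changing the norm. -/
theorem norm_integral_exp_le_of_deriv2_le {g g' g'' : ℝ → ℝ} (hg : ∀ t, HasDerivAt g (g' t) t)
    (hg' : ∀ t, HasDerivAt g' (g'' t) t) (hc : Continuous g'') {a b l R δ : ℝ} (hab : a ≤ b)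
    (hl : 0 < l) (hδ : 0 < δ) (h1 : ∀ t ∈ Set.Icc a b, g'' t ≤ -l)
    (h2 : ∀ t ∈ Set.Icc a b, |g'' t| ≤ R) :
    ‖∫ t in a..b, Complex.exp ((g t : ℂ) * Complex.I)‖ ≤
      2 * δ + 2 * (2 / (l * δ) + R * (b - a) / (l * δ) ^ 2) := by
  have h := norm_integral_exp_le_of_le_deriv2 (fun t => (hg t).neg) (fun t => (hg' t).neg) hc.neg
    hab hl hδ (fun t ht => by have := h1 t ht; linarith)
    (fun t ht => by simp only [abs_neg]; exact h2 t ht)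
  refine le_trans (le_of_eq ?_) h
  rw [← Complex.norm_conj, ← intervalIntegral.intervalIntegral_conj]
  congr 1
  refine intervalIntegral.integral_congr fun t _ => ?_
  rw [← Complex.exp_conj]
  simp

theorem seven_tenths_le_cos {t : ℝ} (ht : |t| ≤ 1 / 8) : (7 / 10 : ℝ) ≤ Real.cos (2 * Real.pi * t) := by
  have hpi := Real.pi_pos
  have h1 : Real.cos (Real.pi / 4) ≤ Real.cos |2 * Real.pi * t| := by
    refine Real.cos_le_cos_of_nonneg_of_le_pi (abs_nonneg _) (by linarith) ?_
    rw [abs_mul, abs_of_pos (by positivity : 0 < 2 * Real.pi)]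
    nlinarith
  rw [Real.cos_abs, Real.cos_pi_div_four] at h1
  have : (14 / 10 : ℝ) ≤ √2 := Real.le_sqrt_of_sq_le (by norm_num)
  linarith

/-- A periodic phase close to `r cos (2π(t - α))`, with its first two derivatives, has an
exponential integral that is `O(r^{-1/3})`. -/
theorem norm_integral_exp_le_of_near_cos {g g' g'' : ℝ → ℝ} (hper : Function.Periodic g 1)
    (hg : ∀ t, HasDerivAt g (g' t) t) (hg' : ∀ t, HasDerivAt g' (g'' t) t) (hc : Continuous g'')
    {r α : ℝ} (hr : 0 < r)
    (h1 : ∀ t, |g' t + 2 * Real.pi * r * Real.sin (2 * Real.pi * (t - α))| ≤ Real.pi * r)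
    (h2 : ∀ t, |g'' t + 4 * Real.pi ^ 2 * r * Real.cos (2 * Real.pi * (t - α))| ≤
      2 * Real.pi ^ 2 * r) :
    ‖∫ t in (0 : ℝ)..1, Complex.exp ((g t : ℂ) * Complex.I)‖ ≤ 106 * r ^ (-(1 / 3) : ℝ) := by
  have hgc : Continuous g := continuous_iff_continuousAt.2 fun t => (hg t).continuousAt
  set δ := r ^ (-(1 / 3) : ℝ) with hδdef
  have hδ : 0 < δ := Real.rpow_pos_of_pos hr _
  rcases le_total r 1 with hr1 | hr1
  · have : 1 ≤ δ := Real.one_le_rpow_of_pos_of_le_one_of_nonpos hr hr1 (by norm_num)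
    refine (intervalIntegral.norm_integral_le_of_norm_le_const (C := 1)
      fun t _ => (Complex.norm_exp_ofReal_mul_I _).le).trans ?_
    norm_num
    linarith
  have hδ1 : δ ≤ 1 := Real.rpow_le_one_of_one_le_of_nonpos hr1 (by norm_num)
  have hδ3 : r * δ ^ 3 = 1 := by
    rw [← Real.rpow_natCast δ 3, hδdef, ← Real.rpow_mul hr.le]
    norm_num
    rw [Real.rpow_neg_one, mul_inv_cancel₀ hr.ne']
  have hpi3 := Real.pi_gt_three
  have hpi4 := Real.pi_lt_d2
  -- shift by `α`
  set u : ℝ → ℝ := fun t => g (t + α)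
  have hu : ∀ t, HasDerivAt u (g' (t + α)) t := fun t => (hg (t + α)).comp_add_const t α
  have hu' : ∀ t, HasDerivAt (fun t => g' (t + α)) (g'' (t + α)) t := fun t =>
    (hg' (t + α)).comp_add_const t α
  have huc : Continuous (fun t => g'' (t + α)) := by fun_prop
  have huc0 : Continuous u := by fun_prop
  have k1 : ∀ t, |g' (t + α) + 2 * Real.pi * r * Real.sin (2 * Real.pi * t)| ≤ Real.pi * r :=
    fun t => by simpa using h1 (t + α)
  have k2 : ∀ t, |g'' (t + α) + 4 * Real.pi ^ 2 * r * Real.cos (2 * Real.pi * t)| ≤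
      2 * Real.pi ^ 2 * r := fun t => by simpa using h2 (t + α)
  have hR : ∀ t, |g'' (t + α)| ≤ 60 * r := by
    intro t
    have h3 := abs_le.1 (k2 t)
    have h4 := Real.cos_le_one (2 * Real.pi * t)
    have h5 := Real.neg_one_le_cos (2 * Real.pi * t)
    have h6 : 0 < 4 * Real.pi ^ 2 * r := by positivity
    have h7 : Real.pi ^ 2 ≤ 10 := by nlinarith
    rw [abs_le]
    constructor <;> nlinarith
  have q1 : ∀ t, (7 / 10 ≤ Real.cos (2 * Real.pi * t) → g'' (t + α) ≤ -r) ∧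
      (Real.cos (2 * Real.pi * t) ≤ -(7 / 10) → r ≤ g'' (t + α)) := by
    intro t
    have h3 := abs_le.1 (k2 t)
    have h6 : 9 * r ≤ Real.pi ^ 2 * r := by
      have : 9 ≤ Real.pi ^ 2 := by nlinarith
      gcongr
    constructor <;> intro h <;> nlinarith
  have q2 : ∀ t, 7 / 10 ≤ |Real.sin (2 * Real.pi * t)| → r ≤ |g' (t + α)| := by
    intro t h
    have h3 := abs_sub_abs_le_abs_sub (2 * Real.pi * r * Real.sin (2 * Real.pi * t))
      (-g' (t + α))
    rw [sub_neg_eq_add, add_comm _ (g' _), abs_neg, abs_mul,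
      abs_of_pos (by positivity : 0 < 2 * Real.pi * r)] at h3
    have h4 := k1 t
    have h5 : 2 * Real.pi * r * (7 / 10) ≤ 2 * Real.pi * r * |Real.sin (2 * Real.pi * t)| := by
      gcongr
    nlinarith
  have hi : ∀ x y : ℝ, IntervalIntegrable (fun t => Complex.exp ((u t : ℂ) * Complex.I))
      volume x y := fun x y => (by fun_prop : Continuous _).intervalIntegrable x y
  have hshift : ∫ t in (0 : ℝ)..1, Complex.exp ((g t : ℂ) * Complex.I)
      = ∫ t in (-1 / 8 : ℝ)..7 / 8, Complex.exp ((u t : ℂ) * Complex.I) := by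
    have hp : Function.Periodic (fun t => Complex.exp ((g t : ℂ) * Complex.I)) 1 := fun t => by
      simp only [hper t]
    have := hp.intervalIntegral_add_eq 0 (-1 / 8 + α)
    rw [intervalIntegral.integral_comp_add_right
      (fun t => Complex.exp ((g t : ℂ) * Complex.I)) α]
    rw [zero_add] at this
    rw [this]
    congr 1
    ring
  -- Four quarter periods: around the two extrema of the cosine `|g''| ≥ r`, on the other two `|g'|
  -- ≥ r`. They contribute `36 * δ` and `17 * δ` each, whence `106 = 2 * (36 + 17)`.
  rw [hshift, ← intervalIntegral.integral_add_adjacent_intervals (hi (-1 / 8) (1 / 8)) (hi _ _),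
    ← intervalIntegral.integral_add_adjacent_intervals (hi (1 / 8) (3 / 8)) (hi _ _),
    ← intervalIntegral.integral_add_adjacent_intervals (hi (3 / 8) (5 / 8)) (hi _ _)]
  -- The choice `δ = r ^ (-1/3)` balances the trivial window `2 * δ` against the error `r / (r * δ)
  -- ^ 2`.
  have e1 : 1 / (r * δ) = δ ^ 2 := by
    rw [div_eq_iff (by positivity)]; linarith
  have e2 : r / (r * δ) ^ 2 = δ := by
    rw [div_eq_iff (by positivity)]
    linear_combination (-r) * hδ3
  have e3 : 1 / r = δ ^ 3 := by
    rw [div_eq_iff (by positivity)]; linarith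
  have hδ2 : δ ^ 2 ≤ δ := by nlinarith
  have hδ3' : δ ^ 3 ≤ δ := by nlinarith
  have b2 : 2 * δ + 2 * (2 / (r * δ) + 60 * r * (1 / 4) / (r * δ) ^ 2) ≤ 36 * δ := by
    have : 2 * δ + 2 * (2 / (r * δ) + 60 * r * (1 / 4) / (r * δ) ^ 2)
      = 2 * δ + 4 * (1 / (r * δ)) + 30 * (r / (r * δ) ^ 2) := by ring
    rw [this, e1, e2]
    linarith
  have b1 : 2 / r + 60 * r * (1 / 4) / r ^ 2 ≤ 17 * δ := by
    have : 2 / r + 60 * r * (1 / 4) / r ^ 2 = 17 * (1 / r) := by field_simp; ring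
    rw [this, e3]
    linarith
  have c1 : ‖∫ t in (-1 / 8 : ℝ)..1 / 8, Complex.exp ((u t : ℂ) * Complex.I)‖ ≤ 36 * δ := by
    have := norm_integral_exp_le_of_deriv2_le hu hu' huc (a := -1 / 8) (b := 1 / 8) (by norm_num)
      hr hδ (fun t ht => (q1 t).1 (seven_tenths_le_cos (by
        rw [abs_le]; constructor <;> linarith [ht.1, ht.2]))) (fun t _ => hR t)
    norm_num at this b2 ⊢
    exact this.trans b2
  have c2 : ‖∫ t in (1 / 8 : ℝ)..3 / 8, Complex.exp ((u t : ℂ) * Complex.I)‖ ≤ 17 * δ := by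
    have := norm_integral_exp_le_of_le_abs_deriv hu hu' huc (a := 1 / 8) (b := 3 / 8)
      (by norm_num) hr (fun t ht => q2 t (by
        have h3 := seven_tenths_le_cos (t := t - 1 / 4)
          (by rw [abs_le]; constructor <;> linarith [ht.1, ht.2])
        rw [show 2 * Real.pi * (t - 1 / 4) = 2 * Real.pi * t - Real.pi / 2 by ring,
          Real.cos_sub_pi_div_two] at h3
        exact h3.trans (le_abs_self _))) (fun t _ => hR t)
    norm_num at this b1 ⊢
    exact this.trans b1
  have c3 : ‖∫ t in (3 / 8 : ℝ)..5 / 8, Complex.exp ((u t : ℂ) * Complex.I)‖ ≤ 36 * δ := by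
    have := norm_integral_exp_le_of_le_deriv2 hu hu' huc (a := 3 / 8) (b := 5 / 8) (by norm_num)
      hr hδ (fun t ht => (q1 t).2 (by
        have h3 := seven_tenths_le_cos (t := t - 1 / 2)
          (by rw [abs_le]; constructor <;> linarith [ht.1, ht.2])
        rw [show 2 * Real.pi * (t - 1 / 2) = 2 * Real.pi * t - Real.pi by ring,
          Real.cos_sub_pi] at h3
        linarith)) (fun t _ => hR t)
    norm_num at this b2 ⊢
    exact this.trans b2
  have c4 : ‖∫ t in (5 / 8 : ℝ)..7 / 8, Complex.exp ((u t : ℂ) * Complex.I)‖ ≤ 17 * δ := by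
    have := norm_integral_exp_le_of_le_abs_deriv hu hu' huc (a := 5 / 8) (b := 7 / 8)
      (by norm_num) hr (fun t ht => q2 t (by
        have h3 := seven_tenths_le_cos (t := t - 3 / 4)
          (by rw [abs_le]; constructor <;> linarith [ht.1, ht.2])
        rw [show 2 * Real.pi * (t - 3 / 4) = (2 * Real.pi * t - Real.pi / 2) - Real.pi by ring,
          Real.cos_sub_pi, Real.cos_sub_pi_div_two] at h3
        exact h3.trans (neg_le_abs _))) (fun t _ => hR t)
    norm_num at this b1 ⊢
    exact this.trans b1
  refine (norm_add_le _ _).trans ((add_le_add le_rfl ((norm_add_le _ _).trans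
    (add_le_add le_rfl (norm_add_le _ _)))).trans ?_)
  linarith

end OscillatoryIntegrals

/-! ### Trigonometric series with positive frequencies and their exponential integrals -/

section TrigSeries

/-- `∑_k β_k e(-(k+1)t)`. -/
noncomputable def trigSeries (β : ℕ → ℂ) (t : ℝ) : ℂ :=
  ∑' k : ℕ, β k * Complex.exp ((-(2 * Real.pi * (k + 1) * t) : ℝ) * Complex.I)

/-- The coefficients of the derivative of a trigonometric series. -/
noncomputable def trigDeriv (β : ℕ → ℂ) (k : ℕ) : ℂ :=
  (-(2 * Real.pi * (k + 1)) : ℝ) * Complex.I * β k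

theorem norm_trigDeriv (β : ℕ → ℂ) (k : ℕ) :
    ‖trigDeriv β k‖ = 2 * Real.pi * ((k + 1) * ‖β k‖) := by
  rw [trigDeriv, norm_mul, norm_mul, Complex.norm_I, Complex.norm_real, norm_neg,
    Real.norm_of_nonneg (by positivity)]
  ring

theorem norm_trigTerm (β : ℕ → ℂ) (k : ℕ) (t : ℝ) :
    ‖β k * Complex.exp ((-(2 * Real.pi * (k + 1) * t) : ℝ) * Complex.I)‖ = ‖β k‖ := by
  rw [norm_mul, Complex.norm_exp_ofReal_mul_I, mul_one]

theorem summable_trigTerm {β : ℕ → ℂ} (h : Summable fun k => ‖β k‖) (t : ℝ) :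
    Summable fun k : ℕ =>
      β k * Complex.exp ((-(2 * Real.pi * (k + 1) * t) : ℝ) * Complex.I) :=
  Summable.of_norm (by simpa only [norm_trigTerm] using h)

theorem norm_trigSeries_le {β : ℕ → ℂ} (h : Summable fun k => ‖β k‖) (t : ℝ) :
    ‖trigSeries β t‖ ≤ ∑' k, ‖β k‖ := by
  refine (norm_tsum_le_tsum_norm (by simpa only [norm_trigTerm] using h)).trans (le_of_eq ?_)
  simp only [norm_trigTerm]

theorem continuous_trigSeries {β : ℕ → ℂ} (h : Summable fun k => ‖β k‖) :
    Continuous (trigSeries β) :=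
  continuous_tsum (fun k => by fun_prop) h fun k t => (norm_trigTerm β k t).le

theorem periodic_trigSeries (β : ℕ → ℂ) : Function.Periodic (trigSeries β) 1 := by
  intro t
  unfold trigSeries
  congr 1; ext k
  congr 1
  rw [Complex.exp_eq_exp_iff_exists_int]
  exact ⟨-((k : ℤ) + 1), by push_cast; ring⟩

theorem summable_norm_of_summable_mul {β : ℕ → ℂ} (h : Summable fun k : ℕ => (k + 1 : ℝ) * ‖β k‖) :
    Summable fun k => ‖β k‖ :=
  h.of_nonneg_of_le (fun _ => norm_nonneg _) fun k =>
    le_mul_of_one_le_left (norm_nonneg _) (by linarith [k.cast_nonneg (α := ℝ)])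

theorem hasDerivAt_trigSeries {β : ℕ → ℂ} (h : Summable fun k : ℕ => (k + 1 : ℝ) * ‖β k‖) (t : ℝ) :
    HasDerivAt (trigSeries β) (trigSeries (trigDeriv β) t) t := by
  have hterm : ∀ (k : ℕ) (t : ℝ), HasDerivAt
      (fun t : ℝ => β k * Complex.exp ((-(2 * Real.pi * (k + 1) * t) : ℝ) * Complex.I))
      (trigDeriv β k * Complex.exp ((-(2 * Real.pi * (k + 1) * t) : ℝ) * Complex.I)) t := by
    intro k t
    have h1 : HasDerivAt (fun t : ℝ => -(2 * Real.pi * (k + 1) * t)) (-(2 * Real.pi * (k + 1))) t :=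
      by simpa using ((hasDerivAt_id t).const_mul (2 * Real.pi * ((k : ℝ) + 1))).fun_neg
    have := ((h1.ofReal_comp.mul_const Complex.I).cexp).const_mul (β k)
    refine this.congr_deriv ?_
    rw [trigDeriv]
    ring
  have hu : Summable fun k => ‖trigDeriv β k‖ := by
    simp_rw [norm_trigDeriv]
    exact h.mul_left _
  exact hasDerivAt_tsum hu hterm (fun k t => (norm_trigTerm (trigDeriv β) k t).le)
    (summable_trigTerm (summable_norm_of_summable_mul h) 0) t

theorem trigSeries_const_mul (c : ℂ) (β : ℕ → ℂ) (t : ℝ) :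
    trigSeries (fun k => c * β k) t = c * trigSeries β t := by
  unfold trigSeries
  rw [← tsum_mul_left]
  simp_rw [mul_assoc]

theorem trigSeries_sum {ι : Type*} (s : Finset ι) {β : ι → ℕ → ℂ}
    (h : ∀ i ∈ s, Summable fun k => ‖β i k‖) (t : ℝ) :
    trigSeries (fun k => ∑ i ∈ s, β i k) t = ∑ i ∈ s, trigSeries (β i) t := by
  unfold trigSeries
  rw [← Summable.tsum_finsetSum fun i hi => summable_trigTerm (h i hi) t]
  simp_rw [Finset.sum_mul]

/-- No frequency is zero, so dividing the coefficients by the frequencies gives a periodic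
antiderivative. -/
theorem integral_trigSeries {β : ℕ → ℂ} (h : Summable fun k => ‖β k‖) :
    ∫ t in Set.Ico (0 : ℝ) 1, trigSeries β t = 0 := by
  set γ : ℕ → ℂ := fun k => β k / ((-(2 * Real.pi * (k + 1)) : ℝ) * Complex.I) with hγ
  have hne : ∀ k : ℕ, ((-(2 * Real.pi * (k + 1)) : ℝ) * Complex.I : ℂ) ≠ 0 := fun k =>
    mul_ne_zero (by
      have : (-(2 * Real.pi * (k + 1)) : ℝ) ≠ 0 := neg_ne_zero.2 (by positivity)
      exact_mod_cast this) Complex.I_ne_zero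
  have hD : trigDeriv γ = β := by
    ext k
    rw [trigDeriv, hγ]
    exact mul_div_cancel₀ _ (hne k)
  have hs : Summable fun k : ℕ => (k + 1 : ℝ) * ‖γ k‖ := by
    have := h.mul_left (2 * Real.pi)⁻¹
    refine this.congr fun k => ?_
    rw [← hD, norm_trigDeriv]
    field_simp
  have := intervalIntegral.integral_eq_sub_of_hasDerivAt
    (fun t (_ : t ∈ Set.uIcc (0 : ℝ) 1) => hasDerivAt_trigSeries hs t)
    (by rw [hD]; exact (continuous_trigSeries h).intervalIntegrable 0 1)
  rw [hD] at this
  rw [integral_Ico_eq_integral_Ioc, ← intervalIntegral.integral_of_le zero_le_one, this, sub_eq_zero]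
  simpa using periodic_trigSeries γ 0

theorem trigSeries_eq_add {β : ℕ → ℂ} (h : Summable fun k => ‖β k‖) (t : ℝ) :
    ‖trigSeries β t - β 0 * Complex.exp ((-(2 * Real.pi * t) : ℝ) * Complex.I)‖ ≤
      ∑' k, ‖β (k + 1)‖ := by
  have hs := summable_trigTerm h t
  have e : trigSeries β t - β 0 * Complex.exp ((-(2 * Real.pi * t) : ℝ) * Complex.I) =
      ∑' k : ℕ, β (k + 1) *
        Complex.exp ((-(2 * Real.pi * ((k + 1 : ℕ) + 1) * t) : ℝ) * Complex.I) := by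
    rw [trigSeries, hs.tsum_eq_zero_add]
    simp
  rw [e]
  have hs' : Summable fun k : ℕ => ‖β (k + 1) *
      Complex.exp ((-(2 * Real.pi * ((k + 1 : ℕ) + 1) * t) : ℝ) * Complex.I)‖ := by
    simp only [fun k : ℕ => norm_trigTerm β (k + 1) t]
    exact (summable_nat_add_iff 1).2 h
  refine (norm_tsum_le_tsum_norm hs').trans (le_of_eq ?_)
  simp only [fun k : ℕ => norm_trigTerm β (k + 1) t]

theorem re_mul_I_mul_exp (c r x : ℝ) :
    ((c : ℂ) * Complex.I * (r * Complex.exp ((-x : ℝ) * Complex.I))).re = c * r * Real.sin x := by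
  rw [Complex.exp_mul_I, ← Complex.ofReal_cos, ← Complex.ofReal_sin, Real.sin_neg, Real.cos_neg]
  simp [Complex.sin_ofReal_re]
  ring

theorem re_mul_I_mul_I_mul_exp (c r x : ℝ) :
    ((c : ℂ) * Complex.I * ((c : ℂ) * Complex.I * (r * Complex.exp ((-x : ℝ) * Complex.I)))).re
      = -(c ^ 2 * r * Real.cos x) := by
  rw [Complex.exp_mul_I, ← Complex.ofReal_cos, ← Complex.ofReal_sin, Real.sin_neg, Real.cos_neg]
  simp [Complex.cos_ofReal_re]
  ring

/-- If the first coefficient dominates, the exponential integral of `Re ∑ γ_k e(-(k+1)t)` is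
`O(|γ_0|^{-1/3})`. -/
theorem norm_integral_exp_trigSeries_le {γ : ℕ → ℂ} (h0 : γ 0 ≠ 0)
    (hs : Summable fun k : ℕ => (k + 1 : ℝ) ^ 2 * ‖γ k‖)
    (htail : ∑' k : ℕ, (k + 2 : ℝ) ^ 2 * ‖γ (k + 1)‖ ≤ ‖γ 0‖ / 2) :
    ‖∫ t in Set.Ico (0 : ℝ) 1, Complex.exp (((trigSeries γ t).re : ℂ) * Complex.I)‖ ≤
      106 * ‖γ 0‖ ^ (-(1 / 3) : ℝ) := by
  rw [integral_Ico_eq_integral_Ioc, ← intervalIntegral.integral_of_le zero_le_one]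
  have hpi := Real.pi_pos
  have hs1 : Summable fun k : ℕ => (k + 1 : ℝ) * ‖γ k‖ := by
    refine hs.of_nonneg_of_le (fun _ => by positivity) fun k => ?_
    have : (0 : ℝ) ≤ k := k.cast_nonneg
    gcongr
    nlinarith
  have hs2 : Summable fun k : ℕ => (k + 1 : ℝ) * ‖trigDeriv γ k‖ := by
    simp_rw [norm_trigDeriv]
    refine (hs.mul_left (2 * Real.pi)).congr fun k => ?_
    ring
  have hs3 : Summable fun k : ℕ => ‖trigDeriv (trigDeriv γ) k‖ := by
    simp_rw [norm_trigDeriv (trigDeriv γ)]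
    exact hs2.mul_left _
  have hre : ∀ {f : ℝ → ℂ} {f' : ℂ} {t : ℝ}, HasDerivAt f f' t →
      HasDerivAt (fun t => (f t).re) f'.re t := fun {f f' t} h =>
    (Complex.reCLM.hasFDerivAt.comp_hasDerivAt t h)
  -- Translating `t` by `φ / (2π)` turns the real part of the leading term into `‖γ 0‖` times a
  -- cosine.
  set φ := Complex.arg (γ 0) with hφ
  have hγ0 : ∀ t : ℝ, γ 0 * Complex.exp ((-(2 * Real.pi * t) : ℝ) * Complex.I) = ‖γ 0‖ *
      Complex.exp ((-(2 * Real.pi * (t - φ / (2 * Real.pi))) : ℝ) * Complex.I) := by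
    intro t
    conv_lhs => rw [← Complex.norm_mul_exp_arg_mul_I (γ 0)]
    rw [mul_assoc, ← Complex.exp_add]
    congr 2
    have : (-(2 * Real.pi * (t - φ / (2 * Real.pi))) : ℝ) = φ + -(2 * Real.pi * t) := by
      field_simp; ring
    rw [this]
    push_cast
    ring
  have hsT : Summable fun k : ℕ => (k + 2 : ℝ) ^ 2 * ‖γ (k + 1)‖ := by
    refine ((summable_nat_add_iff 1).2 hs).congr fun k => ?_
    push_cast; ring
  refine norm_integral_exp_le_of_near_cos (g := fun t => (trigSeries γ t).re)
    (g' := fun t => (trigSeries (trigDeriv γ) t).re)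
    (g'' := fun t => (trigSeries (trigDeriv (trigDeriv γ)) t).re) (α := φ / (2 * Real.pi))
    (fun t => by simp only [periodic_trigSeries γ t]) (fun t => hre (hasDerivAt_trigSeries hs1 t))
    (fun t => hre (hasDerivAt_trigSeries hs2 t))
    (Complex.continuous_re.comp (continuous_trigSeries hs3)) (norm_pos_iff.2 h0) (fun t => ?_)
    fun t => ?_
  -- One or two differentiations put weights `2π (k + 2)` or `4π² (k + 2) ^ 2` on the tail; `htail`
  -- controls both, giving exactly the errors `π r` and `2 π² r` allowed around the cosine.
  · have h1 := trigSeries_eq_add (summable_norm_of_summable_mul hs2) t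
    rw [trigDeriv, mul_assoc, hγ0] at h1
    refine le_trans (le_of_eq ?_) ((Complex.abs_re_le_norm _).trans (h1.trans ?_))
    · rw [Complex.sub_re, re_mul_I_mul_exp]
      congr 1
      push_cast
      ring
    · simp_rw [norm_trigDeriv, tsum_mul_left]
      have : ∑' k : ℕ, (((k + 1 : ℕ) : ℝ) + 1) * ‖γ (k + 1)‖ ≤ ‖γ 0‖ / 2 := by
        refine le_trans (Summable.tsum_le_tsum (fun k => ?_) ((summable_nat_add_iff 1).2 hs1) hsT) htail
        have : (0 : ℝ) ≤ k := k.cast_nonneg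
        push_cast
        gcongr
        nlinarith
      nlinarith
  · have h1 := trigSeries_eq_add hs3 t
    rw [trigDeriv, trigDeriv, mul_assoc, mul_assoc _ (γ 0), hγ0] at h1
    refine le_trans (le_of_eq ?_) ((Complex.abs_re_le_norm _).trans (h1.trans ?_))
    · rw [Complex.sub_re, re_mul_I_mul_I_mul_exp]
      congr 1
      push_cast
      ring
    · simp_rw [norm_trigDeriv]
      have e : ∀ k : ℕ, 2 * Real.pi * ((((k + 1 : ℕ) : ℝ) + 1) * (2 * Real.pi *
          ((((k + 1 : ℕ) : ℝ) + 1) * ‖γ (k + 1)‖))) =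
          4 * Real.pi ^ 2 * ((k + 2 : ℝ) ^ 2 * ‖γ (k + 1)‖) := fun k => by push_cast; ring
      simp_rw [e, tsum_mul_left]
      nlinarith [sq_nonneg Real.pi]

end TrigSeries

/-! ### The Dirichlet coefficients of `F` and of `log F` at primes -/

section PrimeCoefficients

open LSeries LSeries.notation

/-- The restriction of `b` to prime powers. -/
noncomputable def primePowerPart (b : ℕ → ℂ) (n : ℕ) : ℂ :=
  open Classical in if IsPrimePow n then b n else 0

theorem term_primePowerPart (b : ℕ → ℂ) (s : ℂ) (q : Nat.Primes × ℕ) :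
    term (primePowerPart b) s (Nat.Primes.prodNatEquiv q : ℕ) =
      b ((q.1 : ℕ) ^ (q.2 + 1)) / ((q.1 : ℕ) : ℂ) ^ (((q.2 : ℂ) + 1) * s) := by
  obtain ⟨p, k⟩ := q
  have hne : ((Nat.Primes.prodNatEquiv (p, k)) : ℕ) ≠ 0 :=
    (Nat.Primes.prodNatEquiv (p, k)).2.pos.ne'
  rw [term_of_ne_zero hne, primePowerPart, if_pos (Nat.Primes.prodNatEquiv (p, k)).2]
  rw [Nat.Primes.prodNatEquiv_apply]
  simp only
  congr 1
  have := Complex.natCast_cpow_natCast_mul (p : ℕ) (k + 1) s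
  push_cast at this ⊢
  rw [this]

/-- A prime power determines its prime and exponent, so the double sum is an ordinary Dirichlet
series, to which uniqueness of coefficients applies. -/
theorem hasSum_term_primePowerPart {F : ℂ → ℂ} {b : ℕ → ℂ} (h : HasLogEulerProduct F b) {s : ℂ}
    (hs : 1 < s.re) :
    LSeriesHasSum (primePowerPart b) s (∑' p : Nat.Primes, localLog b (p : ℕ) s) := by
  have hsum := (h.1 s hs).1
  have h1 : HasSum (fun q : Nat.Primes × ℕ => term (primePowerPart b) s
      (Nat.Primes.prodNatEquiv q : ℕ)) (∑' p : Nat.Primes, localLog b (p : ℕ) s) := by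
    simp_rw [term_primePowerPart]
    have := hsum.hasSum
    rwa [hsum.tsum_prod] at this
  have hinj : Function.Injective fun q : Nat.Primes × ℕ => (Nat.Primes.prodNatEquiv q : ℕ) :=
    Subtype.val_injective.comp Nat.Primes.prodNatEquiv.injective
  refine (hinj.hasSum_iff fun n hn => ?_).1 h1
  rcases eq_or_ne n 0 with rfl | hn0
  · exact term_zero _ _
  rw [term_of_ne_zero hn0, primePowerPart, if_neg, zero_div]
  intro hp
  exact hn ⟨Nat.Primes.prodNatEquiv.symm ⟨n, hp⟩,
    congrArg Subtype.val (Equiv.apply_symm_apply _ (⟨n, hp⟩ : {n : ℕ // IsPrimePow n}))⟩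

theorem abscissa_le_one_of_forall_hasSum {f : ℕ → ℂ} {F : ℂ → ℂ}
    (h : ∀ s : ℂ, 1 < s.re → LSeriesHasSum f s (F s)) : abscissaOfAbsConv f ≤ 1 := by
  refine abscissaOfAbsConv_le_of_forall_lt_LSeriesSummable' fun y hy => ?_
  exact (h y (by rw [Complex.ofReal_re]; exact_mod_cast hy)).LSeriesSummable

/-- The Dirichlet coefficients of `F` and of `log F` agree at primes. -/
theorem coeff_prime_eq_of_hasLogEulerProduct {F : ℂ → ℂ} {a b : ℕ → ℂ}
    (ha : HasDirichletSeries F a) (hb : HasLogEulerProduct F b) {p : ℕ} (hp : p.Prime) :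
    a p = b p := by
  set β := primePowerPart b
  have hβ : ∀ s : ℂ, 1 < s.re → LSeriesHasSum β s (∑' p : Nat.Primes, localLog b (p : ℕ) s) :=
    fun s hs => hasSum_term_primePowerPart hb hs
  have hA : abscissaOfAbsConv a ≤ 1 := abscissa_le_one_of_forall_hasSum ha
  have hB : abscissaOfAbsConv β ≤ 1 := abscissa_le_one_of_forall_hasSum hβ
  have hlt : ∀ {f : ℕ → ℂ}, abscissaOfAbsConv f ≤ 1 → ∀ {s : ℂ}, 1 < s.re →
      abscissaOfAbsConv f < s.re := fun {_} hf {s} hs => hf.trans_lt (by exact_mod_cast hs)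
  have htop : ∀ {f : ℕ → ℂ}, abscissaOfAbsConv f ≤ 1 → abscissaOfAbsConv f < ⊤ := fun {_} hf =>
    hf.trans_lt (by exact_mod_cast EReal.coe_lt_top 1)
  have hexp : ∀ s : ℂ, 1 < s.re → LSeries a s = Complex.exp (LSeries β s) := fun s hs => by
    rw [(ha s hs).LSeries_eq, (hβ s hs).LSeries_eq]
    exact ((hb.1 s hs).2).symm
  have ha1 : a 1 = 1 := by
    have h1 := LSeries.tendsto_atTop (htop hA)
    have h2 := (LSeries.tendsto_atTop (htop hB)).cexp
    have hβ1 : β 1 = 0 := if_neg not_isPrimePow_one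
    rw [hβ1, Complex.exp_zero] at h2
    refine tendsto_nhds_unique h1 (h2.congr' ?_)
    filter_upwards [eventually_gt_atTop 1] with x hx
    exact (hexp x (by simpa using hx)).symm
  -- The relation `F' = F * (log F)'` is free of the exponential and can be compared coefficient by
  -- coefficient.
  have hder : ∀ s : ℂ, 1 < s.re → LSeries (logMul a) s = LSeries (a ⍟ logMul β) s := by
    intro s hs
    have hopen : {z : ℂ | 1 < z.re} ∈ 𝓝 s :=
      (isOpen_lt continuous_const Complex.continuous_re).mem_nhds hs
    have h1 := LSeries_hasDerivAt (hlt hA hs)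
    have h2 := (LSeries_hasDerivAt (hlt hB hs)).cexp
    have h3 := h1.unique (h2.congr_of_eventuallyEq (by
      filter_upwards [hopen] with z hz using hexp z hz))
    rw [LSeries_convolution (hlt hA hs) (hlt (by rw [abscissaOfAbsConv_logMul]; exact hB) hs),
      hexp s hs]
    linear_combination -h3
  have hconv : abscissaOfAbsConv (a ⍟ logMul β) ≤ 1 :=
    (abscissaOfAbsConv_convolution_le _ _).trans
      (max_le hA (by rw [abscissaOfAbsConv_logMul]; exact hB))
  have := LSeries.eq_of_LSeries_eventually_eq
    (htop (f := logMul a) (by rw [abscissaOfAbsConv_logMul]; exact hA)) (htop hconv) (by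
      filter_upwards [eventually_gt_atTop 1] with x hx
      exact hder x (by simpa using hx)) hp.ne_zero
  rw [LSeries.convolution_def] at this
  -- At a prime only the divisors `1` and `p` occur; the term with `logMul β 1` vanishes because
  -- `log 1 = 0`.
  simp only [Nat.sum_divisorsAntidiagonal fun x y => a x * logMul β y, hp.sum_divisors] at this
  simp only [logMul, Nat.div_one, Nat.div_self hp.pos, Nat.cast_one, Complex.log_one, zero_mul,
    mul_zero, ha1, one_mul, zero_add] at this
  have hlog : Complex.log p ≠ 0 := by
    rw [← Complex.natCast_log]
    exact_mod_cast (Real.log_pos (by exact_mod_cast hp.one_lt)).ne'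
  have hβp : β p = b p := if_pos hp.isPrimePow
  rw [hβp] at this
  exact mul_left_cancel₀ hlog this

end PrimeCoefficients

/-! ### Orthogonality and primes that see a given direction -/

section Orthogonality

open ComplexConjugate

theorem EuclideanSpace.norm_sum_mul_le {N : ℕ} (y : EuclideanSpace ℂ (Fin N)) (z : Fin N → ℂ) :
    ‖∑ j, conj (y j) * z j‖ ≤ ‖y‖ * ∑ j, ‖z j‖ := by
  refine (norm_sum_le _ _).trans ?_
  rw [Finset.mul_sum]
  refine Finset.sum_le_sum fun j _ => ?_
  rw [norm_mul, RCLike.norm_conj]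
  gcongr
  exact PiLp.norm_apply_le y j

theorem sum_normSq_linear_combination {N : ℕ} (s : Finset ℕ) (a : Fin N → ℕ → ℂ)
    (y : EuclideanSpace ℂ (Fin N)) :
    ((∑ p ∈ s, ‖∑ j, conj (y j) * a j p‖ ^ 2 / (p : ℝ) : ℝ) : ℂ) =
      ∑ i, ∑ j, conj (y i) * y j * ∑ p ∈ s, a i p * conj (a j p) / (p : ℂ) := by
  push_cast
  simp_rw [← Complex.mul_conj', map_sum, map_mul, Complex.conj_conj, Finset.sum_mul_sum,
    Finset.sum_div, Finset.mul_sum]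
  rw [Finset.sum_comm]
  refine Finset.sum_congr rfl fun i _ => ?_
  rw [Finset.sum_comm]
  refine Finset.sum_congr rfl fun j _ => Finset.sum_congr rfl fun p _ => ?_
  ring

theorem tendsto_log_log_atTop : Tendsto (fun x : ℝ => Real.log (Real.log x)) atTop atTop :=
  Real.tendsto_log_atTop.comp Real.tendsto_log_atTop

/-- Orthogonality bounds the quadratic form `∑_{p ≤ x} |∑_j conj(y_j) a_j(p)|² / p` from below. -/
theorem AreOrthogonal.exists_lower_bound {N : ℕ} {a : Fin N → ℕ → ℂ} (h : AreOrthogonal a) :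
    ∃ c : ℝ, 0 < c ∧ ∀ᶠ x : ℝ in atTop, ∀ y : EuclideanSpace ℂ (Fin N),
      c * Real.log (Real.log x) * ‖y‖ ^ 2 ≤
        ∑ p ∈ (Finset.Icc 1 ⌊x⌋₊).filter Nat.Prime, ‖∑ j, conj (y j) * a j p‖ ^ 2 / (p : ℝ) := by
  obtain ⟨m, hm0, hm1, hm⟩ := h
  obtain ⟨μ, hμ, hμm⟩ : ∃ μ : ℝ, 0 < μ ∧ ∀ i, μ ≤ m i i := by
    rcases isEmpty_or_nonempty (Fin N) with h | h
    · exact ⟨1, one_pos, fun i => h.elim i⟩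
    · obtain ⟨i, hi⟩ := Finite.exists_min fun i => m i i
      exact ⟨m i i, hm0 i, hi⟩
  -- Chosen so that the `N ^ 2` error terms together take at most half of the diagonal.
  set η := μ / (2 * (N ^ 2 + 1)) with hη
  have hη0 : 0 < η := by positivity
  refine ⟨μ / 2, by positivity, ?_⟩
  have hev : ∀ᶠ x : ℝ in atTop, ∀ i j, ‖(∑ p ∈ (Finset.Icc 1 ⌊x⌋₊).filter Nat.Prime,
      a i p * conj (a j p) / (p : ℂ)) - ((m i j * Real.log (Real.log x) : ℝ) : ℂ)‖
      ≤ η * ‖Real.log (Real.log x)‖ :=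
    eventually_all.2 fun i => eventually_all.2 fun j => (hm i j).bound hη0
  filter_upwards [hev, tendsto_log_log_atTop.eventually_ge_atTop 0] with x hx hL y
  set L := Real.log (Real.log x)
  rw [Real.norm_of_nonneg hL] at hx
  set s := (Finset.Icc 1 ⌊x⌋₊).filter Nat.Prime
  set T := fun i j => ∑ p ∈ s, a i p * conj (a j p) / (p : ℂ) with hT
  have hS := sum_normSq_linear_combination s a y
  set Sx := ∑ p ∈ s, ‖∑ j, conj (y j) * a j p‖ ^ 2 / (p : ℝ)
  have hmain : (∑ i, ∑ j, conj (y i) * y j * ((m i j * L : ℝ) : ℂ)) =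
      ((∑ i, m i i * L * ‖y i‖ ^ 2 : ℝ) : ℂ) := by
    push_cast
    refine Finset.sum_congr rfl fun i _ => ?_
    rw [Finset.sum_eq_single i]
    · rw [Complex.conj_mul']; ring
    · intro j _ hj
      rw [hm1 i j (Ne.symm hj)]; simp
    · simp
  have hdiff : ‖(Sx : ℂ) - ((∑ i, m i i * L * ‖y i‖ ^ 2 : ℝ) : ℂ)‖ ≤ μ / 2 * L * ‖y‖ ^ 2 := by
    rw [hS, ← hmain, ← Finset.sum_sub_distrib]
    calc ‖∑ i, (∑ j, conj (y i) * y j * T i j - ∑ j, conj (y i) * y j * ((m i j * L : ℝ) : ℂ))‖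
        ≤ ∑ _i : Fin N, ∑ _j : Fin N, ‖y‖ * ‖y‖ * (η * L) := by
          refine (norm_sum_le _ _).trans (Finset.sum_le_sum fun i _ => ?_)
          rw [← Finset.sum_sub_distrib]
          refine (norm_sum_le _ _).trans (Finset.sum_le_sum fun j _ => ?_)
          rw [← mul_sub, norm_mul, norm_mul, RCLike.norm_conj]
          gcongr
          · exact PiLp.norm_apply_le y i
          · exact PiLp.norm_apply_le y j
          · exact hx i j
      _ = (N ^ 2 * η) * (L * ‖y‖ ^ 2) := by simp; ring
      _ ≤ (μ / 2) * (L * ‖y‖ ^ 2) := by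
          gcongr
          rw [hη, mul_div_assoc', div_le_div_iff₀ (by positivity) (by norm_num)]
          nlinarith
      _ = _ := by ring
  rw [← Complex.ofReal_sub, Complex.norm_real] at hdiff
  have h1 := (abs_le.1 hdiff).1
  have h2 : μ * L * ‖y‖ ^ 2 ≤ ∑ i, m i i * L * ‖y i‖ ^ 2 := by
    rw [EuclideanSpace.norm_sq_eq, Finset.mul_sum]
    refine Finset.sum_le_sum fun i _ => ?_
    gcongr
    exact hμm i
  linarith

/-- In every direction `y`, some prime of a bounded block beyond `P₀` sees `y` well. -/
theorem AreOrthogonal.exists_prime_block {N : ℕ} {a : Fin N → ℕ → ℂ} (h : AreOrthogonal a)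
    (C : ℝ) {e : ℝ} (he : e < 0) (P₀ : ℕ) :
    ∃ P₁ : ℕ, ∀ y : EuclideanSpace ℂ (Fin N), ∃ p : ℕ, p.Prime ∧ P₀ ≤ p ∧ p ≤ P₁ ∧
      C * (p : ℝ) ^ e * ‖y‖ ≤ ‖∑ j, conj (y j) * a j p‖ := by
  obtain ⟨c, hc, hev⟩ := h.exists_lower_bound
  have hsum : Summable fun n : ℕ => C ^ 2 * (n : ℝ) ^ (2 * e - 1) :=
    (Real.summable_nat_rpow.2 (by linarith)).mul_left _
  set B := ∑ p ∈ Finset.range P₀, (∑ j, ‖a j p‖) ^ 2 / (p : ℝ) with hB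
  set Z := ∑' n : ℕ, C ^ 2 * (n : ℝ) ^ (2 * e - 1) with hZ
  -- If no prime of the block were good, the quadratic form up to `x` would be at most `(B + Z) *
  -- ‖y‖ ^ 2`: `B` accounts for primes below `P₀`, and `Z` converges because `e < 0`. This `x` does
  -- not depend on `y`.
  obtain ⟨x, hx1, hx2⟩ := (hev.and (tendsto_log_log_atTop.eventually_gt_atTop
    ((B + Z) / c))).exists
  obtain ⟨p₀, hp₀, hp₀'⟩ := Nat.exists_infinite_primes P₀
  refine ⟨max p₀ ⌊x⌋₊, fun y => ?_⟩
  rcases eq_or_ne y 0 with rfl | hy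
  · exact ⟨p₀, hp₀', hp₀, le_max_left _ _, by simp⟩
  by_contra! hcon
  have hy0 : 0 < ‖y‖ := norm_pos_iff.2 hy
  have hup : ∀ p ∈ (Finset.Icc 1 ⌊x⌋₊).filter Nat.Prime,
      ‖∑ j, conj (y j) * a j p‖ ^ 2 / (p : ℝ) ≤
        ‖y‖ ^ 2 * ((if p < P₀ then (∑ j, ‖a j p‖) ^ 2 / (p : ℝ) else 0) +
          C ^ 2 * (p : ℝ) ^ (2 * e - 1)) := by
    intro p hp
    rw [Finset.mem_filter, Finset.mem_Icc] at hp
    have hp0 : (0 : ℝ) < p := by exact_mod_cast hp.2.pos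
    split_ifs with hpP
    · have h1 := EuclideanSpace.norm_sum_mul_le y fun j => a j p
      calc _ ≤ (‖y‖ * ∑ j, ‖a j p‖) ^ 2 / (p : ℝ) := by gcongr
        _ = ‖y‖ ^ 2 * ((∑ j, ‖a j p‖) ^ 2 / (p : ℝ)) := by ring
        _ ≤ _ := by
          gcongr
          exact le_add_of_nonneg_right (by positivity)
    · have h1 := hcon p hp.2 (not_lt.1 hpP) (hp.1.2.trans (le_max_right _ _))
      calc _ ≤ (C * (p : ℝ) ^ e * ‖y‖) ^ 2 / (p : ℝ) := by gcongr
        _ = _ := by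
          rw [Real.rpow_sub hp0, Real.rpow_one, two_mul, Real.rpow_add hp0]
          ring
  have h1 := (hx1 y).trans (Finset.sum_le_sum hup)
  rw [← Finset.mul_sum, Finset.sum_add_distrib] at h1
  have h2 : ∑ p ∈ (Finset.Icc 1 ⌊x⌋₊).filter Nat.Prime,
      (if p < P₀ then (∑ j, ‖a j p‖) ^ 2 / (p : ℝ) else 0) ≤ B := by
    rw [← Finset.sum_filter]
    refine Finset.sum_le_sum_of_subset_of_nonneg (fun p hp => ?_) fun p _ _ => by positivity
    exact Finset.mem_range.2 (Finset.mem_filter.1 hp).2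
  have h3 : ∑ p ∈ (Finset.Icc 1 ⌊x⌋₊).filter Nat.Prime, C ^ 2 * (p : ℝ) ^ (2 * e - 1) ≤ Z :=
    hsum.sum_le_tsum _ fun n _ => by positivity
  rw [div_lt_iff₀ hc] at hx2
  have h4 : 0 < ‖y‖ ^ 2 := by positivity
  nlinarith

end Orthogonality

/-! ### Local factors as trigonometric series -/

section LocalFactors

/-- The coefficients of `log F_p(σ + 2πit / log p)` as a trigonometric series in `t`. -/
noncomputable def locCoeff (b : ℕ → ℂ) (p : ℕ) (σ : ℝ) (k : ℕ) : ℂ :=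
  b (p ^ (k + 1)) / (((p : ℝ) ^ (((k : ℝ) + 1) * σ) : ℝ) : ℂ)

/-- The coefficients of `(F_p'/F_p)(σ + 2πit / log p)` as a trigonometric series in `t`. -/
noncomputable def locDeriv (b : ℕ → ℂ) (p : ℕ) (σ : ℝ) (k : ℕ) : ℂ :=
  -(((k + 1 : ℝ) * Real.log p : ℝ) : ℂ) * locCoeff b p σ k

theorem natCast_cpow_mul_twist {p : ℕ} (hp : p.Prime) (σ t : ℝ) (k : ℕ) :
    (p : ℂ) ^ (((k : ℂ) + 1) * twist p (σ : ℂ) t) = (((p : ℝ) ^ (((k : ℝ) + 1) * σ) : ℝ) : ℂ) *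
      Complex.exp ((2 * Real.pi * (k + 1) * t : ℝ) * Complex.I) := by
  have hp0 : (0 : ℝ) < p := by exact_mod_cast hp.pos
  have hlog : Real.log p ≠ 0 := (Real.log_pos (by exact_mod_cast hp.one_lt)).ne'
  have hpc : (p : ℂ) ≠ 0 := by exact_mod_cast hp.ne_zero
  rw [twist, mul_add, Complex.cpow_add _ _ hpc]
  congr 1
  · rw [Complex.ofReal_cpow hp0.le]; push_cast; rfl
  · rw [Complex.cpow_def_of_ne_zero hpc, ← Complex.natCast_log]
    have : (Real.log p : ℂ) ≠ 0 := by exact_mod_cast hlog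
    simp only [Complex.ofReal_div, Complex.ofReal_mul]
    congr 1
    field_simp
    push_cast
    ring

theorem localLog_twist (b : ℕ → ℂ) {p : ℕ} (hp : p.Prime) (σ t : ℝ) :
    localLog b p (twist p (σ : ℂ) t) = trigSeries (locCoeff b p σ) t := by
  unfold localLog trigSeries
  congr 1; ext k
  rw [natCast_cpow_mul_twist hp, locCoeff, ← div_div, div_eq_mul_inv (b _ / _), ← Complex.exp_neg]
  congr 2
  push_cast
  ring

/-- Property (II), with constants in a convenient range. -/
def HasCoeffBound (b : ℕ → ℂ) (θ K : ℝ) : Prop :=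
  ∀ p : ℕ, p.Prime → ∀ k : ℕ, 1 ≤ k → ‖b (p ^ k)‖ ≤ K * (p : ℝ) ^ ((k : ℝ) * θ)

variable {b : ℕ → ℂ} {θ K : ℝ}

theorem HasCoeffBound.norm_locCoeff_le (h : HasCoeffBound b θ K) {p : ℕ} (hp : p.Prime) (σ : ℝ)
    (k : ℕ) : ‖locCoeff b p σ k‖ ≤ K * ((p : ℝ) ^ (θ - σ)) ^ (k + 1) := by
  have hp0 : (0 : ℝ) < p := by exact_mod_cast hp.pos
  have h1 := h p hp (k + 1) (Nat.le_add_left _ _)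
  rw [locCoeff, norm_div, Complex.norm_real, Real.norm_of_nonneg (by positivity),
    div_le_iff₀ (by positivity)]
  refine h1.trans (le_of_eq ?_)
  rw [← Real.rpow_natCast ((p : ℝ) ^ (θ - σ)), ← Real.rpow_mul hp0.le, mul_assoc,
    ← Real.rpow_add hp0]
  congr 2
  push_cast
  ring

theorem norm_locDeriv (b : ℕ → ℂ) (p : ℕ) (σ : ℝ) (k : ℕ) :
    ‖locDeriv b p σ k‖ = Real.log p * (((k : ℝ) + 1) * ‖locCoeff b p σ k‖) := by
  have : 0 ≤ Real.log p := Real.log_natCast_nonneg p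
  rw [locDeriv, norm_mul, norm_neg, Complex.norm_real, Real.norm_of_nonneg (by positivity)]
  ring

theorem summable_succ_sq_mul_geometric {q : ℝ} (h0 : 0 ≤ q) (h1 : q < 1) :
    Summable fun k : ℕ => ((k : ℝ) + 2) ^ 2 * q ^ k := by
  have hq : ‖q‖ < 1 := by rwa [Real.norm_of_nonneg h0]
  have e2 := summable_pow_mul_geometric_of_norm_lt_one 2 hq
  have e1 := (summable_pow_mul_geometric_of_norm_lt_one 1 hq).mul_left 4
  have e0 := (summable_pow_mul_geometric_of_norm_lt_one 0 hq).mul_left 4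
  refine ((e2.add e1).add e0).congr fun k => ?_
  ring

/-- `∑ (k+2)² q^k`, with `q = 2^{θ-1}`. -/
noncomputable def geomConst (θ : ℝ) : ℝ := ∑' k : ℕ, ((k : ℝ) + 2) ^ 2 * ((2 : ℝ) ^ (θ - 1)) ^ k

theorem summable_geomConst (hθ : θ < 1 / 2) :
    Summable fun k : ℕ => ((k : ℝ) + 2) ^ 2 * ((2 : ℝ) ^ (θ - 1)) ^ k :=
  summable_succ_sq_mul_geometric (by positivity)
    (Real.rpow_lt_one_of_one_lt_of_neg (by norm_num) (by linarith))

theorem geomConst_nonneg (θ : ℝ) : 0 ≤ geomConst θ := tsum_nonneg fun k => by positivity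

/-- The worst case `p = 2`, `σ = 1` makes all geometric sums uniform in the prime and in `σ`. -/
theorem prime_rpow_le {p : ℕ} (hp : p.Prime) (hθ : θ < 1 / 2) {σ : ℝ} (hσ : 1 ≤ σ) :
    (p : ℝ) ^ (θ - σ) ≤ (2 : ℝ) ^ (θ - 1) := by
  have hp2 : (2 : ℝ) ≤ p := by exact_mod_cast hp.two_le
  calc (p : ℝ) ^ (θ - σ) ≤ (p : ℝ) ^ (θ - 1) :=
        Real.rpow_le_rpow_of_exponent_le (by linarith) (by linarith)
    _ ≤ _ := Real.rpow_le_rpow_of_nonpos (by norm_num) hp2 (by linarith)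

theorem HasCoeffBound.summable_sq_mul (h : HasCoeffBound b θ K) (hθ : θ < 1 / 2) (hK : 0 ≤ K)
    {p : ℕ} (hp : p.Prime) {σ : ℝ} (hσ : 1 ≤ σ) :
    (Summable fun k : ℕ => ((k : ℝ) + 1) ^ 2 * ‖locCoeff b p σ k‖) ∧
      ∑' k : ℕ, ((k : ℝ) + 1) ^ 2 * ‖locCoeff b p σ k‖ ≤
        K * geomConst θ * (p : ℝ) ^ (θ - σ) := by
  set q := (p : ℝ) ^ (θ - σ) with hq
  have hq0 : 0 ≤ q := by positivity
  have hqle := prime_rpow_le hp hθ hσ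
  have hle : ∀ k : ℕ, ((k : ℝ) + 1) ^ 2 * ‖locCoeff b p σ k‖ ≤
      (K * q) * (((k : ℝ) + 2) ^ 2 * ((2 : ℝ) ^ (θ - 1)) ^ k) := by
    intro k
    have h1 := h.norm_locCoeff_le hp σ k
    calc ((k : ℝ) + 1) ^ 2 * ‖locCoeff b p σ k‖
        ≤ ((k : ℝ) + 2) ^ 2 * (K * q ^ (k + 1)) := by
          gcongr
          linarith
      _ = (K * q) * (((k : ℝ) + 2) ^ 2 * q ^ k) := by ring
      _ ≤ _ := by gcongr
  have hs := (summable_geomConst hθ).mul_left (K * q)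
  have hs' := hs.of_nonneg_of_le (fun k => by positivity) hle
  refine ⟨hs', (hs'.tsum_le_tsum hle hs).trans (le_of_eq ?_)⟩
  rw [tsum_mul_left, geomConst]
  ring

/-- Without the first term the series starts at `q ^ 2`, `q = p ^ (θ - σ)`. This is the size that
the leading coefficient at a good prime has to beat. -/
theorem HasCoeffBound.tail_le (h : HasCoeffBound b θ K) (hθ : θ < 1 / 2) (hK : 0 ≤ K)
    {p : ℕ} (hp : p.Prime) {σ : ℝ} (hσ : 1 ≤ σ) :
    (Summable fun k : ℕ => ((k : ℝ) + 2) ^ 2 * ‖locCoeff b p σ (k + 1)‖) ∧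
      ∑' k : ℕ, ((k : ℝ) + 2) ^ 2 * ‖locCoeff b p σ (k + 1)‖ ≤
        K * geomConst θ * ((p : ℝ) ^ (θ - σ)) ^ 2 := by
  set q := (p : ℝ) ^ (θ - σ) with hq
  have hq0 : 0 ≤ q := by positivity
  have hqle := prime_rpow_le hp hθ hσ
  have hle : ∀ k : ℕ, ((k : ℝ) + 2) ^ 2 * ‖locCoeff b p σ (k + 1)‖ ≤
      (K * q ^ 2) * (((k : ℝ) + 2) ^ 2 * ((2 : ℝ) ^ (θ - 1)) ^ k) := by
    intro k
    have h1 := h.norm_locCoeff_le hp σ (k + 1)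
    calc ((k : ℝ) + 2) ^ 2 * ‖locCoeff b p σ (k + 1)‖
        ≤ ((k : ℝ) + 2) ^ 2 * (K * q ^ (k + 1 + 1)) := by gcongr
      _ = (K * q ^ 2) * (((k : ℝ) + 2) ^ 2 * q ^ k) := by ring
      _ ≤ _ := by gcongr
  have hs := (summable_geomConst hθ).mul_left (K * q ^ 2)
  have hs' := hs.of_nonneg_of_le (fun k => by positivity) hle
  refine ⟨hs', (hs'.tsum_le_tsum hle hs).trans (le_of_eq ?_)⟩
  rw [tsum_mul_left, geomConst]
  ring

theorem HasCoeffBound.locCoeff_bound (h : HasCoeffBound b θ K) (hθ : θ < 1 / 2) (hK : 0 ≤ K)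
    {p : ℕ} (hp : p.Prime) {σ : ℝ} (hσ : 1 ≤ σ) :
    (Summable fun k => ‖locCoeff b p σ k‖) ∧
      ∀ t, ‖trigSeries (locCoeff b p σ) t‖ ≤ K * geomConst θ * (p : ℝ) ^ (θ - σ) := by
  obtain ⟨h1, h2⟩ := h.summable_sq_mul hθ hK hp hσ
  have hle : ∀ k : ℕ, ‖locCoeff b p σ k‖ ≤ ((k : ℝ) + 1) ^ 2 * ‖locCoeff b p σ k‖ := fun k =>
    le_mul_of_one_le_left (norm_nonneg _) (one_le_pow₀ (by linarith [k.cast_nonneg (α := ℝ)]))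
  have hs := h1.of_nonneg_of_le (fun _ => norm_nonneg _) hle
  exact ⟨hs, fun t => (norm_trigSeries_le hs t).trans ((hs.tsum_le_tsum hle h1).trans h2)⟩

theorem HasCoeffBound.locDeriv_bound (h : HasCoeffBound b θ K) (hθ : θ < 1 / 2) (hK : 0 ≤ K)
    {p : ℕ} (hp : p.Prime) {σ : ℝ} (hσ : 1 ≤ σ) :
    (Summable fun k => ‖locDeriv b p σ k‖) ∧
      ∀ t, ‖trigSeries (locDeriv b p σ) t‖ ≤
        Real.log p * (K * geomConst θ * (p : ℝ) ^ (θ - σ)) := by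
  obtain ⟨h1, h2⟩ := h.summable_sq_mul hθ hK hp hσ
  have hlog : 0 ≤ Real.log p := Real.log_natCast_nonneg p
  have hle : ∀ k : ℕ, ‖locDeriv b p σ k‖ ≤
      Real.log p * (((k : ℝ) + 1) ^ 2 * ‖locCoeff b p σ k‖) := fun k => by
    rw [norm_locDeriv]
    have : (0 : ℝ) ≤ k := k.cast_nonneg
    gcongr
    nlinarith
  have hs' := h1.mul_left (Real.log p)
  have hs := hs'.of_nonneg_of_le (fun _ => norm_nonneg _) hle
  refine ⟨hs, fun t => (norm_trigSeries_le hs t).trans ((hs.tsum_le_tsum hle hs').trans ?_)⟩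
  rw [tsum_mul_left]
  gcongr

/-- Points on the line `Re s = 1` need an open neighbourhood; since `θ < 1 / 2`, the terms and their
derivatives are dominated geometrically on `Re s > 1 / 2`, so the series is differentiated termwise
there. -/
theorem HasCoeffBound.hasDerivAt_localLog (h : HasCoeffBound b θ K) (hθ : θ < 1 / 2)
    {p : ℕ} (hp : p.Prime) {s : ℂ} (hs : 1 ≤ s.re) :
    HasDerivAt (localLog b p) (∑' k : ℕ, -(((k + 1 : ℝ) * Real.log p : ℝ) : ℂ) *
      (b (p ^ (k + 1)) / (p : ℂ) ^ (((k : ℂ) + 1) * s))) s := by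
  have hp0 : (0 : ℝ) < p := by exact_mod_cast hp.pos
  have hp1 : (1 : ℝ) < p := by exact_mod_cast hp.one_lt
  have hpc : (p : ℂ) ≠ 0 := by exact_mod_cast hp.ne_zero
  have hlog : 0 ≤ Real.log p := Real.log_natCast_nonneg p
  set q := (p : ℝ) ^ (θ - 1 / 2) with hq
  have hq0 : 0 < q := by positivity
  have hq1 : q < 1 := Real.rpow_lt_one_of_one_lt_of_neg hp1 (by linarith)
  have hK : 0 ≤ K := by
    have := (norm_nonneg _).trans (h p hp 1 le_rfl)
    exact nonneg_of_mul_nonneg_left this (by positivity)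
  have hterm : ∀ (k : ℕ) (z : ℂ), 1 / 2 < z.re →
      ‖b (p ^ (k + 1)) / (p : ℂ) ^ (((k : ℂ) + 1) * z)‖ ≤ K * q ^ (k + 1) := by
    intro k z hz
    have h1 := h p hp (k + 1) (Nat.le_add_left _ _)
    have hre : (((k : ℂ) + 1) * z).re = ((k : ℝ) + 1) * z.re := by
      rw [show ((k : ℂ) + 1) = (((k : ℝ) + 1 : ℝ) : ℂ) by push_cast; rfl, Complex.re_ofReal_mul]
    rw [norm_div, Complex.norm_natCast_cpow_of_pos hp.pos, hre, div_le_iff₀ (by positivity)]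
    refine h1.trans ?_
    rw [mul_assoc, ← Real.rpow_natCast q, hq, ← Real.rpow_mul hp0.le, ← Real.rpow_add hp0]
    gcongr
    · exact hp1.le
    · push_cast
      have : (0 : ℝ) ≤ k := k.cast_nonneg
      nlinarith
  have hu : Summable fun k : ℕ => Real.log p * (K * q) * (((k : ℝ) + 2) ^ 2 * q ^ k) :=
    (summable_succ_sq_mul_geometric hq0.le hq1).mul_left _
  have hopen : IsOpen {z : ℂ | 1 / 2 < z.re} := isOpen_lt continuous_const Complex.continuous_re
  have hconn : IsPreconnected {z : ℂ | 1 / 2 < z.re} :=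
    (convex_halfSpace_re_gt (1 / 2)).isPreconnected
  have hs2 : s ∈ {z : ℂ | 1 / 2 < z.re} := by
    show 1 / 2 < s.re
    linarith
  have hderiv : ∀ (k : ℕ) (z : ℂ), HasDerivAt
      (fun z : ℂ => b (p ^ (k + 1)) / (p : ℂ) ^ (((k : ℂ) + 1) * z))
      (-(((k + 1 : ℝ) * Real.log p : ℝ) : ℂ) *
        (b (p ^ (k + 1)) / (p : ℂ) ^ (((k : ℂ) + 1) * z))) z := by
    intro k z
    have hne : (p : ℂ) ^ (((k : ℂ) + 1) * z) ≠ 0 := by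
      rw [Complex.cpow_def_of_ne_zero hpc]; exact Complex.exp_ne_zero _
    have h1 : HasDerivAt (fun z : ℂ => ((k : ℂ) + 1) * z) ((k : ℂ) + 1) z := by
      simpa using (hasDerivAt_id z).const_mul ((k : ℂ) + 1)
    have h2 := ((h1.const_cpow (c := (p : ℂ)) (Or.inl hpc)).inv hne).const_mul (b (p ^ (k + 1)))
    refine h2.congr_deriv ?_
    rw [← Complex.natCast_log, Complex.ofReal_mul, Complex.ofReal_add, Complex.ofReal_one,
      Complex.ofReal_natCast]
    field_simp
  have hbound : ∀ (k : ℕ) (z : ℂ), z ∈ {z : ℂ | 1 / 2 < z.re} →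
      ‖-(((k + 1 : ℝ) * Real.log p : ℝ) : ℂ) *
        (b (p ^ (k + 1)) / (p : ℂ) ^ (((k : ℂ) + 1) * z))‖ ≤
      Real.log p * (K * q) * (((k : ℝ) + 2) ^ 2 * q ^ k) := by
    intro k z hz
    rw [norm_mul, norm_neg, Complex.norm_real, Real.norm_of_nonneg (by positivity)]
    have := hterm k z hz
    have hk : (0 : ℝ) ≤ k := k.cast_nonneg
    calc ((k : ℝ) + 1) * Real.log p * ‖b (p ^ (k + 1)) / (p : ℂ) ^ (((k : ℂ) + 1) * z)‖
        ≤ ((k : ℝ) + 2) ^ 2 * Real.log p * (K * q ^ (k + 1)) := by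
          gcongr
          nlinarith
      _ = _ := by ring
  have hsum : Summable fun k : ℕ => b (p ^ (k + 1)) / (p : ℂ) ^ (((k : ℂ) + 1) * s) :=
    Summable.of_norm_bounded (g := fun k => K * q ^ (k + 1))
      (((summable_nat_add_iff 1).2 (summable_geometric_of_lt_one hq0.le hq1)).mul_left K)
      fun k => hterm k s hs2
  exact hasDerivAt_tsum_of_isPreconnected hu hopen hconn (fun k z _ => hderiv k z) hbound
    hs2 hsum hs2

theorem HasCoeffBound.hasDerivAt_localLog_twist (h : HasCoeffBound b θ K) (hθ : θ < 1 / 2)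
    {p : ℕ} (hp : p.Prime) {σ : ℝ} (hσ : 1 ≤ σ) (t : ℝ) :
    HasDerivAt (fun s : ℂ => localLog b p (twist p s t)) (trigSeries (locDeriv b p σ) t) σ := by
  have hre : (twist p (σ : ℂ) t).re = σ := by
    simp only [twist, Complex.add_re, Complex.mul_re, Complex.I_re, Complex.I_im,
      Complex.ofReal_re, Complex.ofReal_im]
    ring
  have h1 := h.hasDerivAt_localLog hθ hp (s := twist p (σ : ℂ) t) (by rw [hre]; exact hσ)
  have h2 : HasDerivAt (fun s : ℂ => twist p s t) 1 (σ : ℂ) := by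
    unfold twist
    exact (hasDerivAt_id _).add_const _
  have h3 := h1.comp (σ : ℂ) h2
  rw [mul_one] at h3
  refine h3.congr_deriv ?_
  unfold trigSeries
  congr 1; ext k
  rw [natCast_cpow_mul_twist hp, locDeriv, locCoeff, ← div_div, div_eq_mul_inv (b _ / _),
    ← Complex.exp_neg, ← mul_assoc]
  congr 2
  push_cast
  ring

theorem prime_nthPrime (m : ℕ) : (nthPrime m).Prime := Nat.prime_nth_prime m

theorem logPartial_eq (b : ℕ → ℂ) (n : ℕ) (σ : ℝ) (x : Fin n → ℝ) :
    logPartial b n (σ : ℂ) x = ∑ m : Fin n, trigSeries (locCoeff b (nthPrime m) σ) (x m) := by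
  unfold logPartial
  exact Finset.sum_congr rfl fun m _ => localLog_twist b (prime_nthPrime m) σ (x m)

theorem HasCoeffBound.partialLogDeriv_eq (h : HasCoeffBound b θ K) (hθ : θ < 1 / 2) (n : ℕ)
    {σ : ℝ} (hσ : 1 ≤ σ) (x : Fin n → ℝ) :
    partialLogDeriv b n σ x = ∑ m : Fin n, trigSeries (locDeriv b (nthPrime m) σ) (x m) := by
  have h1 : (fun s : ℂ => partialProd b n s x) = fun s : ℂ =>
      Complex.exp (∑ m : Fin n, localLog b (nthPrime m) (twist (nthPrime m) s (x m))) := by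
    ext s
    rw [partialProd, Complex.exp_sum]
  have h2 := (HasDerivAt.fun_sum fun (m : Fin n) (_ : m ∈ Finset.univ) =>
    h.hasDerivAt_localLog_twist hθ (prime_nthPrime m) hσ (x m)).cexp
  rw [partialLogDeriv, logDeriv_apply, congrFun h1, h1, h2.deriv,
    mul_div_cancel_left₀ _ (Complex.exp_ne_zero _)]

end LocalFactors

/-! ### Integrals at a single prime -/

section OnePrime

open ComplexConjugate

theorem norm_integral_Ico_le {u : ℝ → ℂ} {C : ℝ} (h : ∀ t, ‖u t‖ ≤ C) :
    ‖∫ t in Set.Ico (0 : ℝ) 1, u t‖ ≤ C := by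
  have := norm_setIntegral_le_of_norm_le_const (μ := (volume : Measure ℝ)) (s := Set.Ico (0 : ℝ) 1)
    (by simp) fun t _ => h t
  simpa using this

theorem norm_exp_mul_I_sub_one_sub_le (x : ℝ) :
    ‖Complex.exp ((x : ℂ) * Complex.I) - 1 - (x : ℂ) * Complex.I‖ ≤ 3 * x ^ 2 := by
  rcases le_total |x| 1 with h | h
  · have := Complex.norm_exp_sub_one_sub_id_le (x := (x : ℂ) * Complex.I) (by simpa using h)
    simp only [norm_mul, Complex.norm_real, Complex.norm_I, mul_one, Real.norm_eq_abs,
      sq_abs] at this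
    linarith [sq_nonneg x]
  · have h1 := norm_sub_le (Complex.exp ((x : ℂ) * Complex.I) - 1) ((x : ℂ) * Complex.I)
    have h2 := norm_sub_le (Complex.exp ((x : ℂ) * Complex.I)) 1
    rw [Complex.norm_exp_ofReal_mul_I, norm_one] at h2
    simp only [norm_mul, Complex.norm_real, Complex.norm_I, mul_one, Real.norm_eq_abs] at h1
    have h3 : |x| ≤ x ^ 2 := by rw [← sq_abs]; nlinarith
    linarith

theorem norm_exp_mul_I_sub_one_le (x : ℝ) :
    ‖Complex.exp ((x : ℂ) * Complex.I) - 1‖ ≤ |x| := by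
  have := Real.norm_exp_I_mul_ofReal_sub_one_le (x := x)
  rwa [mul_comm, Real.norm_eq_abs] at this

variable {f : ℝ → ℂ} {g : ℝ → ℝ} {A B : ℝ}

theorem norm_integral_exp_le_one (g : ℝ → ℝ) :
    ‖∫ t in Set.Ico (0 : ℝ) 1, Complex.exp ((g t : ℂ) * Complex.I)‖ ≤ 1 :=
  norm_integral_Ico_le fun _ => (Complex.norm_exp_ofReal_mul_I _).le

theorem norm_integral_mul_exp_le (hA : ∀ t, ‖f t‖ ≤ A) (g : ℝ → ℝ) :
    ‖∫ t in Set.Ico (0 : ℝ) 1, f t * Complex.exp ((g t : ℂ) * Complex.I)‖ ≤ A :=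
  norm_integral_Ico_le fun t => by
    rw [norm_mul, Complex.norm_exp_ofReal_mul_I, mul_one]; exact hA t

theorem integrable_Ico_of_continuous {u : ℝ → ℂ} (h : Continuous u) :
    Integrable u (volume.restrict (Set.Ico (0 : ℝ) 1)) :=
  (h.integrableOn_Icc (a := 0) (b := 1)).mono_set Set.Ico_subset_Icc_self

/-- Zero mean removes the linear term of the exponential and leaves a quadratic error. -/
theorem norm_integral_exp_sub_one_le (hg : Continuous g)
    (hg0 : ∫ t in Set.Ico (0 : ℝ) 1, (g t : ℂ) = 0) (hB : ∀ t, |g t| ≤ B) :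
    ‖(∫ t in Set.Ico (0 : ℝ) 1, Complex.exp ((g t : ℂ) * Complex.I)) - 1‖ ≤ 3 * B ^ 2 := by
  have e : (∫ t in Set.Ico (0 : ℝ) 1, Complex.exp ((g t : ℂ) * Complex.I)) - 1 =
      ∫ t in Set.Ico (0 : ℝ) 1, (Complex.exp ((g t : ℂ) * Complex.I) - 1 - (g t : ℂ) * Complex.I) := by
    rw [integral_sub, integral_sub, integral_mul_const, hg0]
    · simp
    all_goals exact integrable_Ico_of_continuous (by fun_prop)
  have hint : ∀ t, ‖Complex.exp ((g t : ℂ) * Complex.I) - 1 - (g t : ℂ) * Complex.I‖ ≤ 3 * B ^ 2 :=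
    fun t => (norm_exp_mul_I_sub_one_sub_le _).trans (by
      rw [← sq_abs (g t)]
      have := hB t
      gcongr)
  have := norm_integral_Ico_le hint
  rwa [← e] at this

/-- Zero mean of `f` allows `e^{ig}` to be replaced by `e^{ig} - 1`, which gains a factor `B`. -/
theorem norm_integral_mul_exp_le_mul (hf : Continuous f) (hg : Continuous g)
    (hf0 : ∫ t in Set.Ico (0 : ℝ) 1, f t = 0) (hA : ∀ t, ‖f t‖ ≤ A) (hB : ∀ t, |g t| ≤ B) :
    ‖∫ t in Set.Ico (0 : ℝ) 1, f t * Complex.exp ((g t : ℂ) * Complex.I)‖ ≤ A * B := by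
  have e : ∫ t in Set.Ico (0 : ℝ) 1, f t * Complex.exp ((g t : ℂ) * Complex.I) =
      ∫ t in Set.Ico (0 : ℝ) 1, f t * (Complex.exp ((g t : ℂ) * Complex.I) - 1) := by
    simp_rw [mul_sub, mul_one]
    rw [integral_sub, hf0, sub_zero]
    all_goals exact integrable_Ico_of_continuous (by fun_prop)
  rw [e]
  refine norm_integral_Ico_le fun t => ?_
  rw [norm_mul]
  exact mul_le_mul (hA t) ((norm_exp_mul_I_sub_one_le _).trans (hB t)) (norm_nonneg _)
    ((norm_nonneg _).trans (hA t))

end OnePrime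

/-! ### Linear combinations of trigonometric series and the resulting moment bounds -/

section LinearCombinations

theorem weighted_linComb {ι : Type*} [Fintype ι] {β : ι → ℕ → ℂ} {w : ℕ → ℝ} {S : ℝ}
    (hw : ∀ k, 0 ≤ w k) (h : ∀ i, Summable fun k => w k * ‖β i k‖)
    (hS : ∀ i, ∑' k, w k * ‖β i k‖ ≤ S) (d : ι → ℂ) :
    (Summable fun k => w k * ‖∑ i, d i * β i k‖) ∧
      ∑' k, w k * ‖∑ i, d i * β i k‖ ≤ (∑ i, ‖d i‖) * S := by
  have hle : ∀ k, w k * ‖∑ i, d i * β i k‖ ≤ ∑ i, ‖d i‖ * (w k * ‖β i k‖) := fun k => by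
    refine (mul_le_mul_of_nonneg_left (norm_sum_le _ _) (hw k)).trans (le_of_eq ?_)
    rw [Finset.mul_sum]
    refine Finset.sum_congr rfl fun i _ => ?_
    rw [norm_mul]; ring
  have hs : Summable fun k => ∑ i, ‖d i‖ * (w k * ‖β i k‖) :=
    summable_sum fun i _ => (h i).mul_left _
  have hs' := hs.of_nonneg_of_le (fun k => mul_nonneg (hw k) (norm_nonneg _)) hle
  refine ⟨hs', (hs'.tsum_le_tsum hle hs).trans ?_⟩
  rw [Summable.tsum_finsetSum fun i _ => (h i).mul_left _, Finset.sum_mul]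
  refine Finset.sum_le_sum fun i _ => ?_
  rw [tsum_mul_left]
  exact mul_le_mul_of_nonneg_left (hS i) (norm_nonneg _)

theorem trigSeries_linComb {ι : Type*} [Fintype ι] {β : ι → ℕ → ℂ}
    (h : ∀ i, Summable fun k => ‖β i k‖) (d : ι → ℂ) :
    (Summable fun k => ‖∑ i, d i * β i k‖) ∧
      ∀ t, trigSeries (fun k => ∑ i, d i * β i k) t = ∑ i, d i * trigSeries (β i) t := by
  have hd : ∀ i ∈ Finset.univ, Summable fun k => ‖d i * β i k‖ := fun i _ => by
    simpa only [norm_mul] using (h i).mul_left ‖d i‖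
  refine ⟨(summable_sum hd).of_nonneg_of_le (fun _ => norm_nonneg _) fun k => norm_sum_le _ _,
    fun t => ?_⟩
  rw [trigSeries_sum _ hd]
  simp_rw [trigSeries_const_mul]

theorem norm_trigSeries_linComb_le {ι : Type*} [Fintype ι] {β : ι → ℕ → ℂ} {S : ℝ}
    (h : ∀ i, Summable fun k => ‖β i k‖) (hS : ∀ i t, ‖trigSeries (β i) t‖ ≤ S) (d : ι → ℂ)
    (t : ℝ) : ‖trigSeries (fun k => ∑ i, d i * β i k) t‖ ≤ (∑ i, ‖d i‖) * S := by
  rw [(trigSeries_linComb h d).2, Finset.sum_mul]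
  refine (norm_sum_le _ _).trans (Finset.sum_le_sum fun i _ => ?_)
  rw [norm_mul]
  exact mul_le_mul_of_nonneg_left (hS i t) (norm_nonneg _)

theorem integral_re_trigSeries {γ : ℕ → ℂ} (h : Summable fun k => ‖γ k‖) :
    ∫ t in Set.Ico (0 : ℝ) 1, ((trigSeries γ t).re : ℂ) = 0 := by
  have h1 := integral_re (𝕜 := ℂ) (integrable_Ico_of_continuous (continuous_trigSeries h))
  rw [integral_trigSeries h] at h1
  rw [integral_complex_ofReal]
  simpa using h1

end LinearCombinations

section MomentBounds

open ComplexConjugate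

theorem momentBounds_box {f : ℕ → ℝ → ℂ} {g : ℕ → ℝ → ℝ} {B : ℕ → ℝ} {Y : ℝ} (hY : 1 ≤ Y)
    (hf : ∀ m, Continuous (f m)) (hg : ∀ m, Continuous (g m))
    (hf0 : ∀ m, ∫ t in Set.Ico (0 : ℝ) 1, f m t = 0)
    (hg0 : ∀ m, ∫ t in Set.Ico (0 : ℝ) 1, (g m t : ℂ) = 0)
    (hfB : ∀ m t, ‖f m t‖ ≤ B m) (hgB : ∀ m t, |g m t| ≤ Y * B m) :
    MomentBounds
      (fun m => ∫ t in Set.Ico (0 : ℝ) 1, Complex.exp ((g m t : ℂ) * Complex.I))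
      (fun m => ∫ t in Set.Ico (0 : ℝ) 1, f m t * Complex.exp ((g m t : ℂ) * Complex.I))
      (fun m => ∫ t in Set.Ico (0 : ℝ) 1, conj (f m t) * Complex.exp ((g m t : ℂ) * Complex.I))
      (fun m => ∫ t in Set.Ico (0 : ℝ) 1,
        f m t * conj (f m t) * Complex.exp ((g m t : ℂ) * Complex.I))
      (fun m => 3 * B m ^ 2) Y where
  K_le m := norm_integral_exp_le_one (g m)
  K_sub m := (norm_integral_exp_sub_one_le (hg m) (hg0 m) (hgB m)).trans (le_of_eq (by ring))
  A_le m := (norm_integral_mul_exp_le_mul (hf m) (hg m) (hf0 m) (hfB m) (hgB m)).trans (by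
    nlinarith [mul_nonneg (zero_le_one.trans hY) (sq_nonneg (B m))])
  B_le m := by
    have h0 : ∫ t in Set.Ico (0 : ℝ) 1, conj (f m t) = 0 := by
      rw [integral_conj, hf0, map_zero]
    have hc : ∀ t, ‖conj (f m t)‖ ≤ B m := fun t => by rw [RCLike.norm_conj]; exact hfB m t
    refine (norm_integral_mul_exp_le_mul (Complex.continuous_conj.comp (hf m)) (hg m) h0 hc
      (hgB m)).trans ?_
    nlinarith [mul_nonneg (zero_le_one.trans hY) (sq_nonneg (B m))]
  D_le m := by
    have hc : ∀ t, ‖f m t * conj (f m t)‖ ≤ B m ^ 2 := fun t => by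
      rw [norm_mul, RCLike.norm_conj, sq]
      exact mul_self_le_mul_self (norm_nonneg _) (hfB m t)
    exact (norm_integral_mul_exp_le hc (g m)).trans (by nlinarith [sq_nonneg (B m)])

end MomentBounds

/-! ### Sizes at the `m`-th prime and the supply of good primes -/

section PrimeScale

/-- A bound for the local logarithm and its derivative on the line `σ ≥ 1` at `p_m`. -/
noncomputable def primeScale (θ K : ℝ) (m : ℕ) : ℝ :=
  K * geomConst θ * (nthPrime m : ℝ) ^ (θ - 1) * (1 + Real.log (nthPrime m))

theorem primeScale_nonneg {θ K : ℝ} (hK : 0 ≤ K) (m : ℕ) : 0 ≤ primeScale θ K m := by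
  have := geomConst_nonneg θ
  have := Real.log_natCast_nonneg (nthPrime m)
  unfold primeScale
  positivity

theorem nthPrime_strictMono : StrictMono nthPrime :=
  Nat.nth_strictMono Nat.infinite_setOfPred_prime

theorem summable_primeScale_sq {θ K : ℝ} (hθ : θ < 1 / 2) :
    Summable fun m => primeScale θ K m ^ 2 := by
  -- The logarithm costs `p ^ δ`; after squaring the exponent is `2 * (θ - 1) + 2 * δ = θ - 3 / 2`,
  -- still below `-1`.
  set δ := (1 / 2 - θ) / 2 with hδ
  have hδ0 : 0 < δ := by rw [hδ]; linarith
  have hs : Summable fun m : ℕ =>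
      (K * geomConst θ * (1 + 1 / δ)) ^ 2 * (nthPrime m : ℝ) ^ (θ - 3 / 2) :=
    ((Real.summable_nat_rpow.2 (show θ - 3 / 2 < -1 by linarith)).comp_injective
      nthPrime_strictMono.injective).mul_left _
  refine hs.of_nonneg_of_le (fun m => sq_nonneg _) fun m => ?_
  have hp1 : (1 : ℝ) ≤ nthPrime m := by exact_mod_cast (prime_nthPrime m).one_lt.le
  have hp0 : (0 : ℝ) < nthPrime m := by linarith
  have h1 : 1 + Real.log (nthPrime m) ≤ (1 + 1 / δ) * (nthPrime m : ℝ) ^ δ := by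
    have h2 := Real.log_le_rpow_div hp0.le hδ0
    have h3 := Real.one_le_rpow hp1 hδ0.le
    rw [add_mul, one_mul, one_div_mul_eq_div]
    linarith
  have h0 : 0 ≤ Real.log (nthPrime m) := Real.log_natCast_nonneg _
  have e : (nthPrime m : ℝ) ^ (θ - 3 / 2) =
      ((nthPrime m : ℝ) ^ (θ - 1)) ^ 2 * ((nthPrime m : ℝ) ^ δ) ^ 2 := by
    rw [← Real.rpow_natCast, ← Real.rpow_natCast, ← Real.rpow_mul hp0.le, ← Real.rpow_mul hp0.le,
      ← Real.rpow_add hp0]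
    congr 1
    rw [hδ]; push_cast; ring
  rw [e]
  calc primeScale θ K m ^ 2 = (K * geomConst θ * (nthPrime m : ℝ) ^ (θ - 1)) ^ 2 *
        (1 + Real.log (nthPrime m)) ^ 2 := by unfold primeScale; ring
    _ ≤ (K * geomConst θ * (nthPrime m : ℝ) ^ (θ - 1)) ^ 2 *
        ((1 + 1 / δ) * (nthPrime m : ℝ) ^ δ) ^ 2 := by gcongr
    _ = _ := by ring

variable {b : ℕ → ℂ} {θ K : ℝ}

theorem HasCoeffBound.locCoeff_le_primeScale (h : HasCoeffBound b θ K) (hθ : θ < 1 / 2)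
    (hK : 0 ≤ K) (m : ℕ) {σ : ℝ} (hσ : 1 ≤ σ) (t : ℝ) :
    ‖trigSeries (locCoeff b (nthPrime m) σ) t‖ ≤ primeScale θ K m := by
  refine ((h.locCoeff_bound hθ hK (prime_nthPrime m) hσ).2 t).trans ?_
  have hg := geomConst_nonneg θ
  have hp1 : (1 : ℝ) ≤ nthPrime m := by exact_mod_cast (prime_nthPrime m).one_lt.le
  have h0 : 0 ≤ Real.log (nthPrime m) := Real.log_natCast_nonneg _
  have h1 : (nthPrime m : ℝ) ^ (θ - σ) ≤ (nthPrime m : ℝ) ^ (θ - 1) :=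
    Real.rpow_le_rpow_of_exponent_le hp1 (by linarith)
  calc K * geomConst θ * (nthPrime m : ℝ) ^ (θ - σ)
      ≤ K * geomConst θ * (nthPrime m : ℝ) ^ (θ - 1) := by gcongr
    _ ≤ _ := le_mul_of_one_le_right (by positivity) (by linarith)

theorem HasCoeffBound.locDeriv_le_primeScale (h : HasCoeffBound b θ K) (hθ : θ < 1 / 2)
    (hK : 0 ≤ K) (m : ℕ) {σ : ℝ} (hσ : 1 ≤ σ) (t : ℝ) :
    ‖trigSeries (locDeriv b (nthPrime m) σ) t‖ ≤ primeScale θ K m := by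
  refine ((h.locDeriv_bound hθ hK (prime_nthPrime m) hσ).2 t).trans ?_
  have hg := geomConst_nonneg θ
  have hp1 : (1 : ℝ) ≤ nthPrime m := by exact_mod_cast (prime_nthPrime m).one_lt.le
  have h0 : 0 ≤ Real.log (nthPrime m) := Real.log_natCast_nonneg _
  have h1 : (nthPrime m : ℝ) ^ (θ - σ) ≤ (nthPrime m : ℝ) ^ (θ - 1) :=
    Real.rpow_le_rpow_of_exponent_le hp1 (by linarith)
  calc Real.log (nthPrime m) * (K * geomConst θ * (nthPrime m : ℝ) ^ (θ - σ))
      ≤ (1 + Real.log (nthPrime m)) * (K * geomConst θ * (nthPrime m : ℝ) ^ (θ - 1)) := by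
        gcongr; linarith
    _ = _ := by unfold primeScale; ring

/-- Every direction is seen well by `t` of the first `n₀ t` primes. -/
theorem AreOrthogonal.exists_good_primes {N : ℕ} {a : Fin N → ℕ → ℂ} (h : AreOrthogonal a)
    (C : ℝ) {e : ℝ} (he : e < 0) (t : ℕ) :
    ∃ n₀ : ℕ, ∀ y : EuclideanSpace ℂ (Fin N), ∃ G : Finset ℕ, t ≤ G.card ∧ ∀ m ∈ G, m < n₀ ∧
      C * (nthPrime m : ℝ) ^ e * ‖y‖ ≤ ‖∑ j, (starRingEnd ℂ) (y j) * a j (nthPrime m)‖ := by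
  induction t with
  | zero => exact ⟨0, fun y => ⟨∅, le_rfl, by simp⟩⟩
  | succ t ih =>
    obtain ⟨n₀, hn₀⟩ := ih
    -- The block begins at the prime of index `n₀`, so its good prime differs from all those found
    -- before.
    obtain ⟨P₁, hP₁⟩ := h.exists_prime_block C he (nthPrime n₀)
    refine ⟨max n₀ (P₁ + 1), fun y => ?_⟩
    obtain ⟨G, hG, hGm⟩ := hn₀ y
    obtain ⟨p, hp, hp0, hp1, hpy⟩ := hP₁ y
    have hcount : nthPrime (Nat.count Nat.Prime p) = p := Nat.nth_count hp
    set m := Nat.count Nat.Prime p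
    have hm0 : n₀ ≤ m := nthPrime_strictMono.le_iff_le.1 (by rw [hcount]; exact hp0)
    have hm1 : m ≤ p := by
      have := nthPrime_strictMono.le_apply (x := m)
      rwa [hcount] at this
    refine ⟨insert m G, ?_, fun m' hm' => ?_⟩
    · rw [Finset.card_insert_of_notMem fun hm => absurd (hGm m hm).1 (not_lt.2 hm0)]
      omega
    · rcases Finset.mem_insert.1 hm' with rfl | hm'
      · exact ⟨lt_max_of_lt_right (by omega), by rw [hcount]; exact hpy⟩
      · exact ⟨lt_max_of_lt_left (hGm m' hm').1, (hGm m' hm').2⟩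

end PrimeScale

/-! ### Decay of the one-prime characteristic function at a good prime -/

section PhaseAndWeight

open ComplexConjugate

variable {N : ℕ} {b : Fin N → ℕ → ℂ} {θ K : ℝ}

/-- The coefficients of the phase at `p_m` in direction `y`. -/
noncomputable def phaseCoeff (b : Fin N → ℕ → ℂ) (σ : ℝ) (y : EuclideanSpace ℂ (Fin N))
    (m k : ℕ) : ℂ :=
  ∑ j, (2 * Real.pi : ℝ) * conj (y j) * locCoeff (b j) (nthPrime m) σ k

/-- The coefficients of `∑ c_j F_{j,p_m}'/F_{j,p_m}`. -/
noncomputable def weightCoeff (b : Fin N → ℕ → ℂ) (c : Fin N → ℂ) (σ : ℝ) (m k : ℕ) : ℂ :=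
  ∑ j, c j * locDeriv (b j) (nthPrime m) σ k

theorem sum_norm_direction_le (y : EuclideanSpace ℂ (Fin N)) :
    ∑ j, ‖(2 * Real.pi : ℝ) * conj (y j)‖ ≤ 2 * Real.pi * N * ‖y‖ := by
  have h : ∀ j ∈ Finset.univ, ‖(2 * Real.pi : ℝ) * conj (y j)‖ ≤ 2 * Real.pi * ‖y‖ := fun j _ => by
    rw [norm_mul, RCLike.norm_conj, Complex.norm_real, Real.norm_of_nonneg (by positivity)]
    have := PiLp.norm_apply_le y j
    gcongr
  refine (Finset.sum_le_sum h).trans (le_of_eq ?_)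
  simp
  ring

theorem phaseCoeff_zero (σ : ℝ) (y : EuclideanSpace ℂ (Fin N)) (m : ℕ) :
    ‖phaseCoeff b σ y m 0‖ = 2 * Real.pi * (nthPrime m : ℝ) ^ (-σ) *
      ‖∑ j, conj (y j) * b j (nthPrime m)‖ := by
  have hp0 : (0 : ℝ) < nthPrime m := by exact_mod_cast (prime_nthPrime m).pos
  have e : phaseCoeff b σ y m 0 = ((2 * Real.pi * (nthPrime m : ℝ) ^ (-σ) : ℝ) : ℂ) *
      ∑ j, conj (y j) * b j (nthPrime m) := by
    unfold phaseCoeff locCoeff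
    rw [Finset.mul_sum]
    refine Finset.sum_congr rfl fun j _ => ?_
    simp only [Nat.cast_zero, zero_add, one_mul, pow_one]
    rw [Real.rpow_neg hp0.le]
    push_cast
    ring
  rw [e, norm_mul, Complex.norm_real, Real.norm_of_nonneg (by positivity)]

/-- The leading phase coefficient is `2π p^{-σ} |∑ conj(y_j) b_j(p)|`, while the tail is at most
`2πN ‖y‖ K geomConst p^{2(θ-σ)}`; as `σ ≥ 1`, `p^{2(θ-σ)} ≤ p^{2θ-1-σ}` and `hy` makes the former
dominate. The constant uses only `p_n` and `M`, hence is uniform in `m < n` and `σ ≤ M`. -/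
theorem norm_phase_integral_le (hb : ∀ j, HasCoeffBound (b j) θ K) (hθ : θ < 1 / 2) (hK : 0 ≤ K)
    {σ M : ℝ} (hσ : σ ∈ Set.Icc 1 M) (y : EuclideanSpace ℂ (Fin N)) {m n : ℕ} (hmn : m < n)
    (hy : (2 * N * K * geomConst θ + 1) * (nthPrime m : ℝ) ^ (2 * θ - 1) * ‖y‖ ≤
      ‖∑ j, conj (y j) * b j (nthPrime m)‖) :
    ‖∫ t in Set.Ico (0 : ℝ) 1,
        Complex.exp (((trigSeries (phaseCoeff b σ y m) t).re : ℂ) * Complex.I)‖ ≤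
      (106 * ((nthPrime n : ℝ) ^ (2 * θ - 1 - M) / 2) ^ (-(1 / 3) : ℝ) + 2) *
        (1 + ‖y‖) ^ (-(1 / 3) : ℝ) := by
  have hpi : 3 < Real.pi := Real.pi_gt_three
  have hG := geomConst_nonneg θ
  have hp := prime_nthPrime m
  have hp0 : (0 : ℝ) < nthPrime m := by exact_mod_cast hp.pos
  have hn0 : (0 : ℝ) < nthPrime n := by exact_mod_cast (prime_nthPrime n).pos
  have hp1 : (1 : ℝ) ≤ nthPrime m := by exact_mod_cast hp.one_lt.le
  have hy0 := norm_nonneg y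
  have hκ0 : 0 < (nthPrime n : ℝ) ^ (2 * θ - 1 - M) / 2 := by positivity
  have hr0 : (0 : ℝ) < (1 + ‖y‖) ^ (-(1 / 3) : ℝ) := by positivity
  -- For `‖y‖ ≤ 1` the trivial bound `1` suffices; it accounts for the `+ 2` in the constant.
  rcases le_total ‖y‖ 1 with hy1 | hy1
  · refine (norm_integral_exp_le_one _).trans ?_
    have h2 : (1 : ℝ) / 2 ≤ (1 + ‖y‖) ^ (-(1 / 3) : ℝ) := by
      calc (1 : ℝ) / 2 = 2 ^ (-1 : ℝ) := by rw [Real.rpow_neg_one]; norm_num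
        _ ≤ (1 + ‖y‖) ^ (-1 : ℝ) :=
          Real.rpow_le_rpow_of_nonpos (by positivity) (by linarith) (by norm_num)
        _ ≤ _ := Real.rpow_le_rpow_of_exponent_le (by linarith) (by norm_num)
    have : 0 ≤ 106 * ((nthPrime n : ℝ) ^ (2 * θ - 1 - M) / 2) ^ (-(1 / 3) : ℝ) := by positivity
    nlinarith
  set q := (nthPrime m : ℝ)
  have hlow : 2 * Real.pi * ((2 * N * K * geomConst θ + 1) * q ^ (2 * θ - 1 - σ) * ‖y‖) ≤
      ‖phaseCoeff b σ y m 0‖ := by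
    rw [phaseCoeff_zero, show 2 * θ - 1 - σ = -σ + (2 * θ - 1) by ring, Real.rpow_add hp0]
    calc _ = 2 * Real.pi * q ^ (-σ) *
          ((2 * N * K * geomConst θ + 1) * q ^ (2 * θ - 1) * ‖y‖) := by ring
      _ ≤ _ := by gcongr
  have hκ : (nthPrime n : ℝ) ^ (2 * θ - 1 - M) / 2 * (1 + ‖y‖) ≤ ‖phaseCoeff b σ y m 0‖ := by
    have h1 : (nthPrime n : ℝ) ^ (2 * θ - 1 - M) ≤ q ^ (2 * θ - 1 - σ) :=
      calc (nthPrime n : ℝ) ^ (2 * θ - 1 - M) ≤ q ^ (2 * θ - 1 - M) :=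
            Real.rpow_le_rpow_of_nonpos hp0
              (Nat.cast_le.2 (nthPrime_strictMono.monotone hmn.le)) (by linarith [hσ.1, hσ.2])
        _ ≤ _ := Real.rpow_le_rpow_of_exponent_le hp1 (by linarith [hσ.2])
    have h2 : 0 ≤ 2 * N * K * geomConst θ := by positivity
    calc (nthPrime n : ℝ) ^ (2 * θ - 1 - M) / 2 * (1 + ‖y‖)
        ≤ q ^ (2 * θ - 1 - σ) / 2 * (‖y‖ + ‖y‖) := by gcongr
      _ = 1 * (1 * q ^ (2 * θ - 1 - σ) * ‖y‖) := by ring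
      _ ≤ 2 * Real.pi * ((2 * N * K * geomConst θ + 1) * q ^ (2 * θ - 1 - σ) * ‖y‖) := by
        gcongr <;> linarith
      _ ≤ _ := hlow
  have hpos : 0 < ‖phaseCoeff b σ y m 0‖ := lt_of_lt_of_le (by positivity) hκ
  have hd := sum_norm_direction_le y
  have htail := (weighted_linComb (w := fun k : ℕ => ((k : ℝ) + 2) ^ 2) (fun k => by positivity)
    (fun j => ((hb j).tail_le hθ hK hp hσ.1).1) (fun j => ((hb j).tail_le hθ hK hp hσ.1).2)
    fun j => (2 * Real.pi : ℝ) * conj (y j)).2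
  have hsum := (weighted_linComb (w := fun k : ℕ => ((k : ℝ) + 1) ^ 2) (fun k => by positivity)
    (fun j => ((hb j).summable_sq_mul hθ hK hp hσ.1).1)
    (fun j => ((hb j).summable_sq_mul hθ hK hp hσ.1).2)
    fun j => (2 * Real.pi : ℝ) * conj (y j)).1
  -- Here the summand `2 * N * K * geomConst θ` is used; the `+ 1` served to keep the leading
  -- coefficient away from zero.
  have hsmall : (∑ j, ‖(2 * Real.pi : ℝ) * conj (y j)‖) *
      (K * geomConst θ * (q ^ (θ - σ)) ^ 2) ≤ ‖phaseCoeff b σ y m 0‖ / 2 := by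
    have h1 : (q ^ (θ - σ)) ^ 2 ≤ q ^ (2 * θ - 1 - σ) := by
      rw [← Real.rpow_natCast, ← Real.rpow_mul hp0.le]
      refine Real.rpow_le_rpow_of_exponent_le hp1 ?_
      push_cast
      linarith [hσ.1]
    have h2 : 0 ≤ Real.pi * (q ^ (2 * θ - 1 - σ) * ‖y‖) := by positivity
    calc _ ≤ 2 * Real.pi * N * ‖y‖ * (K * geomConst θ * q ^ (2 * θ - 1 - σ)) := by gcongr
      _ ≤ 2 * Real.pi * ((2 * N * K * geomConst θ + 1) * q ^ (2 * θ - 1 - σ) * ‖y‖) / 2 := by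
        linarith
      _ ≤ _ := by linarith
  refine (norm_integral_exp_trigSeries_le (norm_pos_iff.1 hpos) hsum
    (htail.trans hsmall)).trans ?_
  have hr : ‖phaseCoeff b σ y m 0‖ ^ (-(1 / 3) : ℝ) ≤
      ((nthPrime n : ℝ) ^ (2 * θ - 1 - M) / 2) ^ (-(1 / 3) : ℝ) *
        (1 + ‖y‖) ^ (-(1 / 3) : ℝ) := by
    rw [← Real.mul_rpow hκ0.le (by positivity)]
    exact Real.rpow_le_rpow_of_nonpos (by positivity) hκ (by norm_num)
  linarith

end PhaseAndWeight

/-! ### The weighted characteristic function and its limit -/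

section WeightedLimit

open ComplexConjugate

variable {N : ℕ} {b : Fin N → ℕ → ℂ} {θ K : ℝ}

/-- The characteristic function of `weightedDistribution` for the weight `|∑ c_j F_j'/F_j|²`. -/
noncomputable def weightedMoment (b : Fin N → ℕ → ℂ) (c : Fin N → ℂ) (σ : ℝ)
    (y : EuclideanSpace ℂ (Fin N)) (n : ℕ) : ℂ :=
  ∫ x, boxSum (fun m => trigSeries (weightCoeff b c σ m)) n x *
    conj (boxSum (fun m => trigSeries (weightCoeff b c σ m)) n x) *
    boxPhase (fun m t => (trigSeries (phaseCoeff b σ y m) t).re) n x ∂(boxMeasure n)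

theorem summable_phaseCoeff (hb : ∀ j, HasCoeffBound (b j) θ K) (hθ : θ < 1 / 2) (hK : 0 ≤ K)
    {σ : ℝ} (hσ : 1 ≤ σ) (y : EuclideanSpace ℂ (Fin N)) (m : ℕ) :
    Summable fun k => ‖phaseCoeff b σ y m k‖ :=
  (trigSeries_linComb (fun j => ((hb j).locCoeff_bound hθ hK (prime_nthPrime m) hσ).1) _).1

theorem summable_weightCoeff (hb : ∀ j, HasCoeffBound (b j) θ K) (hθ : θ < 1 / 2) (hK : 0 ≤ K)
    {σ : ℝ} (hσ : 1 ≤ σ) (c : Fin N → ℂ) (m : ℕ) :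
    Summable fun k => ‖weightCoeff b c σ m k‖ :=
  (trigSeries_linComb (fun j => ((hb j).locDeriv_bound hθ hK (prime_nthPrime m) hσ).1) _).1

/-- Goodness of a prime is a property of the numbers `b_j(p)` alone. Hence the thresholds depend
neither on `σ` and `M` nor on the weight `c`, and one sequence serves all the measures. -/
theorem exists_rapid_limit_weightedMoment (hb : ∀ j, HasCoeffBound (b j) θ K) (hθ : θ < 1 / 2)
    (hK : 0 ≤ K) {n₀ : ℕ → ℕ} (hn₀ : ∀ t, ∀ y : EuclideanSpace ℂ (Fin N), ∃ G : Finset ℕ,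
      t ≤ G.card ∧ ∀ m ∈ G, m < n₀ t ∧
        (2 * N * K * geomConst θ + 1) * (nthPrime m : ℝ) ^ (2 * θ - 1) * ‖y‖ ≤
          ‖∑ j, conj (y j) * b j (nthPrime m)‖) (c : Fin N → ℂ) :
    ∃ φ : ℝ → EuclideanSpace ℂ (Fin N) → ℂ, ∀ (J : ℕ) (M : ℝ), ∃ (C : ℝ) (δ : ℕ → ℝ),
      Tendsto δ atTop (𝓝 0) ∧ ∀ n, n₀ (3 * (J + 4) + 2) ≤ n → ∀ σ ∈ Set.Icc 1 M, ∀ y,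
        ‖weightedMoment b c σ y n‖ ≤ C * ((1 + ‖y‖) ^ J)⁻¹ ∧
        ‖weightedMoment b c σ y n - φ σ y‖ ≤ δ n * ((1 + ‖y‖) ^ J)⁻¹ := by
  -- One scale dominates both the weight and the phase divided by `1 + ‖y‖`.
  set B : ℕ → ℝ := fun m => (∑ j, ‖c j‖ + 2 * Real.pi * N) * primeScale θ K m with hB
  have hΛ := fun m => primeScale_nonneg (θ := θ) hK m
  have hc0 : 0 ≤ ∑ j, ‖c j‖ := Finset.sum_nonneg fun _ _ => norm_nonneg _
  have hpN : 0 ≤ 2 * Real.pi * N := by positivity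
  have hε : Summable fun m => 3 * B m ^ 2 := by
    simp only [hB, mul_pow]
    exact ((summable_primeScale_sq hθ).mul_left _).mul_left _
  have hf : ∀ σ, 1 ≤ σ → ∀ m, Continuous (trigSeries (weightCoeff b c σ m)) := fun σ hσ m =>
    continuous_trigSeries (summable_weightCoeff hb hθ hK hσ c m)
  have hg : ∀ σ, 1 ≤ σ → ∀ y : EuclideanSpace ℂ (Fin N), ∀ m,
      Continuous fun t => (trigSeries (phaseCoeff b σ y m) t).re := fun σ hσ y m =>
    Complex.continuous_re.comp (continuous_trigSeries (summable_phaseCoeff hb hθ hK hσ y m))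
  have hfB : ∀ σ, 1 ≤ σ → ∀ m t, ‖trigSeries (weightCoeff b c σ m) t‖ ≤ B m := fun σ hσ m t => by
    refine (norm_trigSeries_linComb_le
      (fun j => ((hb j).locDeriv_bound hθ hK (prime_nthPrime m) hσ).1)
      (fun j => (hb j).locDeriv_le_primeScale hθ hK m hσ) c t).trans ?_
    exact mul_le_mul_of_nonneg_right (by linarith) (hΛ m)
  have hgB : ∀ σ, 1 ≤ σ → ∀ y : EuclideanSpace ℂ (Fin N), ∀ m t,
      |(trigSeries (phaseCoeff b σ y m) t).re| ≤ (1 + ‖y‖) * B m := fun σ hσ y m t => by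
    refine (Complex.abs_re_le_norm _).trans ((norm_trigSeries_linComb_le
      (fun j => ((hb j).locCoeff_bound hθ hK (prime_nthPrime m) hσ).1)
      (fun j => (hb j).locCoeff_le_primeScale hθ hK m hσ) _ t).trans ?_)
    rw [hB, ← mul_assoc]
    refine mul_le_mul_of_nonneg_right ((sum_norm_direction_le y).trans ?_) (hΛ m)
    nlinarith [norm_nonneg y, mul_nonneg (norm_nonneg y) hc0]
  -- This `C₀` bounds `A` and `B` independently of `y`, through `B n ≤ 1 + 3 * B n ^ 2`.
  refine exists_rapid_limit_of_momentRecursion (C₀ := 1 + ∑' m, 3 * B m ^ 2)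
    (fun n => by positivity) hε
    (fun σ hσ y => momentRecursion_box (hf σ hσ) (hg σ hσ y))
    (fun σ hσ y => momentBounds_box (by linarith [norm_nonneg y]) (hf σ hσ) (hg σ hσ y)
      (fun m => integral_trigSeries (summable_weightCoeff hb hθ hK hσ c m))
      (fun m => integral_re_trigSeries (summable_phaseCoeff hb hθ hK hσ y m))
      (hfB σ hσ) (hgB σ hσ y)) ?_ ?_ ?_
  · intro σ hσ y n
    refine (norm_integral_mul_exp_le (hfB σ hσ n) _).trans ?_
    have := hε.le_tsum n fun m _ => by positivity
    nlinarith [sq_nonneg (B n - 1)]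
  · intro σ hσ y n
    refine (norm_integral_mul_exp_le (A := B n)
      (fun t => by rw [RCLike.norm_conj]; exact hfB σ hσ n t) _).trans ?_
    have := hε.le_tsum n fun m _ => by positivity
    nlinarith [sq_nonneg (B n - 1)]
  · intro t M
    refine ⟨106 * ((nthPrime (n₀ t) : ℝ) ^ (2 * θ - 1 - M) / 2) ^ (-(1 / 3) : ℝ) + 2,
      fun σ hσ y => ?_⟩
    obtain ⟨G, hG, hGm⟩ := hn₀ t y
    exact ⟨G, hG, fun m hm => ⟨(hGm m hm).1,
      norm_phase_integral_le hb hθ hK hσ y (hGm m hm).1 (hGm m hm).2⟩⟩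

end WeightedLimit

/-! ### The weighted distributions -/

section Distribution

open ComplexConjugate

variable {N : ℕ} {b : Fin N → ℕ → ℂ} {θ K : ℝ}

/-- `∑ c_j (F_{j,n}'/F_{j,n})(σ, ·)`. -/
noncomputable def combinedLogDeriv (b : Fin N → ℕ → ℂ) (c : Fin N → ℂ) (σ : ℝ) (n : ℕ)
    (x : Fin n → ℝ) : ℂ := ∑ j, c j * partialLogDeriv (b j) n σ x

theorem combinedLogDeriv_eq (hb : ∀ j, HasCoeffBound (b j) θ K) (hθ : θ < 1 / 2) (hK : 0 ≤ K)
    (c : Fin N → ℂ) {σ : ℝ} (hσ : 1 ≤ σ) (n : ℕ) :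
    combinedLogDeriv b c σ n = boxSum (fun m => trigSeries (weightCoeff b c σ m)) n := by
  ext x
  unfold combinedLogDeriv boxSum
  simp_rw [fun j => (hb j).partialLogDeriv_eq hθ n hσ x, Finset.mul_sum]
  rw [Finset.sum_comm]
  exact Finset.sum_congr rfl fun m _ => ((trigSeries_linComb
    (fun j => ((hb j).locDeriv_bound hθ hK (prime_nthPrime m) hσ).1) c).2 (x m)).symm

theorem continuous_combinedLogDeriv (hb : ∀ j, HasCoeffBound (b j) θ K) (hθ : θ < 1 / 2)
    (hK : 0 ≤ K) (c : Fin N → ℂ) {σ : ℝ} (hσ : 1 ≤ σ) (n : ℕ) :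
    Continuous (combinedLogDeriv b c σ n) := by
  rw [combinedLogDeriv_eq hb hθ hK c hσ]
  exact continuous_boxSum
    (fun m => continuous_trigSeries (summable_weightCoeff hb hθ hK hσ c m)) n

theorem continuous_logPartial_pi (hb : ∀ j, HasCoeffBound (b j) θ K) (hθ : θ < 1 / 2)
    (hK : 0 ≤ K) {σ : ℝ} (hσ : 1 ≤ σ) (n : ℕ) :
    Continuous fun (x : Fin n → ℝ) (h : Fin N) => logPartial (b h) n (σ : ℂ) x := by
  refine continuous_pi fun h => ?_
  simp_rw [logPartial_eq]
  exact continuous_finsetSum _ fun m _ => (continuous_trigSeries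
    ((hb h).locCoeff_bound hθ hK (prime_nthPrime m) hσ).1).comp (continuous_apply m)

theorem isFiniteMeasure_weightedDistribution (hb : ∀ j, HasCoeffBound (b j) θ K)
    (hθ : θ < 1 / 2) (hK : 0 ≤ K) (c : Fin N → ℂ) {σ : ℝ} (hσ : 1 ≤ σ) (n : ℕ) :
    IsFiniteMeasure (weightedDistribution b σ n (combinedLogDeriv b c σ n)) := by
  have hw := continuous_combinedLogDeriv hb hθ hK c hσ n
  have hi : Integrable (fun x => ‖combinedLogDeriv b c σ n x‖ ^ 2) (boxMeasure n) := by
    have : Continuous fun x => ((‖combinedLogDeriv b c σ n x‖ ^ 2 : ℝ) : ℂ) := by fun_prop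
    exact (integrable_box_of_continuous this).re
  have := isFiniteMeasure_withDensity_ofReal hi.2
  unfold weightedDistribution
  rw [volume_restrict_box]
  infer_instance

/-- The real inner product on `ℂ^N` is `Re ∑ conj(y_j) z_j`, so the phase splits into one function
of `θ_m` per prime. -/
theorem inner_logPartial_eq (hb : ∀ j, HasCoeffBound (b j) θ K) (hθ : θ < 1 / 2) (hK : 0 ≤ K)
    {σ : ℝ} (hσ : 1 ≤ σ) (n : ℕ) (x : Fin n → ℝ) (y : EuclideanSpace ℂ (Fin N)) :
    inner ℝ ((PiLp.continuousLinearEquiv 2 ℝ (fun _ : Fin N => ℂ)).symm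
      fun h => logPartial (b h) n (σ : ℂ) x) ((2 * Real.pi) • y) =
      ∑ m : Fin n, (trigSeries (phaseCoeff b σ y m) (x m)).re := by
  have h1 : ∀ m : Fin n, trigSeries (phaseCoeff b σ y m) (x m) =
      ∑ j, (2 * Real.pi : ℝ) * conj (y j) * trigSeries (locCoeff (b j) (nthPrime m) σ) (x m) :=
    fun m => (trigSeries_linComb
      (fun j => ((hb j).locCoeff_bound hθ hK (prime_nthPrime m) hσ).1) _).2 (x m)
  simp_rw [h1, ← Complex.re_sum]
  rw [Finset.sum_comm]
  simp_rw [← Finset.mul_sum, ← logPartial_eq]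
  rw [PiLp.inner_apply, Complex.re_sum]
  refine Finset.sum_congr rfl fun j _ => ?_
  rw [Complex.inner]
  simp

theorem scaledCharFun_weightedDistribution (hb : ∀ j, HasCoeffBound (b j) θ K) (hθ : θ < 1 / 2)
    (hK : 0 ≤ K) (c : Fin N → ℂ) {σ : ℝ} (hσ : 1 ≤ σ) (n : ℕ) (y : EuclideanSpace ℂ (Fin N)) :
    scaledCharFun ((weightedDistribution b σ n (combinedLogDeriv b c σ n)).map
      (PiLp.continuousLinearEquiv 2 ℝ (fun _ : Fin N => ℂ)).symm) y =
      weightedMoment b c σ y n := by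
  have hw := continuous_combinedLogDeriv hb hθ hK c hσ n
  have hL := continuous_logPartial_pi hb hθ hK hσ n
  set T := (PiLp.continuousLinearEquiv 2 ℝ (fun _ : Fin N => ℂ)).symm with hT
  have hTc : Continuous T := T.continuous
  unfold scaledCharFun weightedDistribution
  rw [charFun_apply, volume_restrict_box, Measure.map_map hTc.measurable hL.measurable,
    integral_map (hTc.comp hL).measurable.aemeasurable
      (by fun_prop),
    integral_withDensity_eq_integral_toReal_smul₀ (by fun_prop)
      (ae_of_all _ fun _ => ENNReal.ofReal_lt_top)]
  unfold weightedMoment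
  refine integral_congr_ae (ae_of_all _ fun x => ?_)
  simp only [Function.comp_apply]
  rw [hT, inner_logPartial_eq hb hθ hK hσ, ENNReal.toReal_ofReal (by positivity),
    ← combinedLogDeriv_eq hb hθ hK c hσ, Complex.mul_conj, Complex.normSq_eq_norm_sq,
    Complex.real_smul]
  rfl

/-- The limit theorem for the weight `|∑ c_j F_j'/F_j|²`. -/
theorem exists_limit_densities_combined (hb : ∀ j, HasCoeffBound (b j) θ K) (hθ : θ < 1 / 2)
    (hK : 0 ≤ K) {n₀ : ℕ → ℕ} (hn₀ : ∀ t, ∀ y : EuclideanSpace ℂ (Fin N), ∃ G : Finset ℕ,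
      t ≤ G.card ∧ ∀ m ∈ G, m < n₀ t ∧
        (2 * N * K * geomConst θ + 1) * (nthPrime m : ℝ) ^ (2 * θ - 1) * ‖y‖ ≤
          ‖∑ j, conj (y j) * b j (nthPrime m)‖) (c : Fin N → ℂ)
    {ν : ℝ → ℕ → Measure (Fin N → ℂ)}
    (hν : ∀ σ n, ν σ n = weightedDistribution b σ n (combinedLogDeriv b c σ n)) :
    ∃ (G : ℝ → ℕ → (Fin N → ℂ) → ℝ) (lam : ℝ → Measure (Fin N → ℂ))
      (Glim : ℝ → (Fin N → ℂ) → ℝ),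
      (∀ k n : ℕ, max 1 (n₀ (3 *
          (Module.finrank ℝ (EuclideanSpace ℂ (Fin N)) + 1 + k + 4) + 2)) ≤ n →
        ∀ σ : ℝ, 1 ≤ σ →
        IsAbsContWithDensity (ν σ n) (G σ n) ∧ ContDiff ℝ (k : ℕ∞) (G σ n)) ∧
      (∀ σ : ℝ, 1 ≤ σ →
        ConvergesWeakly (fun n => ν σ n) (lam σ) ∧
          IsAbsContWithDensity (lam σ) (Glim σ) ∧ ContDiff ℝ (⊤ : ℕ∞) (Glim σ)) ∧
      (∀ M : ℝ, 1 < M → ∀ k : ℕ,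
        TendstoUniformlyOn
          (fun (n : ℕ) (q : ℝ × (Fin N → ℂ)) => iteratedFDeriv ℝ k (G q.1 n) q.2)
          (fun q : ℝ × (Fin N → ℂ) => iteratedFDeriv ℝ k (Glim q.1) q.2)
          atTop (Set.Icc 1 M ×ˢ Set.univ)) := by
  obtain ⟨φ, hφ⟩ := exists_rapid_limit_weightedMoment hb hθ hK hn₀ c
  -- Finiteness is required for every real `σ` but is known for `σ ≥ 1`; replacing `σ` by `max σ 1`
  -- changes nothing in the range of interest.
  have hmax : ∀ {σ : ℝ}, 1 ≤ σ → max σ 1 = σ := fun h => max_eq_left h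
  obtain ⟨G, lam, Glim, h1, h2, h3⟩ := exists_smooth_limit_densities
    (PiLp.continuousLinearEquiv 2 ℝ (fun _ : Fin N => ℂ)).symm (fun σ n => ν (max σ 1) n)
    (fun σ n => by
      rw [hν]
      exact isFiniteMeasure_weightedDistribution hb hθ hK c (le_max_right _ _) n)
    φ (fun J => n₀ (3 * (J + 4) + 2)) (by
      intro J M
      obtain ⟨C, δ, hδ, hC⟩ := hφ J M
      refine ⟨C, δ, hδ, fun n hn σ hσ y => ?_⟩
      simp only [hmax hσ.1, hν, scaledCharFun_weightedDistribution hb hθ hK c hσ.1]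
      exact hC n hn σ hσ y)
  refine ⟨G, lam, Glim, fun k n hn σ hσ => ?_, fun σ hσ => ?_, h3⟩
  · have := h1 k n ((le_max_right _ _).trans hn) σ hσ
    rwa [hmax hσ] at this
  · have := h2 σ hσ
    rwa [hmax hσ] at this

theorem combinedLogDeriv_single (b : Fin N → ℕ → ℂ) (j : Fin N) (σ : ℝ) (n : ℕ) :
    combinedLogDeriv b (Pi.single j 1) σ n = fun x => partialLogDeriv (b j) n σ x := by
  ext x
  simp [combinedLogDeriv, Pi.single_apply]

theorem combinedLogDeriv_pair (b : Fin N → ℕ → ℂ) (j l : Fin N) (τ : ℂ) (σ : ℝ) (n : ℕ) :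
    combinedLogDeriv b (Pi.single j 1 + Pi.single l τ) σ n = fun x =>
      partialLogDeriv (b j) n σ x + τ * partialLogDeriv (b l) n σ x := by
  ext x
  simp [combinedLogDeriv, Pi.single_apply, add_mul, Finset.sum_add_distrib]

theorem exists_common_coeffBound {F : Fin N → ℂ → ℂ} (h : ∀ j, HasLogEulerProduct (F j) (b j)) :
    ∃ θ K : ℝ, θ < 1 / 2 ∧ 0 ≤ K ∧ ∀ j, HasCoeffBound (b j) θ K := by
  choose θ hθ K hK using fun j => (h j).2
  obtain ⟨θ₀, hθ₀, hle⟩ : ∃ θ₀ : ℝ, θ₀ < 1 / 2 ∧ ∀ j, θ j ≤ θ₀ := by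
    rcases isEmpty_or_nonempty (Fin N) with _ | _
    · exact ⟨0, by norm_num, fun j => isEmptyElim j⟩
    · obtain ⟨i, hi⟩ := Finite.exists_max θ
      exact ⟨θ i, hθ i, hi⟩
  refine ⟨θ₀, ∑ j, |K j|, hθ₀, Finset.sum_nonneg fun _ _ => abs_nonneg _, fun j p hp k hk => ?_⟩
  have hp1 : (1 : ℝ) ≤ p := by exact_mod_cast hp.one_lt.le
  have h1 : K j ≤ ∑ j, |K j| := (le_abs_self _).trans
    (Finset.single_le_sum (f := fun j => |K j|) (fun _ _ => abs_nonneg _) (Finset.mem_univ j))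
  refine (hK j p hp k hk).trans ?_
  have h2 : (p : ℝ) ^ ((k : ℝ) * θ j) ≤ (p : ℝ) ^ ((k : ℝ) * θ₀) :=
    Real.rpow_le_rpow_of_exponent_le hp1 (mul_le_mul_of_nonneg_left (hle j) k.cast_nonneg)
  exact mul_le_mul h1 h2 (by positivity) (Finset.sum_nonneg fun _ _ => abs_nonneg _)

end Distribution

/-! ### Assembly of the theorem -/

theorem mainTheorem8 {N : ℕ} (hN : 1 ≤ N)
    (F : Fin N → ℂ → ℂ) (a b : Fin N → ℕ → ℂ)
    (hI : ∀ j, HasDirichletSeries (F j) (a j))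
    (hII : ∀ j, HasLogEulerProduct (F j) (b j))
    (horth : AreOrthogonal a) :
    -- the thresholds `n_k`, and the densities of the two families of measures
    ∃ (nk : ℕ → ℕ)
      (G : Fin N → ℝ → ℕ → (Fin N → ℂ) → ℝ)
      (H : Fin N → Fin N → ℂ → ℝ → ℕ → (Fin N → ℂ) → ℝ)
      -- the limit measures and their densities
      (lam : Fin N → ℝ → Measure (Fin N → ℂ))
      (lam' : Fin N → Fin N → ℂ → ℝ → Measure (Fin N → ℂ))
      (Glim : Fin N → ℝ → (Fin N → ℂ) → ℝ)
      (Hlim : Fin N → Fin N → ℂ → ℝ → (Fin N → ℂ) → ℝ),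
      (∀ k, 1 ≤ nk k) ∧
      -- the measures `λ_{σ,n;j}`
      (∀ j : Fin N,
        (∀ k n : ℕ, nk k ≤ n → ∀ σ : ℝ, 1 ≤ σ →
          IsAbsContWithDensity (lambdaSingle b j σ n) (G j σ n) ∧
            ContDiff ℝ (k : ℕ∞) (G j σ n)) ∧
        (∀ σ : ℝ, 1 ≤ σ →
          ConvergesWeakly (fun n => lambdaSingle b j σ n) (lam j σ) ∧
            IsAbsContWithDensity (lam j σ) (Glim j σ) ∧
            ContDiff ℝ (⊤ : ℕ∞) (Glim j σ)) ∧
        (∀ M : ℝ, 1 < M → ∀ k : ℕ,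
          TendstoUniformlyOn
            (fun (n : ℕ) (q : ℝ × (Fin N → ℂ)) => iteratedFDeriv ℝ k (G j q.1 n) q.2)
            (fun q : ℝ × (Fin N → ℂ) => iteratedFDeriv ℝ k (Glim j q.1) q.2)
            atTop (Set.Icc 1 M ×ˢ Set.univ))) ∧
      -- the measures `λ_{σ,n;j,l;τ}`
      (∀ j l : Fin N, j ≠ l → ∀ τ ∈ ({1, -1, Complex.I, -Complex.I} : Set ℂ),
        (∀ k n : ℕ, nk k ≤ n → ∀ σ : ℝ, 1 ≤ σ →
          IsAbsContWithDensity (lambdaPair b j l τ σ n) (H j l τ σ n) ∧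
            ContDiff ℝ (k : ℕ∞) (H j l τ σ n)) ∧
        (∀ σ : ℝ, 1 ≤ σ →
          ConvergesWeakly (fun n => lambdaPair b j l τ σ n) (lam' j l τ σ) ∧
            IsAbsContWithDensity (lam' j l τ σ) (Hlim j l τ σ) ∧
            ContDiff ℝ (⊤ : ℕ∞) (Hlim j l τ σ)) ∧
        (∀ M : ℝ, 1 < M → ∀ k : ℕ,
          TendstoUniformlyOn
            (fun (n : ℕ) (q : ℝ × (Fin N → ℂ)) => iteratedFDeriv ℝ k (H j l τ q.1 n) q.2)
            (fun q : ℝ × (Fin N → ℂ) => iteratedFDeriv ℝ k (Hlim j l τ q.1) q.2)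
            atTop (Set.Icc 1 M ×ˢ Set.univ))) := by
  obtain ⟨θ, K, hθ, hK, hb⟩ := exists_common_coeffBound hII
  have hab : ∀ j m, a j (nthPrime m) = b j (nthPrime m) := fun j m =>
    coeff_prime_eq_of_hasLogEulerProduct (hI j) (hII j) (prime_nthPrime m)
  -- The constant and the exponent are those under which the first frequency dominates at a good
  -- prime; `2 * θ - 1 < 0` is where `θ < 1 / 2` meets orthogonality.
  choose n₀ hn₀ using fun t => horth.exists_good_primes (2 * N * K * geomConst θ + 1)
    (show 2 * θ - 1 < 0 by linarith) t
  simp_rw [hab] at hn₀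
  choose G lam Glim hG using fun j => exists_limit_densities_combined hb hθ hK hn₀
    (Pi.single j 1) (ν := lambdaSingle b j) fun σ n => by
      rw [combinedLogDeriv_single]; rfl
  choose H lam' Hlim hH using fun j l τ => exists_limit_densities_combined hb hθ hK hn₀
    (Pi.single j 1 + Pi.single l τ) (ν := lambdaPair b j l τ) fun σ n => by
      rw [combinedLogDeriv_pair]; rfl
  -- The thresholds are read off from `hG`; they do not involve the weight, so the same ones fit
  -- `hH`.
  exact ⟨_, G, H, lam, lam', Glim, Hlim, fun k => le_max_left _ _, hG,
    fun j l _ τ _ => hH j l τ⟩
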